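/- Let $k$ be a field and let $\mathcal C$ be a rigid abelian $k$-linear tensor category: an abelian $k$-linear category with finite-dimensional $\mathrm{Hom}$ spaces, in which every object has finite length, with a symmetric monoidal structure that is $k$-linear in each variable and in which every object $X$ has a dual $X^\vee$. Call a commutative $k$-algebra $A$ quasi-separable if it is finite over $k$ and $A_{\mathrm{red}}$ is separable over $k$. For a quasi-separable $A$, an $A$-module in $\mathcal C$ is an object $X$ with a $k$-algebra map $A\to\mathrm{End}(X)$. For a finitely generated $A$-module $M$, the objects $M\otimes_A X$ and $\underline{\mathrm{Hom}}_A(M,X)$ of $\mathcal C$ are defined by $\mathrm{Hom}(M\otimes_A X,Y)=\mathrm{Hom}_A(M,\mathrm{Hom}(X,Y))$ and $\mathrm{Hom}(Y,\underline{\mathrm{Hom}}_A(M,X))=\mathrm{Hom}_A(M,\mathrm{Hom}(Y,X))$. The module $X$ is flat if $M\mapsto M\otimes_A X$ is exact on finitely generated $A$-modules, and $A$-injective if the dual module $X^\vee$ (with the transposed action) is flat. For $A$-modules $X,Y$ in $\mathcal C$, $X\otimes_A Y$ is the largest quotient, and $X\otimes^A Y$ the largest subobject, of $X\otimes Y$ on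 which the two actions of $A$ agree. Let $E=(E_j)_{j\in J}$ be a pro-finite (quasi-separable) $k$-algebra, that is, a cofiltered system of quasi-separable $k$-algebras. A flat $E$-module in $\mathcal C$ is a system of flat $E_j$-modules $X_j$ in $\mathcal C$ with, for each $i\to j$ in $J$, an $E_i$-linear morphism $X_i\to X_j$, functorially in $i\to j$, inducing an isomorphism $E_j\otimes_{E_i}X_i\to X_j$. An $E$-injective module in $\mathcal C$ is a system of $E_j$-injective modules $X_j$ with, for each $i\to j$, an $E_i$-linear morphism $X_j\to X_i$, functorially in $i\to j$, inducing an isomorphism $X_j\to\underline{\mathrm{Hom}}_{E_i}(E_j,X_i)$. Let $\mathrm{Flat}_E(\mathcal C)$ and $\mathrm{Prolong}_E(\mathcal C)$ be the categories of these, with the compatible families of $E_j$-linear morphisms. Then the tensor products $(X\otimes Y)_j=X_j\otimes_{E_j}Y_j$, with unit $(E_j\otimes_k\mathbf 1)_j$ and the constraints induced from those of $\mathcal C$, make $\mathrm{Flat}_E(\mathcal C)$ an additive rigid $k$-linear tensor (symmetric monoidal) category; the dual tensor products $(X\otimes Y)_j=X_j\otimes^{E_j}Y_j$, with unit $(E_j^\vee\otimes_k\mathbf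 1)_j$ and the induced constraints, make $\mathrm{Prolong}_E(\mathcal C)$ an additive rigid $k$-linear tensor category (neither category is claimed to be abelian); and $(X_j)_j\mapsto (X_j^\vee)_j$, with the tensor structure given by the transposes $X_j^\vee\otimes Y_j^\vee\to (X_j\otimes^{E_j}Y_j)^\vee$ of the inclusions, is an equivalence of tensor categories $\mathrm{Prolong}_E(\mathcal C)\to\mathrm{Flat}_E(\mathcal C)^{\mathrm{op}}$. -/

import Mathlib

open CategoryTheory Limits MonoidalCategory Opposite

universe w u v₁ u₁ v₂ u₂

noncomputable section

namespace Prolong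

/-! ### Algebras and linear categories -/

/-- A commutative `k`-algebra `E` is quasi-separable if it is finite over `k` and the associated
reduced algebra is separable over `k`. -/
class IsQuasiSeparable (k : Type u) [Field k] (E : Type w) [CommRing E] [Algebra k E] : Prop
    extends Module.Finite k E where
  separable_reduced : Algebra.IsSeparable k (E ⧸ nilradical E)

/-- The finiteness conditions on a `k`-linear category: the spaces of morphisms are
finite dimensional, and the length of the strict chains of subobjects of a given object is
bounded. -/
class IsFiniteLinear (k : Type u) [Field k] (C : Type u₁) [Category.{v₁} C] [Preadditive C]
    [Linear k C] : Prop where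
  finite_hom : ∀ X Y : C, Module.Finite k (X ⟶ Y)
  finite_length : ∀ X : C, ∃ n : ℕ, ∀ s : LTSeries (Subobject X), s.length ≤ n

/-! ### Modules in a `k`-linear category -/

/-- An `E`-module in the `k`-linear category `C`: an object of `C` with an action of `E`. -/
structure ModuleIn (k : Type u) [Field k] (E : Type w) [CommRing E] [Algebra k E]
    (C : Type u₁) [Category.{v₁} C] [Preadditive C] [Linear k C] where
  obj : C
  act : E →ₐ[k] End obj

section Linear

variable {k : Type u} [Field k] {E : Type w} [CommRing E] [Algebra k E]
variable {C : Type u₁} [Category.{v₁} C] [Preadditive C] [Linear k C]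

/-- The action of an element of `E`, as a morphism of `C`. -/
def ModuleIn.smul (X : ModuleIn k E C) (e : E) : X.obj ⟶ X.obj := X.act e

lemma ModuleIn.smul_add (X : ModuleIn k E C) (a b : E) :
    X.smul (a + b) = X.smul a + X.smul b := map_add X.act a b

lemma ModuleIn.smul_one (X : ModuleIn k E C) : X.smul 1 = 𝟙 X.obj := map_one X.act

lemma ModuleIn.smul_zero (X : ModuleIn k E C) : X.smul 0 = 0 := map_zero X.act

lemma ModuleIn.smul_mul (X : ModuleIn k E C) (a b : E) :
    X.smul (a * b) = X.smul a ≫ X.smul b := by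
  rw [mul_comm]; exact map_mul X.act b a

/-- An object of `C`, viewed as a module over the base field `k`. -/
def ModuleIn.trivial (k : Type u) [Field k] {C : Type u₁} [Category.{v₁} C] [Preadditive C]
    [Linear k C] (X : C) : ModuleIn k k C := ⟨X, Algebra.ofId k (End X)⟩

variable {M : Type*} [AddCommGroup M] [Module E M]

/-- `β` is an `E`-linear map from `M` to the `E`-module `Hom(X, T)`. -/
def IsBalanced (X : ModuleIn k E C) {T : C} (β : M →+ (X.obj ⟶ T)) : Prop :=
  ∀ (e : E) (m : M), β (e • m) = X.smul e ≫ β m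

/-- `β` is an `E`-linear map from `M` to the `E`-module `Hom(T, X)`. -/
def IsCobalanced (X : ModuleIn k E C) {T : C} (β : M →+ (T ⟶ X.obj)) : Prop :=
  ∀ (e : E) (m : M), β (e • m) = β m ≫ X.smul e

/-- `T`, with the `E`-linear map `β : M → Hom(X, T)`, is the object `M ⊗_E X`, that is,
`Hom(T, Y) = Hom_E(M, Hom(X, Y))` via `β`. -/
structure IsTensor (X : ModuleIn k E C) {T : C} (β : M →+ (X.obj ⟶ T)) : Prop where
  balanced : IsBalanced X β
  existsUnique : ∀ (Y : C) (γ : M →+ (X.obj ⟶ Y)), IsBalanced X γ →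
    ∃! h : T ⟶ Y, ∀ m, β m ≫ h = γ m

/-- `T`, with the `E`-linear map `β : M → Hom(T, X)`, is the object `\underline{Hom}_E(M, X)`,
that is, `Hom(Y, T) = Hom_E(M, Hom(Y, X))` via `β`. -/
structure IsHom (X : ModuleIn k E C) {T : C} (β : M →+ (T ⟶ X.obj)) : Prop where
  cobalanced : IsCobalanced X β
  existsUnique : ∀ (Y : C) (γ : M →+ (Y ⟶ X.obj)), IsCobalanced X γ →
    ∃! h : Y ⟶ T, ∀ m, h ≫ β m = γ m

end Linear

section Flat

variable {k : Type u} [Field k] {E : Type w} [CommRing E] [Algebra k E] [Module.Finite k E]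
variable {C : Type u₁} [Category.{v₁} C] [Abelian C] [Linear k C]

lemma exists_isTensor (M : Type w) [AddCommGroup M] [Module E M] [Module.Finite E M]
    (X : ModuleIn k E C) : ∃ (T : C) (β : M →+ (X.obj ⟶ T)), IsTensor X β := by
  classical
  have : IsNoetherianRing E := IsNoetherianRing.of_finite k E
  have : HasFiniteBiproducts C := Abelian.hasFiniteBiproducts
  obtain ⟨n, f, hf⟩ := Module.Finite.exists_fin' E M
  obtain ⟨m, r, hr⟩ := Submodule.fg_iff_exists_fin_generating_family.mp
    (IsNoetherian.noetherian (LinearMap.ker f))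
  let rel : (⨁ fun _ : Fin m => X.obj) ⟶ (⨁ fun _ : Fin n => X.obj) :=
    biproduct.matrix fun i j => X.smul (r i j)
  let q : Fin n → (X.obj ⟶ cokernel rel) := fun j =>
    biproduct.ι (fun _ : Fin n => X.obj) j ≫ cokernel.π rel
  let g : (Fin n → E) →+ (X.obj ⟶ cokernel rel) :=
    { toFun := fun v => ∑ j, X.smul (v j) ≫ q j
      map_zero' := by simp [ModuleIn.smul_zero]
      map_add' := fun v w => by
        simp [ModuleIn.smul_add, Preadditive.add_comp, Finset.sum_add_distrib] }
  have hg_smul : ∀ (e : E) v, g (e • v) = X.smul e ≫ g v := fun e v => by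
    simp [g, ModuleIn.smul_mul, Preadditive.comp_sum]
  have hg_rel : ∀ i, g (r i) = 0 := fun i => by
    have h : biproduct.ι (fun _ : Fin m => X.obj) i ≫ rel ≫ cokernel.π rel = 0 := by simp
    rw [← h, ← Category.assoc, biproduct.ι_matrix, biproduct.lift_eq, Preadditive.sum_comp]
    simp [g, q]
  have hg_ker : ∀ v, f v = 0 → g v = 0 := fun v hv => by
    have hv' : v ∈ Submodule.span E (Set.range r) := by rw [hr]; exact hv
    induction hv' using Submodule.span_induction with
    | mem x hx => obtain ⟨i, rfl⟩ := hx; exact hg_rel i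
    | zero => exact map_zero g
    | add x y hx hy ihx ihy =>
      have hx0 : f x = 0 := by rw [← LinearMap.mem_ker, ← hr]; exact hx
      have hy0 : f y = 0 := by rw [← LinearMap.mem_ker, ← hr]; exact hy
      rw [map_add, ihx hx0, ihy hy0, add_zero]
    | smul e x hx ih =>
      have hx0 : f x = 0 := by rw [← LinearMap.mem_ker, ← hr]; exact hx
      rw [hg_smul, ih hx0, comp_zero]
  have hg_eq : ∀ v w, f v = f w → g v = g w := fun v w h => by
    have := hg_ker (v - w) (by rw [map_sub, h, sub_self])
    rwa [map_sub, sub_eq_zero] at this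
  choose s hs using hf
  let β : M →+ (X.obj ⟶ cokernel rel) :=
    { toFun := fun x => g (s x)
      map_zero' := by rw [hg_eq _ 0 (by rw [hs, map_zero]), map_zero]
      map_add' := fun x y => by
        rw [← map_add]; exact hg_eq _ _ (by rw [hs, map_add, hs, hs]) }
  have hβ : ∀ v, β (f v) = g v := fun v => hg_eq _ _ (hs _)
  have hg_single : ∀ j, g (Pi.single j 1) = q j := fun j => by
    change ∑ i, X.smul ((Pi.single j 1 : Fin n → E) i) ≫ q i = q j
    rw [Finset.sum_eq_single j]
    · simp [ModuleIn.smul_one]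
    · intro i _ hij
      simp [Pi.single_eq_of_ne hij, ModuleIn.smul_zero]
    · simp
  refine ⟨cokernel rel, β, ?_, ?_⟩
  · intro e x
    rw [← hs x, ← map_smul, hβ, hβ, hg_smul]
  · intro Y γ hγ
    have hγ_f : ∀ v, γ (f v) = ∑ j, X.smul (v j) ≫ γ (f (Pi.single j 1)) := fun v => by
      conv_lhs => rw [pi_eq_sum_univ' v]
      simp only [map_sum]
      refine Finset.sum_congr rfl fun j _ => ?_
      rw [← hγ, ← map_smul]
    have hd : rel ≫ biproduct.desc (fun j => γ (f (Pi.single j 1))) = 0 := by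
      ext i
      have h0 : f (r i) = 0 := by
        rw [← LinearMap.mem_ker, ← hr]; exact Submodule.subset_span ⟨i, rfl⟩
      have h1 := hγ_f (r i)
      rw [h0, map_zero] at h1
      rw [comp_zero, h1, ← Category.assoc, biproduct.ι_matrix, biproduct.lift_desc]
    refine ⟨cokernel.desc rel _ hd, ?_, ?_⟩
    · intro x
      rw [← hs x, hβ, hγ_f]
      simp [g, q, Preadditive.sum_comp]
    · intro h hh
      apply coequalizer.hom_ext
      apply biproduct.hom_ext'
      intro j
      have h1 := hh (f (Pi.single j 1))
      rw [hβ, hg_single] at h1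
      have h2 : biproduct.ι (fun _ : Fin n => X.obj) j ≫ cokernel.π rel ≫ h =
          γ (f (Pi.single j 1)) := by rw [← h1, Category.assoc]
      refine h2.trans ?_
      symm
      exact (by simp : biproduct.ι (fun _ : Fin n => X.obj) j ≫ cokernel.π rel ≫
        cokernel.desc rel _ hd = γ (f (Pi.single j 1)))

/-- The object `M ⊗_E X` of `C`. -/
def tensorObj (M : Type w) [AddCommGroup M] [Module E M] [Module.Finite E M]
    (X : ModuleIn k E C) : C := (exists_isTensor M X).choose

/-- The universal `E`-linear map `M → Hom(X, M ⊗_E X)`. -/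
def tensorMk (M : Type w) [AddCommGroup M] [Module E M] [Module.Finite E M]
    (X : ModuleIn k E C) : M →+ (X.obj ⟶ tensorObj M X) := (exists_isTensor M X).choose_spec.choose

lemma isTensor_tensorMk (M : Type w) [AddCommGroup M] [Module E M] [Module.Finite E M]
    (X : ModuleIn k E C) : IsTensor X (tensorMk M X) := (exists_isTensor M X).choose_spec.choose_spec

section

variable {M N : Type w} [AddCommGroup M] [Module E M] [Module.Finite E M]
  [AddCommGroup N] [Module E N] [Module.Finite E N]

lemma exists_tensorMap (f : M →ₗ[E] N) (X : ModuleIn k E C) :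
    ∃! h : tensorObj M X ⟶ tensorObj N X, ∀ m, tensorMk M X m ≫ h = tensorMk N X (f m) :=
  (isTensor_tensorMk M X).existsUnique _ ((tensorMk N X).comp f.toAddMonoidHom) (by
    intro e m
    simpa using (isTensor_tensorMk N X).balanced e (f m))

/-- The morphism `f ⊗_E X : M ⊗_E X ⟶ N ⊗_E X`. -/
def tensorMap (f : M →ₗ[E] N) (X : ModuleIn k E C) : tensorObj M X ⟶ tensorObj N X :=
  (exists_tensorMap f X).choose

lemma tensorMk_tensorMap (f : M →ₗ[E] N) (X : ModuleIn k E C) (m : M) :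
    tensorMk M X m ≫ tensorMap f X = tensorMk N X (f m) :=
  (exists_tensorMap f X).choose_spec.1 m

lemma tensor_hom_ext (X : ModuleIn k E C) {Y : C} {f g : tensorObj M X ⟶ Y}
    (h : ∀ m, tensorMk M X m ≫ f = tensorMk M X m ≫ g) : f = g := by
  let γ : M →+ (X.obj ⟶ Y) :=
    { toFun := fun m => tensorMk M X m ≫ g
      map_zero' := by simp
      map_add' := by simp }
  refine ((isTensor_tensorMk M X).existsUnique Y γ ?_).unique h (fun _ => rfl)
  intro e m
  change tensorMk M X (e • m) ≫ g = X.smul e ≫ tensorMk M X m ≫ g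
  rw [(isTensor_tensorMk M X).balanced e m, Category.assoc]

end

/-- The functor `M ↦ M ⊗_E X` from finitely generated `E`-modules to `C`. -/
def tensorFunctor (X : ModuleIn k E C) : FGModuleCat.{w} E ⥤ C where
  obj M := tensorObj M X
  map f := tensorMap f.hom.hom X
  map_id M := by
    apply tensor_hom_ext
    intro m
    rw [tensorMk_tensorMap]
    simp
  map_comp f g := by
    apply tensor_hom_ext
    intro m
    rw [tensorMk_tensorMap, ← Category.assoc, tensorMk_tensorMap, tensorMk_tensorMap]
    simp

/-- `X` is flat if the functor `M ↦ M ⊗_E X` on finitely generated `E`-modules is exact. -/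
structure ModuleIn.IsFlat (X : ModuleIn k E C) : Prop where
  preservesFiniteLimits : PreservesFiniteLimits (tensorFunctor X)
  preservesFiniteColimits : PreservesFiniteColimits (tensorFunctor X)

end Flat

/-! ### Systems of modules over a pro-finite algebra

A pro-finite algebra is a cofiltered system `E : J ⥤ CommAlgCat k` of finite algebras. -/

section Systems

variable {k : Type u} [Field k] {J : Type u₂} [Category.{v₂} J]

section Def

variable (E : J ⥤ CommAlgCat.{w} k) (C : Type u₁) [Category.{v₁} C] [Preadditive C] [Linear k C]

/-- A functorial system of `E_j`-modules `X_j` in `C` and, for `f : i ⟶ j`, morphisms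
`X_i ⟶ X_j` that are semilinear along `E_i → E_j`. -/
structure ModuleSystem where
  module : ∀ j : J, ModuleIn k (E.obj j) C
  map : ∀ {i j : J}, (i ⟶ j) → ((module i).obj ⟶ (module j).obj)
  map_id : ∀ j, map (𝟙 j) = 𝟙 (module j).obj
  map_comp : ∀ {i j l : J} (f : i ⟶ j) (g : j ⟶ l), map (f ≫ g) = map f ≫ map g
  smul_map : ∀ {i j : J} (f : i ⟶ j) (e : E.obj i),
    (module i).smul e ≫ map f = map f ≫ (module j).smul ((E.map f).hom e)

/-- A functorial system of `E_j`-modules `X_j` in `C` and, for `f : i ⟶ j`, morphisms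
`X_j ⟶ X_i` that are `E_i`-linear, where `E_i` acts on `X_j` via `E_i → E_j`. -/
structure DualModuleSystem where
  module : ∀ j : J, ModuleIn k (E.obj j) C
  map : ∀ {i j : J}, (i ⟶ j) → ((module j).obj ⟶ (module i).obj)
  map_id : ∀ j, map (𝟙 j) = 𝟙 (module j).obj
  map_comp : ∀ {i j l : J} (f : i ⟶ j) (g : j ⟶ l), map (f ≫ g) = map g ≫ map f
  map_smul : ∀ {i j : J} (f : i ⟶ j) (e : E.obj i),
    map f ≫ (module i).smul e = (module j).smul ((E.map f).hom e) ≫ map f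

end Def

variable {E : J ⥤ CommAlgCat.{w} k} {C : Type u₁} [Category.{v₁} C] [Preadditive C] [Linear k C]

/-- Morphisms of systems: compatible families of `E_j`-linear morphisms. -/
@[ext]
structure ModuleSystem.Hom (X Y : ModuleSystem E C) where
  app : ∀ j, (X.module j).obj ⟶ (Y.module j).obj
  smul_app : ∀ j (e : E.obj j), (X.module j).smul e ≫ app j = app j ≫ (Y.module j).smul e
  naturality : ∀ {i j : J} (f : i ⟶ j), X.map f ≫ app j = app i ≫ Y.map f

/-- Morphisms of systems: compatible families of `E_j`-linear morphisms. -/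
@[ext]
structure DualModuleSystem.Hom (X Y : DualModuleSystem E C) where
  app : ∀ j, (X.module j).obj ⟶ (Y.module j).obj
  smul_app : ∀ j (e : E.obj j), (X.module j).smul e ≫ app j = app j ≫ (Y.module j).smul e
  naturality : ∀ {i j : J} (f : i ⟶ j), X.map f ≫ app i = app j ≫ Y.map f

namespace ModuleSystem

instance : Category (ModuleSystem E C) where
  Hom := Hom
  id X := ⟨fun j => 𝟙 _, by simp, by simp⟩
  comp f g := ⟨fun j => f.app j ≫ g.app j,
    fun j e => by rw [← Category.assoc, f.smul_app, Category.assoc, g.smul_app, Category.assoc],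
    fun h => by rw [← Category.assoc, f.naturality, Category.assoc, g.naturality, Category.assoc]⟩
  id_comp f := Hom.ext (funext fun j => Category.id_comp _)
  comp_id f := Hom.ext (funext fun j => Category.comp_id _)
  assoc f g h := Hom.ext (funext fun j => Category.assoc _ _ _)

variable {X Y : ModuleSystem E C}

@[ext] lemma hom_ext {f g : X ⟶ Y} (h : ∀ j, f.app j = g.app j) : f = g := Hom.ext (funext h)

instance : Add (X ⟶ Y) := ⟨fun f g => ⟨fun j => f.app j + g.app j,
  by simp [f.smul_app, g.smul_app], by simp [f.naturality, g.naturality]⟩⟩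

instance : Neg (X ⟶ Y) := ⟨fun f => ⟨fun j => - f.app j,
  by simp [f.smul_app], by simp [f.naturality]⟩⟩

instance : Zero (X ⟶ Y) := ⟨⟨fun j => 0, by simp, by simp⟩⟩

instance : SMul k (X ⟶ Y) := ⟨fun r f =>
  ⟨fun j => r • f.app j, by simp [f.smul_app], by simp [f.naturality]⟩⟩

instance : AddCommGroup (X ⟶ Y) where
  add_assoc _ _ _ := hom_ext fun _ => add_assoc _ _ _
  zero_add _ := hom_ext fun _ => zero_add _
  add_zero _ := hom_ext fun _ => add_zero _
  add_comm _ _ := hom_ext fun _ => add_comm _ _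
  neg_add_cancel _ := hom_ext fun _ => neg_add_cancel _
  nsmul := nsmulRec
  zsmul := zsmulRec

instance : Module k (X ⟶ Y) where
  one_smul _ := hom_ext fun _ => one_smul _ _
  mul_smul _ _ _ := hom_ext fun _ => mul_smul _ _ _
  smul_zero _ := hom_ext fun _ => smul_zero _
  smul_add _ _ _ := hom_ext fun _ => smul_add _ _ _
  add_smul _ _ _ := hom_ext fun _ => add_smul _ _ _
  zero_smul _ := hom_ext fun _ => zero_smul _ _

instance : Preadditive (ModuleSystem E C) where
  add_comp _ _ _ _ _ _ := hom_ext fun _ => Preadditive.add_comp _ _ _ _ _ _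
  comp_add _ _ _ _ _ _ := hom_ext fun _ => Preadditive.comp_add _ _ _ _ _ _

instance : Linear k (ModuleSystem E C) where
  smul_comp _ _ _ _ _ _ := hom_ext fun _ => Linear.smul_comp _ _ _ _ _ _
  comp_smul _ _ _ _ _ _ := hom_ext fun _ => Linear.comp_smul _ _ _ _ _ _

/-- The functor sending a system to its member `X_j`. -/
def eval (j : J) : ModuleSystem E C ⥤ C where
  obj X := (X.module j).obj
  map f := f.app j

/-- For `f : i ⟶ j`, the algebra `E_j` is an `E_i`-module, and an `E_i`-semilinear morphism
`X_i ⟶ X_j` amounts to the `E_i`-linear map `E_j → Hom(X_i, X_j)`, `b ↦ b • X.map f`. -/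
def transition (X : ModuleSystem E C) {i j : J} (f : i ⟶ j) :
    E.obj j →+ ((X.module i).obj ⟶ (X.module j).obj) where
  toFun b := X.map f ≫ (X.module j).smul b
  map_zero' := by rw [ModuleIn.smul_zero, comp_zero]
  map_add' a b := by rw [ModuleIn.smul_add, Preadditive.comp_add]

/-- The system is Cartesian: all the morphisms `E_j ⊗_{E_i} X_i ⟶ X_j` are isomorphisms. -/
def IsCartesian (X : ModuleSystem E C) : Prop :=
  ∀ {i j : J} (f : i ⟶ j),
    letI : Module (E.obj i) (E.obj j) := Module.compHom _ (E.map f).hom.toRingHom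
    IsTensor (X.module i) (X.transition f)

end ModuleSystem

namespace DualModuleSystem

instance : Category (DualModuleSystem E C) where
  Hom := Hom
  id X := ⟨fun j => 𝟙 _, by simp, by simp⟩
  comp f g := ⟨fun j => f.app j ≫ g.app j,
    fun j e => by rw [← Category.assoc, f.smul_app, Category.assoc, g.smul_app, Category.assoc],
    fun h => by rw [← Category.assoc, f.naturality, Category.assoc, g.naturality, Category.assoc]⟩
  id_comp f := Hom.ext (funext fun j => Category.id_comp _)
  comp_id f := Hom.ext (funext fun j => Category.comp_id _)
  assoc f g h := Hom.ext (funext fun j => Category.assoc _ _ _)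

variable {X Y : DualModuleSystem E C}

@[ext] lemma hom_ext {f g : X ⟶ Y} (h : ∀ j, f.app j = g.app j) : f = g := Hom.ext (funext h)

instance : Add (X ⟶ Y) := ⟨fun f g => ⟨fun j => f.app j + g.app j,
  by simp [f.smul_app, g.smul_app], by simp [f.naturality, g.naturality]⟩⟩

instance : Neg (X ⟶ Y) := ⟨fun f => ⟨fun j => - f.app j,
  by simp [f.smul_app], by simp [f.naturality]⟩⟩

instance : Zero (X ⟶ Y) := ⟨⟨fun j => 0, by simp, by simp⟩⟩

instance : SMul k (X ⟶ Y) := ⟨fun r f =>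
  ⟨fun j => r • f.app j, by simp [f.smul_app], by simp [f.naturality]⟩⟩

instance : AddCommGroup (X ⟶ Y) where
  add_assoc _ _ _ := hom_ext fun _ => add_assoc _ _ _
  zero_add _ := hom_ext fun _ => zero_add _
  add_zero _ := hom_ext fun _ => add_zero _
  add_comm _ _ := hom_ext fun _ => add_comm _ _
  neg_add_cancel _ := hom_ext fun _ => neg_add_cancel _
  nsmul := nsmulRec
  zsmul := zsmulRec

instance : Module k (X ⟶ Y) where
  one_smul _ := hom_ext fun _ => one_smul _ _
  mul_smul _ _ _ := hom_ext fun _ => mul_smul _ _ _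
  smul_zero _ := hom_ext fun _ => smul_zero _
  smul_add _ _ _ := hom_ext fun _ => smul_add _ _ _
  add_smul _ _ _ := hom_ext fun _ => add_smul _ _ _
  zero_smul _ := hom_ext fun _ => zero_smul _ _

instance : Preadditive (DualModuleSystem E C) where
  add_comp _ _ _ _ _ _ := hom_ext fun _ => Preadditive.add_comp _ _ _ _ _ _
  comp_add _ _ _ _ _ _ := hom_ext fun _ => Preadditive.comp_add _ _ _ _ _ _

instance : Linear k (DualModuleSystem E C) where
  smul_comp _ _ _ _ _ _ := hom_ext fun _ => Linear.smul_comp _ _ _ _ _ _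
  comp_smul _ _ _ _ _ _ := hom_ext fun _ => Linear.comp_smul _ _ _ _ _ _

/-- The functor sending a system to its member `X_j`. -/
def eval (j : J) : DualModuleSystem E C ⥤ C where
  obj X := (X.module j).obj
  map f := f.app j

/-- For `f : i ⟶ j`, the algebra `E_j` is an `E_i`-module, and an `E_i`-linear morphism
`X_j ⟶ X_i` amounts to the `E_i`-linear map `E_j → Hom(X_j, X_i)`, `b ↦ X.map f ∘ b`. -/
def transition (X : DualModuleSystem E C) {i j : J} (f : i ⟶ j) :
    E.obj j →+ ((X.module j).obj ⟶ (X.module i).obj) where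
  toFun b := (X.module j).smul b ≫ X.map f
  map_zero' := by rw [ModuleIn.smul_zero, zero_comp]
  map_add' a b := by rw [ModuleIn.smul_add, Preadditive.add_comp]

/-- The system is Cartesian: all the morphisms `X_j ⟶ \underline{Hom}_{E_i}(E_j, X_i)` are
isomorphisms. -/
def IsCartesian (X : DualModuleSystem E C) : Prop :=
  ∀ {i j : J} (f : i ⟶ j),
    letI : Module (E.obj i) (E.obj j) := Module.compHom _ (E.map f).hom.toRingHom
    IsHom (X.module i) (X.transition f)

end DualModuleSystem

end Systems

/-! ### Duality -/

section Mates

variable {C : Type u₁} [Category.{v₁} C] [MonoidalCategory C]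

lemma pairing_injective_left {X Y Z : C} [ExactPairing Y Z] {f g : X ⟶ Y}
    (h : Z ◁ f ≫ ε_ Y Z = Z ◁ g ≫ ε_ Y Z) : f = g := by
  have key : ∀ f : X ⟶ Y, (tensorLeftHomEquiv X Y Z (𝟙_ C)).symm (f ≫ (ρ_ Y).inv) =
      Z ◁ f ≫ ε_ Y Z := fun f => by
    rw [tensorLeftHomEquiv_symm_naturality]
    congr 1
    simp [tensorLeftHomEquiv, unitors_equal]
  have h2 := (key f).trans (h.trans (key g).symm)
  simpa using (tensorLeftHomEquiv X Y Z (𝟙_ C)).symm.injective h2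

lemma pairing_injective_right {X Y Z : C} [ExactPairing Y Z] {f g : X ⟶ Z}
    (h : f ▷ Y ≫ ε_ Y Z = g ▷ Y ≫ ε_ Y Z) : f = g := by
  have key : ∀ f : X ⟶ Z, (tensorRightHomEquiv X Y Z (𝟙_ C)).symm (f ≫ (λ_ Z).inv) =
      f ▷ Y ≫ ε_ Y Z := fun f => by
    rw [tensorRightHomEquiv_symm_naturality]
    congr 1
    simp [tensorRightHomEquiv, ← unitors_equal]
  have h2 := (key f).trans (h.trans (key g).symm)
  simpa using (tensorRightHomEquiv X Y Z (𝟙_ C)).symm.injective h2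

variable {X Y : C} [HasRightDual X] [HasRightDual Y]

lemma leftMate_mate (f : X ⟶ Y) : (ᘁ(fᘁ : Yᘁ ⟶ Xᘁ)) = f :=
  pairing_injective_left (Z := Yᘁ)
    ((leftAdjointMate_comp_evaluation (fᘁ : Yᘁ ⟶ Xᘁ)).trans (rightAdjointMate_comp_evaluation f))

lemma mate_leftMate (f : Yᘁ ⟶ Xᘁ) : ((ᘁf : X ⟶ Y)ᘁ : Yᘁ ⟶ Xᘁ) = f :=
  pairing_injective_right (Y := X)
    ((rightAdjointMate_comp_evaluation (ᘁf : X ⟶ Y)).trans (leftAdjointMate_comp_evaluation f))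

variable [Preadditive C] [MonoidalPreadditive C]

lemma mate_add (f g : X ⟶ Y) : (f + g)ᘁ = (fᘁ : Yᘁ ⟶ Xᘁ) + gᘁ := by
  simp [rightAdjointMate, MonoidalPreadditive.add_whiskerRight,
    MonoidalPreadditive.whiskerLeft_add]

lemma mate_zero : ((0 : X ⟶ Y)ᘁ : Yᘁ ⟶ Xᘁ) = 0 := by
  simp [rightAdjointMate]

lemma mate_smul {k : Type u} [Field k] [Linear k C] [MonoidalLinear k C] (r : k) (f : X ⟶ Y) :
    (r • f)ᘁ = r • (fᘁ : Yᘁ ⟶ Xᘁ) := by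
  simp [rightAdjointMate]

/-- Transposition, as an isomorphism of groups. -/
def mateEquiv (X Y : C) [HasRightDual X] [HasRightDual Y] : (X ⟶ Y) ≃+ (Yᘁ ⟶ Xᘁ) where
  toFun f := fᘁ
  invFun f := (ᘁf : X ⟶ Y)
  left_inv := leftMate_mate
  right_inv := mate_leftMate
  map_add' := mate_add

lemma IsHom.existsUnique_mate {k : Type u} [Field k] [Linear k C] {E : Type w} [CommRing E]
    [Algebra k E] {M : Type*} [AddCommGroup M] [Module E M] {X : ModuleIn k E C} {T P : C}
    {β : M →+ (T ⟶ X.obj)} (h : IsHom X β) [HasRightDual X.obj] [HasRightDual T] [HasRightDual P]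
    (γ : M →+ ((X.obj)ᘁ ⟶ Pᘁ)) (hγ : ∀ e m, γ (e • m) = (X.smul e)ᘁ ≫ γ m) :
    ∃! g : Tᘁ ⟶ Pᘁ, ∀ m, (β m)ᘁ ≫ g = γ m := by
  obtain ⟨t, ht, htu⟩ := h.existsUnique P ((mateEquiv P X.obj).symm.toAddMonoidHom.comp γ) (by
    intro e m
    apply (mateEquiv P X.obj).injective
    refine ((mateEquiv P X.obj).apply_symm_apply _).trans ((hγ e m).trans ?_)
    refine Eq.trans ?_ (comp_rightAdjointMate (f := (mateEquiv P X.obj).symm (γ m))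
      (g := X.smul e)).symm
    congr 1
    exact ((mateEquiv P X.obj).apply_symm_apply (γ m)).symm)
  have key : ∀ (g : P ⟶ T) m, (β m)ᘁ ≫ (gᘁ : Tᘁ ⟶ Pᘁ) = γ m ↔
      g ≫ β m = (mateEquiv P X.obj).symm (γ m) := fun g m => by
    rw [← comp_rightAdjointMate, AddEquiv.eq_symm_apply]; rfl
  refine ⟨tᘁ, fun m => (key t m).mpr (ht m), fun g hg => ?_⟩
  obtain ⟨g, rfl⟩ := (mateEquiv P T).surjective g
  exact congrArg (mateEquiv P T) (htu g fun m => (key g m).mp (hg m))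

end Mates

section Dual

variable {k : Type u} [Field k] {C : Type u₁} [Category.{v₁} C] [Preadditive C] [Linear k C]
  [MonoidalCategory C] [MonoidalPreadditive C] [MonoidalLinear k C] [RigidCategory C]

section

variable {E : Type w} [CommRing E] [Algebra k E]

/-- The dual `X^∨` of an `E`-module, on which `e` acts as the transpose of its action on `X`. -/
def ModuleIn.dual (X : ModuleIn k E C) : ModuleIn k E C where
  obj := (X.obj)ᘁ
  act := AlgHom.ofLinearMap
    { toFun := fun e => ((X.smul e)ᘁ : (X.obj)ᘁ ⟶ (X.obj)ᘁ)
      map_add' := fun a b => by rw [X.smul_add, mate_add]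
      map_smul' := fun r e => by
        have h : X.smul (r • e) = r • X.smul e := map_smul X.act r e
        rw [h, mate_smul]; rfl }
    (by
      change (X.smul 1)ᘁ = 𝟙 _
      rw [X.smul_one, rightAdjointMate_id])
    (fun a b => by
      change (X.smul (a * b))ᘁ = (X.smul b)ᘁ ≫ (X.smul a)ᘁ
      rw [X.smul_mul, comp_rightAdjointMate])

@[simp] lemma ModuleIn.dual_smul (X : ModuleIn k E C) (e : E) :
    X.dual.smul e = (X.smul e)ᘁ := rfl

/-- Duality exchanges `\underline{Hom}_E(M, X)` and `M ⊗_E X^∨`. -/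
lemma IsHom.dual {M : Type*} [AddCommGroup M] [Module E M] {X : ModuleIn k E C} {T : C}
    {β : M →+ (T ⟶ X.obj)} (h : IsHom X β) (δ : M →+ (X.dual.obj ⟶ Tᘁ))
    (hδ : ∀ m, δ m = (β m)ᘁ) : IsTensor X.dual δ where
  balanced e m := by
    rw [hδ, hδ, h.cobalanced]; exact comp_rightAdjointMate
  existsUnique Y γ hγ := by
    have key := @IsHom.existsUnique_mate C _ _ _ _ k _ _ E _ _ M _ _ X T (ᘁY : C) β h _ _
      hasRightDualLeftDual γ hγ
    simp only [hδ]
    exact key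

end

/-- The dual of a system, formed member by member. -/
def DualModuleSystem.dual {J : Type u₂} [Category.{v₂} J] {E : J ⥤ CommAlgCat.{w} k}
    (X : DualModuleSystem E C) : ModuleSystem E C where
  module j := (X.module j).dual
  map f := (X.map f)ᘁ
  map_id j := by rw [X.map_id, rightAdjointMate_id]; rfl
  map_comp f g := by rw [X.map_comp]; exact comp_rightAdjointMate
  smul_map f e :=
    comp_rightAdjointMate.symm.trans
      ((congrArg rightAdjointMate (X.map_smul f e)).trans comp_rightAdjointMate)

lemma DualModuleSystem.IsCartesian.dual {J : Type u₂} [Category.{v₂} J]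
    {E : J ⥤ CommAlgCat.{w} k} {X : DualModuleSystem E C} (h : X.IsCartesian) :
    X.dual.IsCartesian := fun {i j} f => by
  let : Module (E.obj i) (E.obj j) := Module.compHom _ (E.map f).hom.toRingHom
  exact IsHom.dual (h f) _ fun _ => comp_rightAdjointMate.symm

end Dual

/-! ### Flat modules and injective modules over a pro-finite algebra -/

section Categories

variable {k : Type u} [Field k] {J : Type u₂} [Category.{v₂} J] (E : J ⥤ CommAlgCat.{w} k)
  [∀ j, Module.Finite k (E.obj j)] (C : Type u₁) [Category.{v₁} C] [Abelian C] [Linear k C]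

/-- The Cartesian systems of flat modules. -/
def isFlatSystem : ObjectProperty (ModuleSystem E C) :=
  fun X => (∀ j, (X.module j).IsFlat) ∧ X.IsCartesian

/-- The category of flat `E`-modules in `C`: the limit of the categories of flat `E_j`-modules
along the functors `E_j ⊗_{E_i} -`. -/
abbrev FlatCat := (isFlatSystem E C).FullSubcategory

/-- The functor sending a flat `E`-module to the object underlying its `E_j`-module. -/
def FlatCat.eval (j : J) : FlatCat E C ⥤ C := (isFlatSystem E C).ι ⋙ ModuleSystem.eval j

variable [MonoidalCategory C] [MonoidalPreadditive C] [MonoidalLinear k C] [RigidCategory C]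

/-- An `E`-module in a rigid category is `E`-injective if its dual is flat. -/
def ModuleIn.IsInjective {A : Type w} [CommRing A] [Algebra k A] [Module.Finite k A]
    {C : Type u₁} [Category.{v₁} C] [Abelian C] [Linear k C]
    [MonoidalCategory C] [MonoidalPreadditive C] [MonoidalLinear k C] [RigidCategory C]
    (X : ModuleIn k A C) : Prop := X.dual.IsFlat

/-- The Cartesian systems of injective modules. -/
def isInjectiveSystem : ObjectProperty (DualModuleSystem E C) :=
  fun X => (∀ j, (X.module j).IsInjective) ∧ X.IsCartesian

/-- The `E`-prolongation of `C`, the category of `E`-injective modules in `C`: the limit of the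
categories of `E_j`-injective modules along the functors `\underline{Hom}_{E_i}(E_j, -)`. -/
abbrev ProlongCat := (isInjectiveSystem E C).FullSubcategory

/-- The functor sending an `E`-injective module to the object underlying its `E_j`-module. -/
def ProlongCat.eval (j : J) : ProlongCat E C ⥤ C :=
  (isInjectiveSystem E C).ι ⋙ DualModuleSystem.eval j

/-- The functor `X ↦ X^∨`. -/
def dualFunctor : ProlongCat E C ⥤ (FlatCat E C)ᵒᵖ where
  obj X := op ⟨X.obj.dual, X.property.1, DualModuleSystem.IsCartesian.dual X.property.2⟩
  map {X Y} f := Quiver.Hom.op (ObjectProperty.homMk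
    { app := fun j => ((f.hom.app j)ᘁ : ((Y.obj.module j).obj)ᘁ ⟶ ((X.obj.module j).obj)ᘁ)
      smul_app := fun j e => comp_rightAdjointMate.symm.trans
        ((congrArg rightAdjointMate (f.hom.smul_app j e).symm).trans comp_rightAdjointMate)
      naturality := fun g => comp_rightAdjointMate.symm.trans
        ((congrArg rightAdjointMate (f.hom.naturality g).symm).trans comp_rightAdjointMate) })
  map_id _ := Quiver.Hom.unop_inj <| ObjectProperty.hom_ext _ <| ModuleSystem.hom_ext fun _ =>
    rightAdjointMate_id
  map_comp _ _ := Quiver.Hom.unop_inj <| ObjectProperty.hom_ext _ <|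
    ModuleSystem.hom_ext fun _ => comp_rightAdjointMate

end Categories

/-! ### Tensor structures -/

section Tensor

section Finite

variable {k : Type u} [Field k] {A : Type w} [CommRing A] [Algebra k A]
  {C : Type u₁} [Category.{v₁} C] [Preadditive C] [Linear k C] [MonoidalCategory C]

/-- `Z`, with the morphism `μ : X ⊗ Y ⟶ Z`, is the tensor product `X ⊗_A Y`: the largest quotient
of `X ⊗ Y` on which the two actions of `A` agree, with the action of `A` coming from either. -/
structure IsTensorProduct (X Y Z : ModuleIn k A C) (μ : X.obj ⊗ Y.obj ⟶ Z.obj) : Prop where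
  smul_left : ∀ a : A, X.smul a ▷ Y.obj ≫ μ = μ ≫ Z.smul a
  smul_right : ∀ a : A, X.obj ◁ Y.smul a ≫ μ = μ ≫ Z.smul a
  existsUnique : ∀ (T : C) (g : X.obj ⊗ Y.obj ⟶ T),
    (∀ a : A, X.smul a ▷ Y.obj ≫ g = X.obj ◁ Y.smul a ≫ g) → ∃! h : Z.obj ⟶ T, μ ≫ h = g

/-- `Z`, with the morphism `δ : Z ⟶ X ⊗ Y`, is the dual tensor product `X ⊗^A Y`: the largest
subobject of `X ⊗ Y` on which the two actions of `A` agree, with the action of `A` coming from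
either. -/
structure IsDualTensorProduct (X Y Z : ModuleIn k A C) (δ : Z.obj ⟶ X.obj ⊗ Y.obj) : Prop where
  smul_left : ∀ a : A, δ ≫ X.smul a ▷ Y.obj = Z.smul a ≫ δ
  smul_right : ∀ a : A, δ ≫ X.obj ◁ Y.smul a = Z.smul a ≫ δ
  existsUnique : ∀ (T : C) (g : T ⟶ X.obj ⊗ Y.obj),
    (∀ a : A, g ≫ X.smul a ▷ Y.obj = g ≫ X.obj ◁ Y.smul a) → ∃! h : T ⟶ Z.obj, h ≫ δ = g

/-- The map `A → Hom(𝟙, Z)`, `a ↦ a • ε`, for a morphism `ε : 𝟙 ⟶ Z`. -/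
def unitMap (Z : ModuleIn k A C) (ε : 𝟙_ C ⟶ Z.obj) : A →+ (𝟙_ C ⟶ Z.obj) where
  toFun a := ε ≫ Z.smul a
  map_zero' := by rw [ModuleIn.smul_zero, comp_zero]
  map_add' a b := by rw [ModuleIn.smul_add, Preadditive.comp_add]

/-- The map `A → Hom(Z, 𝟙)`, `a ↦ η ∘ a`, for a morphism `η : Z ⟶ 𝟙`. -/
def counitMap (Z : ModuleIn k A C) (η : Z.obj ⟶ 𝟙_ C) : A →+ (Z.obj ⟶ 𝟙_ C) where
  toFun a := Z.smul a ≫ η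
  map_zero' := by rw [ModuleIn.smul_zero, zero_comp]
  map_add' a b := by rw [ModuleIn.smul_add, Preadditive.add_comp]

/-- `Z`, with the morphism `ε : 𝟙 ⟶ Z`, is the `A`-module `A ⊗_k 𝟙`. -/
def IsTensorUnit (Z : ModuleIn k A C) (ε : 𝟙_ C ⟶ Z.obj) : Prop :=
  IsTensor (ModuleIn.trivial k (𝟙_ C)) (unitMap Z ε)

/-- `Z`, with the morphism `η : Z ⟶ 𝟙`, is the `A`-module
`\underline{Hom}_k(A, 𝟙) = A^∨ ⊗_k 𝟙`. -/
def IsDualTensorUnit (Z : ModuleIn k A C) (η : Z.obj ⟶ 𝟙_ C) : Prop :=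
  IsHom (ModuleIn.trivial k (𝟙_ C)) (counitMap Z η)

end Finite

open Functor.LaxMonoidal Functor.OplaxMonoidal

variable {k : Type u} [Field k] {J : Type u₂} [Category.{v₂} J] (E : J ⥤ CommAlgCat.{w} k)
  [∀ j, Module.Finite k (E.obj j)] (C : Type u₁) [Category.{v₁} C] [Abelian C] [Linear k C]
  [MonoidalCategory C] [SymmetricCategory C]

/-- The symmetric monoidal structure on the category of flat `E`-modules is the one given member by
member by the tensor products `⊗_{E_j}`, with units `E_j`: the quotient morphisms
`X_j ⊗ Y_j ⟶ (X ⊗ Y)_j` and the morphisms `𝟙 ⟶ 𝟙_j` are compatible with the constraints of `C`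
(the lax braided structure of the evaluation functors) and with the transition morphisms. -/
structure FlatCat.IsLevelwiseTensor [MonoidalCategory (FlatCat E C)]
    [SymmetricCategory (FlatCat E C)] [∀ j, (FlatCat.eval E C j).LaxBraided] : Prop where
  isTensorProduct : ∀ (j : J) (X Y : FlatCat E C),
    IsTensorProduct (X.obj.module j) (Y.obj.module j) ((X ⊗ Y).obj.module j)
      (μ (FlatCat.eval E C j) X Y)
  isTensorUnit : ∀ j : J, IsTensorUnit ((𝟙_ (FlatCat E C)).obj.module j) (ε (FlatCat.eval E C j))
  map_tensor : ∀ {i j : J} (f : i ⟶ j) (X Y : FlatCat E C),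
    μ (FlatCat.eval E C i) X Y ≫ (X ⊗ Y).obj.map f =
      (X.obj.map f ⊗ₘ Y.obj.map f) ≫ μ (FlatCat.eval E C j) X Y
  map_unit : ∀ {i j : J} (f : i ⟶ j),
    ε (FlatCat.eval E C i) ≫ (𝟙_ (FlatCat E C)).obj.map f = ε (FlatCat.eval E C j)

variable [MonoidalPreadditive C] [MonoidalLinear k C] [RigidCategory C]

/-- The symmetric monoidal structure on the category of `E`-injective modules is the one given
member by member by the dual tensor products `⊗^{E_j}`, with units the duals of the `E_j`: the
inclusions `(X ⊗ Y)_j ⟶ X_j ⊗ Y_j` and the morphisms `𝟙_j ⟶ 𝟙` are compatible with the constraints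
of `C` (the oplax structure of the evaluation functors, and `braided`) and with the transition
morphisms. -/
structure ProlongCat.IsLevelwiseTensor [MonoidalCategory (ProlongCat E C)]
    [SymmetricCategory (ProlongCat E C)] [∀ j, (ProlongCat.eval E C j).OplaxMonoidal] : Prop where
  isDualTensorProduct : ∀ (j : J) (X Y : ProlongCat E C),
    IsDualTensorProduct (X.obj.module j) (Y.obj.module j) ((X ⊗ Y).obj.module j)
      (δ (ProlongCat.eval E C j) X Y)
  isDualTensorUnit : ∀ j : J, IsDualTensorUnit ((𝟙_ (ProlongCat E C)).obj.module j) (η (ProlongCat.eval E C j))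
  braided : ∀ (j : J) (X Y : ProlongCat E C),
    δ (ProlongCat.eval E C j) X Y ≫
        (β_ ((ProlongCat.eval E C j).obj X) ((ProlongCat.eval E C j).obj Y)).hom =
      (ProlongCat.eval E C j).map (β_ X Y).hom ≫ δ (ProlongCat.eval E C j) Y X
  map_tensor : ∀ {i j : J} (f : i ⟶ j) (X Y : ProlongCat E C),
    (X ⊗ Y).obj.map f ≫ δ (ProlongCat.eval E C i) X Y =
      δ (ProlongCat.eval E C j) X Y ≫ (X.obj.map f ⊗ₘ Y.obj.map f)
  map_unit : ∀ {i j : J} (f : i ⟶ j),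
    (𝟙_ (ProlongCat E C)).obj.map f ≫ η (ProlongCat.eval E C i) = η (ProlongCat.eval E C j)

/-- The tensor structure of the duality functor is the canonical one: the morphism
`X_j^∨ ⊗ Y_j^∨ ⟶ (X ⊗ Y)_j^∨` that it gives is the transpose of the inclusion
`(X ⊗ Y)_j ⟶ X_j ⊗ Y_j`, with respect to the evaluation pairings. -/
def IsCanonicalDuality [MonoidalCategory (FlatCat E C)]
    [SymmetricCategory (FlatCat E C)] [∀ j, (FlatCat.eval E C j).LaxBraided]
    [MonoidalCategory (ProlongCat E C)] [SymmetricCategory (ProlongCat E C)]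
    [∀ j, (ProlongCat.eval E C j).OplaxMonoidal] [(dualFunctor E C).Braided] : Prop :=
  ∀ (j : J) (X Y : ProlongCat E C),
    let x : C := (X.obj.module j).obj
    let y : C := (Y.obj.module j).obj
    let z : C := ((X ⊗ Y).obj.module j).obj
    let p : xᘁ ⊗ yᘁ ⟶ zᘁ :=
      μ (FlatCat.eval E C j) ((dualFunctor E C).obj X).unop ((dualFunctor E C).obj Y).unop ≫
        (FlatCat.eval E C j).map (δ (dualFunctor E C) X Y).unop
    let d : z ⟶ x ⊗ y := δ (ProlongCat.eval E C j) X Y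
    p ▷ z ≫ ε_ z zᘁ =
      (xᘁ ⊗ yᘁ) ◁ d ≫ tensorμ xᘁ yᘁ x y ≫ (ε_ x xᘁ ⊗ₘ ε_ y yᘁ) ≫ (λ_ (𝟙_ C)).hom

end Tensor

end Prolong

end

/-! The theorem splits into facts about modules over one finite algebra `A`, their compatibility
with a base change `A → B`, and a transfer to injective modules by duality.

Coherence is inherited from `C`. The functors `X ↦ X_j` are jointly faithful, and the quotient maps
from `X_j ⊗ Y_j` to the tensor product over `E_j` are epimorphisms that remain so after tensoring
with an object. Each axiom for systems therefore reduces to the same axiom in `C` (`LaxInduced`).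
All systems thus form a symmetric monoidal category; the point is that the full subcategory of flat
Cartesian systems contains the unit and is stable under tensor products, finite sums and duals.

The central fact is `ModuleIn.IsFlat.isMonoFlat`: flatness, which only tests `M ⊗_A X` for finitely
generated modules `M` over `A`, implies that `W ⊗_A X` preserves monomorphisms in `W` for all
`A`-modules `W` in `C`. Let `K` be the kernel of the free cover `F = A ⊗ X ⟶ X`. By the snake lemma
it suffices that `W ⊗_A K ⟶ W ⊗_A F` is mono for every `W`, a form of `Tor_1(W, X) = 0`. This
condition is stable under extensions in `W`, so dévissage along the nilradical reduces to `W` killed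
by it. The quotient `A_red` being separable, its separability idempotent makes `W` a direct factor
of `W ⊗ A_red`, and for the latter the claim follows from flatness tested on the ideal. This is the
one use of quasi-separability. The converse, `ModuleIn.IsMonoFlat.isFlat`, holds over any finite
`A`, because `M ↦ M ⊗_k 𝟙` is exact.

For the dual, let `D` be the internal hom of `A`-modules from `X` to the unit. Internal homs exist:
the one from `X` to `Y` is a dual in `C` of `Y^∨ ⊗_A X`. This description also shows that the
internal hom out of a flat `X` is exact. The comparison from `D ⊗_A Y` to the internal hom from `X`
to `Y` is an isomorphism for free `Y`, hence for all `Y` by a presentation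
(`IsInternalHom.isInternalHom_tensEv`). Consequently `D` is flat, and with `Y = X` the identity of
`X` gives a coevaluation, so `D` is a dual of `X`.

Units, tensor products and duals of flat modules commute with base change (`isTensor_extMap_const`,
`IsTensor.extMap_tens`, `IsTensor.extMap_dual`), so Cartesian systems are stable under these
operations and the evaluations and coevaluations are compatible with the transition morphisms.

Finally `X ↦ X^∨` is an equivalence onto the opposite of the flat category, because transposition in
`C` is bijective on morphisms and every object is the dual of its left dual. The tensor structure
and rigidity of the injective category are transported along it. The inclusions into `X_j ⊗ Y_j` are
defined as transposes of the quotient maps, and their universal properties and coherence are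
obtained by pairing with the duals (`oplaxOfPairing`, `isDualTensorProduct_of_dual`). -/

set_option linter.unusedSectionVars false

noncomputable section

namespace Prolong

/-! ### Monoidal structures induced by lax functors -/

section LaxInduced

open Functor

variable {D : Type*} [Category* D] {C : Type*} [Category* C] [MonoidalCategory C]
  {ι : Type*}

/-- Data exhibiting the operations of `D` as quotients, under a jointly faithful family of
functors, of the operations of a monoidal category. -/
structure LaxInduced [MonoidalCategoryStruct D] (U : ι → D ⥤ C) where
  faithful : ∀ {X Y : D} {f g : X ⟶ Y}, (∀ i, (U i).map f = (U i).map g) → f = g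
  μ : ∀ i (X Y : D), (U i).obj X ⊗ (U i).obj Y ⟶ (U i).obj (X ⊗ Y)
  ε : ∀ i, 𝟙_ C ⟶ (U i).obj (𝟙_ D)
  epi_μ : ∀ i X Y, Epi (μ i X Y)
  epi_whiskerRight : ∀ i X Y Z, Epi (μ i X Y ▷ Z)
  tensorHom_def : ∀ {X₁ Y₁ X₂ Y₂ : D} (f : X₁ ⟶ Y₁) (g : X₂ ⟶ Y₂),
    f ⊗ₘ g = (f ▷ X₂) ≫ (Y₁ ◁ g)
  whiskerRight : ∀ i {X Y : D} (f : X ⟶ Y) (Z : D),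
    μ i X Z ≫ (U i).map (f ▷ Z) = (U i).map f ▷ (U i).obj Z ≫ μ i Y Z
  whiskerLeft : ∀ i (Z : D) {X Y : D} (f : X ⟶ Y),
    μ i Z X ≫ (U i).map (Z ◁ f) = (U i).obj Z ◁ (U i).map f ≫ μ i Z Y
  associator : ∀ i (X Y Z : D),
    μ i X Y ▷ (U i).obj Z ≫ μ i (X ⊗ Y) Z ≫ (U i).map (α_ X Y Z).hom =
      (α_ _ _ _).hom ≫ (U i).obj X ◁ μ i Y Z ≫ μ i X (Y ⊗ Z)
  leftUnitor : ∀ i (X : D),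
    ε i ▷ (U i).obj X ≫ μ i (𝟙_ D) X ≫ (U i).map (λ_ X).hom = (λ_ _).hom
  rightUnitor : ∀ i (X : D),
    (U i).obj X ◁ ε i ≫ μ i X (𝟙_ D) ≫ (U i).map (ρ_ X).hom = (ρ_ _).hom

namespace LaxInduced

attribute [instance] epi_μ epi_whiskerRight

variable [MonoidalCategoryStruct D] {U : ι → D ⥤ C} (d : LaxInduced U)

include d

lemma whiskerRight_assoc (i : ι) {X Y : D} (f : X ⟶ Y) (Z : D) {T : C}
    (t : (U i).obj (Y ⊗ Z) ⟶ T) : d.μ i X Z ≫ (U i).map (f ▷ Z) ≫ t =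
      (U i).map f ▷ (U i).obj Z ≫ d.μ i Y Z ≫ t := by
  simpa only [Category.assoc] using d.whiskerRight i f Z =≫ t

lemma whiskerLeft_assoc (i : ι) (Z : D) {X Y : D} (f : X ⟶ Y) {T : C}
    (t : (U i).obj (Z ⊗ Y) ⟶ T) : d.μ i Z X ≫ (U i).map (Z ◁ f) ≫ t =
      (U i).obj Z ◁ (U i).map f ≫ d.μ i Z Y ≫ t := by
  simpa only [Category.assoc] using d.whiskerLeft i Z f =≫ t

lemma associator_assoc (i : ι) (X Y Z : D) {T : C} (t : (U i).obj (X ⊗ Y ⊗ Z) ⟶ T) :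
    d.μ i X Y ▷ (U i).obj Z ≫ d.μ i (X ⊗ Y) Z ≫ (U i).map (α_ X Y Z).hom ≫ t =
      (α_ _ _ _).hom ≫ (U i).obj X ◁ d.μ i Y Z ≫ d.μ i X (Y ⊗ Z) ≫ t := by
  simpa only [Category.assoc] using d.associator i X Y Z =≫ t

lemma hom_ext {X Y Z : D} {f g : X ⊗ Y ⟶ Z}
    (h : ∀ i, d.μ i X Y ≫ (U i).map f = d.μ i X Y ≫ (U i).map g) : f = g :=
  d.faithful fun i => (cancel_epi (d.μ i X Y)).1 (h i)

/-- Both tensorators here are epimorphisms. After this precomposition a law on triple products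
becomes the same law in `C`. -/
lemma hom_ext₃ {X Y Z W : D} {f g : (X ⊗ Y) ⊗ Z ⟶ W}
    (h : ∀ i, d.μ i X Y ▷ (U i).obj Z ≫ d.μ i _ Z ≫ (U i).map f =
      d.μ i X Y ▷ (U i).obj Z ≫ d.μ i _ Z ≫ (U i).map g) : f = g :=
  d.hom_ext fun i => (cancel_epi (d.μ i X Y ▷ (U i).obj Z)).1 (h i)

lemma leftUnitor_inv (i : ι) (X : D) :
    (U i).map (λ_ X).inv = (λ_ _).inv ≫ d.ε i ▷ (U i).obj X ≫ d.μ i (𝟙_ D) X := by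
  rw [← cancel_mono ((U i).map (λ_ X).hom), Category.assoc, Category.assoc, d.leftUnitor,
    ← Functor.map_comp]
  simp

lemma rightUnitor_inv (i : ι) (X : D) :
    (U i).map (ρ_ X).inv = (ρ_ _).inv ≫ (U i).obj X ◁ d.ε i ≫ d.μ i X (𝟙_ D) := by
  rw [← cancel_mono ((U i).map (ρ_ X).hom), Category.assoc, Category.assoc, d.rightUnitor,
    ← Functor.map_comp]
  simp

lemma whiskerLeft_id (X Y : D) : X ◁ 𝟙 Y = 𝟙 (X ⊗ Y) :=
  d.hom_ext fun i => by simp [d.whiskerLeft]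

lemma id_whiskerRight (X Y : D) : 𝟙 X ▷ Y = 𝟙 (X ⊗ Y) :=
  d.hom_ext fun i => by simp [d.whiskerRight]

lemma whiskerLeft_comp (X : D) {Y Z W : D} (f : Y ⟶ Z) (g : Z ⟶ W) :
    X ◁ (f ≫ g) = X ◁ f ≫ X ◁ g :=
  d.hom_ext fun i => by simp [d.whiskerLeft, d.whiskerLeft_assoc]

lemma comp_whiskerRight {Y Z W : D} (f : Y ⟶ Z) (g : Z ⟶ W) (X : D) :
    (f ≫ g) ▷ X = f ▷ X ≫ g ▷ X :=
  d.hom_ext fun i => by simp [d.whiskerRight, d.whiskerRight_assoc]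

lemma whisker_exchange {X Y Z W : D} (f : X ⟶ Y) (g : Z ⟶ W) :
    X ◁ g ≫ f ▷ W = f ▷ Z ≫ Y ◁ g :=
  d.hom_ext fun i => by
    simp [d.whiskerRight, d.whiskerRight_assoc, d.whiskerLeft, d.whiskerLeft_assoc,
      whisker_exchange_assoc]

lemma tensorHom (i : ι) {X₁ Y₁ X₂ Y₂ : D} (f : X₁ ⟶ Y₁) (g : X₂ ⟶ Y₂) :
    d.μ i X₁ X₂ ≫ (U i).map (f ⊗ₘ g) = ((U i).map f ⊗ₘ (U i).map g) ≫ d.μ i Y₁ Y₂ := by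
  rw [d.tensorHom_def, Functor.map_comp, d.whiskerRight_assoc, d.whiskerLeft,
    MonoidalCategory.tensorHom_def, Category.assoc]

lemma associator_naturality {X₁ X₂ X₃ Y₁ Y₂ Y₃ : D} (f₁ : X₁ ⟶ Y₁) (f₂ : X₂ ⟶ Y₂)
    (f₃ : X₃ ⟶ Y₃) :
    ((f₁ ⊗ₘ f₂) ⊗ₘ f₃) ≫ (α_ Y₁ Y₂ Y₃).hom = (α_ X₁ X₂ X₃).hom ≫ (f₁ ⊗ₘ (f₂ ⊗ₘ f₃)) :=
  d.hom_ext₃ fun i => by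
    rw [Functor.map_comp, Functor.map_comp, reassoc_of% (d.tensorHom i (f₁ ⊗ₘ f₂) f₃),
      d.associator_assoc, d.tensorHom]
    have h₁ := d.tensorHom i f₁ f₂
    have h₂ := d.tensorHom i f₂ f₃
    have e₁ : d.μ i X₁ X₂ ▷ (U i).obj X₃ ≫ ((U i).map (f₁ ⊗ₘ f₂) ⊗ₘ (U i).map f₃) =
        (((U i).map f₁ ⊗ₘ (U i).map f₂) ⊗ₘ (U i).map f₃) ≫ d.μ i Y₁ Y₂ ▷ (U i).obj Y₃ := by
      rw [← tensorHom_id, ← tensorHom_id, tensorHom_comp_tensorHom, tensorHom_comp_tensorHom, h₁]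
      simp
    have e₂ : (U i).obj X₁ ◁ d.μ i X₂ X₃ ≫ ((U i).map f₁ ⊗ₘ (U i).map (f₂ ⊗ₘ f₃)) =
        ((U i).map f₁ ⊗ₘ (U i).map f₂ ⊗ₘ (U i).map f₃) ≫ (U i).obj Y₁ ◁ d.μ i Y₂ Y₃ := by
      rw [← id_tensorHom, ← id_tensorHom, tensorHom_comp_tensorHom, tensorHom_comp_tensorHom, h₂]
      simp
    rw [reassoc_of% e₁, reassoc_of% e₂, d.associator, associator_naturality_assoc]

lemma pentagon (W X Y Z : D) :
    (α_ W X Y).hom ▷ Z ≫ (α_ W (X ⊗ Y) Z).hom ≫ W ◁ (α_ X Y Z).hom =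
      (α_ (W ⊗ X) Y Z).hom ≫ (α_ W X (Y ⊗ Z)).hom :=
  d.hom_ext₃ fun i => by
    -- `hom_ext₃` cancels only two tensorators; the source is a fourfold product, so a third one has
    -- to be cancelled.
    have : Epi (d.μ i W X ▷ (U i).obj Y ▷ (U i).obj Z) := by
      rw [whiskerRight_tensor_symm]; infer_instance
    rw [← cancel_epi (d.μ i W X ▷ (U i).obj Y ▷ (U i).obj Z)]
    have h₁ : d.μ i W X ▷ (U i).obj Y ▷ (U i).obj Z ≫ d.μ i (W ⊗ X) Y ▷ (U i).obj Z ≫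
        (U i).map (α_ W X Y).hom ▷ (U i).obj Z = (α_ _ _ _).hom ▷ (U i).obj Z ≫
          ((U i).obj W ◁ d.μ i X Y) ▷ (U i).obj Z ≫ d.μ i W (X ⊗ Y) ▷ (U i).obj Z := by
      simp only [← MonoidalCategory.comp_whiskerRight, d.associator]
    have h₂ : (U i).obj W ◁ d.μ i X Y ▷ (U i).obj Z ≫ (U i).obj W ◁ d.μ i (X ⊗ Y) Z ≫
        (U i).obj W ◁ (U i).map (α_ X Y Z).hom = (U i).obj W ◁ (α_ _ _ _).hom ≫
          (U i).obj W ◁ (U i).obj X ◁ d.μ i Y Z ≫ (U i).obj W ◁ d.μ i X (Y ⊗ Z) := by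
      simp only [← MonoidalCategory.whiskerLeft_comp, d.associator]
    simp only [Functor.map_comp, d.whiskerRight_assoc, d.associator_assoc]
    rw [reassoc_of% h₁, d.associator_assoc, d.whiskerLeft, associator_naturality_middle_assoc,
      reassoc_of% h₂, associator_naturality_left_assoc, ← whisker_exchange_assoc, d.associator,
      associator_naturality_right_assoc, pentagon_assoc]

lemma triangle (X Y : D) : (α_ X (𝟙_ D) Y).hom ≫ X ◁ (λ_ Y).hom = (ρ_ X).hom ▷ Y := by
  have : IsIso ((ρ_ X).inv ▷ Y) := ⟨(ρ_ X).hom ▷ Y, by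
    rw [← d.comp_whiskerRight, Iso.inv_hom_id, d.id_whiskerRight], by
    rw [← d.comp_whiskerRight, Iso.hom_inv_id, d.id_whiskerRight]⟩
  -- The unit laws are known only after composing with `ε`, which need not be epi. Precomposing with
  -- the inverse unitor, whose image under `U i` is expressed through `ε`, brings them into play.
  rw [← cancel_epi ((ρ_ X).inv ▷ Y), ← d.comp_whiskerRight, Iso.inv_hom_id, d.id_whiskerRight]
  refine d.hom_ext fun i => ?_
  have h : (U i).obj X ◁ d.ε i ▷ (U i).obj Y ≫ (U i).obj X ◁ d.μ i (𝟙_ D) Y ≫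
      (U i).obj X ◁ (U i).map (λ_ Y).hom = (U i).obj X ◁ (λ_ _).hom := by
    simp only [← MonoidalCategory.whiskerLeft_comp, d.leftUnitor]
  simp only [Functor.map_comp, d.whiskerRight_assoc, d.rightUnitor_inv,
    MonoidalCategory.comp_whiskerRight, Category.assoc, d.associator_assoc, d.whiskerLeft]
  rw [associator_naturality_middle_assoc, reassoc_of% h]
  simp

/-- The monoidal structure of the source of a jointly faithful family of lax functors. -/
abbrev monoidalCategory : MonoidalCategory D where
  tensorHom_def := d.tensorHom_def
  id_tensorHom_id X Y := by
    rw [d.tensorHom_def, d.id_whiskerRight, d.whiskerLeft_id, Category.id_comp]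
  tensorHom_comp_tensorHom f₁ f₂ g₁ g₂ := by
    simp only [d.tensorHom_def, d.comp_whiskerRight, d.whiskerLeft_comp, Category.assoc]
    rw [← Category.assoc (_ ◁ f₂), d.whisker_exchange, Category.assoc]
  whiskerLeft_id := d.whiskerLeft_id
  id_whiskerRight := d.id_whiskerRight
  associator_naturality := d.associator_naturality
  leftUnitor_naturality {X Y} f := by
    -- As for the triangle: the inverse unitor is given by `ε`, after which the unit law in `C`
    -- applies.
    rw [← cancel_epi (λ_ X).inv]
    refine d.faithful fun i => ?_
    simp [d.leftUnitor_inv, d.whiskerLeft_assoc, ← whisker_exchange_assoc, d.leftUnitor]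
  rightUnitor_naturality {X Y} f := by
    rw [← cancel_epi (ρ_ X).inv]
    refine d.faithful fun i => ?_
    simp [d.rightUnitor_inv, d.whiskerRight_assoc, whisker_exchange_assoc, d.rightUnitor]
  pentagon := d.pentagon
  triangle := d.triangle

/-- The functors that induce a monoidal structure are lax monoidal. -/
abbrev laxMonoidal (i : ι) :
    letI := d.monoidalCategory
    (U i).LaxMonoidal :=
  letI := d.monoidalCategory
  { ε := d.ε i
    μ := d.μ i
    μ_natural_left := fun f Z => (d.whiskerRight i f Z).symm
    μ_natural_right := fun Z f => (d.whiskerLeft i Z f).symm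
    associativity := d.associator i
    left_unitality := fun X => (d.leftUnitor i X).symm
    right_unitality := fun X => (d.rightUnitor i X).symm }

variable [SymmetricCategory C] (b : ∀ X Y : D, X ⊗ Y ≅ Y ⊗ X)
  (hb : ∀ i X Y, d.μ i X Y ≫ (U i).map (b X Y).hom = (β_ _ _).hom ≫ d.μ i Y X)

/-- The symmetric structure induced by a jointly faithful family of lax functors. -/
abbrev symmetricCategory :
    letI := d.monoidalCategory
    SymmetricCategory D :=
  letI := d.monoidalCategory
  have hb' : ∀ i X Y {Z} (g : (U i).obj (Y ⊗ X) ⟶ Z),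
      d.μ i X Y ≫ (U i).map (b X Y).hom ≫ g = (β_ _ _).hom ≫ d.μ i Y X ≫ g := by
    intro i X Y Z g
    rw [← Category.assoc, hb, Category.assoc]
  have hs : ∀ X Y, (b X Y).hom ≫ (b Y X).hom = 𝟙 (X ⊗ Y) :=
    fun X Y => d.hom_ext fun i => by simp [hb, hb']
  have hf : ∀ X Y Z, (α_ X Y Z).hom ≫ (b X (Y ⊗ Z)).hom ≫ (α_ Y Z X).hom =
      (b X Y).hom ▷ Z ≫ (α_ Y X Z).hom ≫ Y ◁ (b X Z).hom := fun X Y Z => d.hom_ext₃ fun i => by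
      have h₁ : d.μ i X Y ▷ (U i).obj Z ≫ (U i).map (b X Y).hom ▷ (U i).obj Z =
          (β_ _ _).hom ▷ (U i).obj Z ≫ d.μ i Y X ▷ (U i).obj Z := by
        simp only [← MonoidalCategory.comp_whiskerRight, hb]
      have h₂ : (U i).obj Y ◁ d.μ i X Z ≫ (U i).obj Y ◁ (U i).map (b X Z).hom =
          (U i).obj Y ◁ (β_ _ _).hom ≫ (U i).obj Y ◁ d.μ i Z X := by
        simp only [← MonoidalCategory.whiskerLeft_comp, hb]
      simp only [Functor.map_comp, d.associator_assoc, d.whiskerRight_assoc, hb']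
      rw [reassoc_of% h₁, d.associator_assoc, d.whiskerLeft, reassoc_of% h₂,
        BraidedCategory.braiding_naturality_right_assoc, d.associator,
        BraidedCategory.hexagon_forward_assoc]
  { braiding := b
    braiding_naturality_right := fun X Y Z f => d.hom_ext fun i => by
      simp [hb, hb', d.whiskerLeft_assoc, d.whiskerRight]
    braiding_naturality_left := fun f Z => d.hom_ext fun i => by
      simp [hb, hb', d.whiskerRight_assoc, d.whiskerLeft]
    hexagon_forward := hf
    hexagon_reverse := fun X Y Z => by
      have h₁ : X ◁ (b Z Y).hom ≫ X ◁ (b Y Z).hom = 𝟙 _ := by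
        rw [← MonoidalCategory.whiskerLeft_comp, hs, MonoidalCategory.whiskerLeft_id]
      have h₂ : (b Z X).hom ▷ Y ≫ (b X Z).hom ▷ Y = 𝟙 _ := by
        rw [← MonoidalCategory.comp_whiskerRight, hs, MonoidalCategory.id_whiskerRight]
      have : IsIso ((α_ Z X Y).hom ≫ (b Z (X ⊗ Y)).hom ≫ (α_ X Y Z).hom) := inferInstance
      -- By symmetry the two sides of the reverse hexagon are inverse to those of a forward hexagon.
      -- Composing with one side of the latter makes both sides the identity.
      rw [← cancel_epi ((α_ Z X Y).hom ≫ (b Z (X ⊗ Y)).hom ≫ (α_ X Y Z).hom)]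
      trans 𝟙 _
      · simp [reassoc_of% (hs Z (X ⊗ Y))]
      · rw [hf]
        simp [reassoc_of% h₁, h₂]
    symmetry := hs }

/-- The functors that induce a symmetric monoidal structure are lax braided. -/
abbrev laxBraided (i : ι) :
    letI := d.monoidalCategory
    letI := d.symmetricCategory b hb
    (U i).LaxBraided :=
  letI := d.monoidalCategory
  letI := d.symmetricCategory b hb
  letI := d.laxMonoidal i
  { braided := fun X Y => hb i X Y }

end LaxInduced
end LaxInduced
end Prolong

namespace Prolong

/-! ### The category of modules in a linear category -/

section ModuleCategory

variable {k : Type u} [Field k] {A : Type w} [CommRing A] [Algebra k A]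
variable {C : Type u₁} [Category.{v₁} C] [Preadditive C] [Linear k C]

namespace ModuleIn

lemma smul_smul (X : ModuleIn k A C) (r : k) (a : A) : X.smul (r • a) = r • X.smul a :=
  map_smul X.act r a

lemma smul_comm (X : ModuleIn k A C) (a b : A) : X.smul a ≫ X.smul b = X.smul b ≫ X.smul a := by
  rw [← smul_mul, mul_comm, smul_mul]

/-- A module in a linear category, from the endomorphisms giving the action. -/
abbrev ofSmul (X : C) (s : A → (X ⟶ X)) (add : ∀ a b, s (a + b) = s a + s b)
    (smul : ∀ (r : k) a, s (r • a) = r • s a) (one : s 1 = 𝟙 X)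
    (mul : ∀ a b, s (a * b) = s a ≫ s b) : ModuleIn k A C where
  obj := X
  act := AlgHom.ofLinearMap
    { toFun := fun a => (s a : End X)
      map_add' := add
      map_smul' := smul } one (fun a b => by
        -- Multiplication in `End` is composition in the opposite order; commutativity of `A` makes
        -- the two agree.
        change s (a * b) = s b ≫ s a
        rw [mul_comm, mul])

/-- Morphisms of modules: the morphisms compatible with the actions. -/
@[ext]
structure Hom (X Y : ModuleIn k A C) where
  hom : X.obj ⟶ Y.obj
  smul_hom : ∀ a, X.smul a ≫ hom = hom ≫ Y.smul a

lemma Hom.smul_hom_assoc {X Y : ModuleIn k A C} (f : Hom X Y) (a : A) {T : C} (t : Y.obj ⟶ T) :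
    X.smul a ≫ f.hom ≫ t = f.hom ≫ Y.smul a ≫ t := by
  simpa only [Category.assoc] using f.smul_hom a =≫ t

instance : Category (ModuleIn k A C) where
  Hom := Hom
  id X := ⟨𝟙 _, by simp⟩
  comp f g := ⟨f.hom ≫ g.hom, fun a => by rw [f.smul_hom_assoc, g.smul_hom, Category.assoc]⟩
  id_comp f := Hom.ext (Category.id_comp _)
  comp_id f := Hom.ext (Category.comp_id _)
  assoc f g h := Hom.ext (Category.assoc _ _ _)

@[ext] lemma hom_ext {X Y : ModuleIn k A C} {f g : X ⟶ Y} (h : f.hom = g.hom) : f = g := Hom.ext h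

@[simp] lemma id_hom (X : ModuleIn k A C) : Hom.hom (𝟙 X) = 𝟙 X.obj := rfl

@[simp] lemma comp_hom {X Y Z : ModuleIn k A C} (f : X ⟶ Y) (g : Y ⟶ Z) :
    (f ≫ g).hom = f.hom ≫ g.hom := rfl

/-- An isomorphism of modules, from an isomorphism of the underlying objects. -/
@[simps]
def isoMk {X Y : ModuleIn k A C} (e : X.obj ≅ Y.obj)
    (h : ∀ a, X.smul a ≫ e.hom = e.hom ≫ Y.smul a) : X ≅ Y where
  hom := ⟨e.hom, h⟩
  inv := ⟨e.inv, fun a => by rw [Iso.comp_inv_eq, Category.assoc, h, e.inv_hom_id_assoc]⟩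
  hom_inv_id := hom_ext e.hom_inv_id
  inv_hom_id := hom_ext e.inv_hom_id

@[simp] lemma hom_inv_id_hom {X Y : ModuleIn k A C} (e : X ≅ Y) :
    e.hom.hom ≫ e.inv.hom = 𝟙 X.obj := congrArg Hom.hom e.hom_inv_id

@[simp] lemma hom_inv_id_hom_assoc {X Y : ModuleIn k A C} (e : X ≅ Y) {T : C} (t : X.obj ⟶ T) :
    e.hom.hom ≫ e.inv.hom ≫ t = t := by
  rw [← Category.assoc, hom_inv_id_hom, Category.id_comp]

@[simp] lemma inv_hom_id_hom {X Y : ModuleIn k A C} (e : X ≅ Y) :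
    e.inv.hom ≫ e.hom.hom = 𝟙 Y.obj := congrArg Hom.hom e.inv_hom_id

@[simp] lemma inv_hom_id_hom_assoc {X Y : ModuleIn k A C} (e : X ≅ Y) {T : C} (t : Y.obj ⟶ T) :
    e.inv.hom ≫ e.hom.hom ≫ t = t := by
  rw [← Category.assoc, inv_hom_id_hom, Category.id_comp]

instance {X Y : ModuleIn k A C} (e : X ≅ Y) : IsIso e.hom.hom :=
  ⟨e.inv.hom, hom_inv_id_hom e, inv_hom_id_hom e⟩

instance {X Y : ModuleIn k A C} (e : X ≅ Y) : IsIso e.inv.hom :=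
  ⟨e.hom.hom, inv_hom_id_hom e, hom_inv_id_hom e⟩

end ModuleIn

end ModuleCategory

/-! ### Universal properties are stable under tensoring with an object -/

section Whisker

variable {k : Type u} [Field k] {A : Type w} [CommRing A] [Algebra k A]
variable {C : Type u₁} [Category.{v₁} C] [Preadditive C] [Linear k C]
  [MonoidalCategory C] [MonoidalPreadditive C] [MonoidalLinear k C]

/-- The form in which universal properties are moved across adjunction and transposition bijections
throughout. -/
lemma existsUnique_congr_equiv {α β : Type*} (e : α ≃ β) {p : α → Prop} {q : β → Prop}
    (h : ∀ a, p a ↔ q (e a)) (hq : ∃! b, q b) : ∃! a, p a := by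
  obtain ⟨b, hb, hu⟩ := hq
  exact ⟨e.symm b, (h _).2 (by simpa using hb), fun a ha => by
    rw [← hu _ ((h a).1 ha), e.symm_apply_apply]⟩

lemma tensorLeftHomEquiv_comp {X X' Y Y' Z : C} [ExactPairing Y Y'] (f : X ⟶ X')
    (g : Y' ⊗ X' ⟶ Z) : tensorLeftHomEquiv X Y Y' Z (Y' ◁ f ≫ g) =
      f ≫ tensorLeftHomEquiv X' Y Y' Z g := by
  rw [← Equiv.eq_symm_apply, tensorLeftHomEquiv_symm_naturality, Equiv.symm_apply_apply]

lemma tensorRightHomEquiv_comp {X X' Y Y' Z : C} [ExactPairing Y Y'] (f : X ⟶ X')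
    (g : X' ⊗ Y ⟶ Z) : tensorRightHomEquiv X Y Y' Z (f ▷ Y ≫ g) =
      f ≫ tensorRightHomEquiv X' Y Y' Z g := by
  rw [← Equiv.eq_symm_apply, tensorRightHomEquiv_symm_naturality, Equiv.symm_apply_apply]

lemma tensorLeftHomEquiv_add {X Y Y' Z : C} [ExactPairing Y Y'] (f g : Y' ⊗ X ⟶ Z) :
    tensorLeftHomEquiv X Y Y' Z (f + g) =
      tensorLeftHomEquiv X Y Y' Z f + tensorLeftHomEquiv X Y Y' Z g := by
  simp [tensorLeftHomEquiv, MonoidalPreadditive.whiskerLeft_add]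

lemma tensorRightHomEquiv_add {X Y Y' Z : C} [ExactPairing Y Y'] (f g : X ⊗ Y ⟶ Z) :
    tensorRightHomEquiv X Y Y' Z (f + g) =
      tensorRightHomEquiv X Y Y' Z f + tensorRightHomEquiv X Y Y' Z g := by
  simp [tensorRightHomEquiv, MonoidalPreadditive.add_whiskerRight]

lemma tensorLeftHomEquiv_smul {X Y Y' Z : C} [ExactPairing Y Y'] (r : k) (f : Y' ⊗ X ⟶ Z) :
    tensorLeftHomEquiv X Y Y' Z (r • f) = r • tensorLeftHomEquiv X Y Y' Z f := by
  simp [tensorLeftHomEquiv]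

lemma tensorRightHomEquiv_smul {X Y Y' Z : C} [ExactPairing Y Y'] (r : k) (f : X ⊗ Y ⟶ Z) :
    tensorRightHomEquiv X Y Y' Z (r • f) = r • tensorRightHomEquiv X Y Y' Z f := by
  simp [tensorRightHomEquiv]

/-- The tensor product of an object and a module. -/
abbrev ModuleIn.whiskerLeft (V : C) (X : ModuleIn k A C) : ModuleIn k A C :=
  .ofSmul (V ⊗ X.obj) (fun a => V ◁ X.smul a)
    (fun a b => by rw [X.smul_add, MonoidalPreadditive.whiskerLeft_add])
    (fun r a => by rw [X.smul_smul, MonoidalLinear.whiskerLeft_smul])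
    (by rw [X.smul_one, MonoidalCategory.whiskerLeft_id])
    (fun a b => by rw [X.smul_mul, MonoidalCategory.whiskerLeft_comp])

/-- The tensor product of a module and an object. -/
abbrev ModuleIn.whiskerRight (X : ModuleIn k A C) (V : C) : ModuleIn k A C :=
  .ofSmul (X.obj ⊗ V) (fun a => X.smul a ▷ V)
    (fun a b => by rw [X.smul_add, MonoidalPreadditive.add_whiskerRight])
    (fun r a => by rw [X.smul_smul, MonoidalLinear.smul_whiskerRight])
    (by rw [X.smul_one, MonoidalCategory.id_whiskerRight])
    (fun a b => by rw [X.smul_mul, MonoidalCategory.comp_whiskerRight])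

@[simp] lemma ModuleIn.whiskerLeft_smul (V : C) (X : ModuleIn k A C) (a : A) :
    (X.whiskerLeft V).smul a = V ◁ X.smul a := rfl

@[simp] lemma ModuleIn.whiskerRight_smul (V : C) (X : ModuleIn k A C) (a : A) :
    (X.whiskerRight V).smul a = X.smul a ▷ V := rfl

variable [RigidCategory C]

/-- The left dual of `V` makes `V ⊗ -` a left adjoint, and the adjunction bijection is additive and
natural, so it preserves balanced maps. -/
lemma IsTensor.whiskerLeft {M : Type*} [AddCommGroup M] [Module A M] {X : ModuleIn k A C} {T : C}
    {β : M →+ (X.obj ⟶ T)} (h : IsTensor X β) (V : C) (β' : M →+ (V ⊗ X.obj ⟶ V ⊗ T))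
    (hβ' : ∀ m, β' m = V ◁ β m) : IsTensor (X.whiskerLeft V) β' where
  balanced a m := by
    rw [hβ', hβ', h.balanced, MonoidalCategory.whiskerLeft_comp]; rfl
  existsUnique Y γ hγ := by
    refine existsUnique_congr_equiv (tensorLeftHomEquiv T (ᘁV : C) V Y) (fun g => ?_)
      (h.existsUnique _
        { toFun := fun m => tensorLeftHomEquiv X.obj (ᘁV : C) V Y (γ m)
          map_zero' := by rw [map_zero]; simp [tensorLeftHomEquiv, MonoidalPreadditive.whiskerLeft_zero]
          map_add' := fun a b => by rw [map_add, tensorLeftHomEquiv_add] }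
        fun a m => ?_)
    · refine forall_congr' fun m => ?_
      rw [hβ', ← (tensorLeftHomEquiv X.obj (ᘁV : C) V Y).injective.eq_iff,
        tensorLeftHomEquiv_comp]; rfl
    · change tensorLeftHomEquiv X.obj (ᘁV : C) V Y (γ (a • m)) =
        X.smul a ≫ tensorLeftHomEquiv X.obj (ᘁV : C) V Y (γ m)
      rw [hγ, ← tensorLeftHomEquiv_comp]; rfl

lemma IsTensor.whiskerRight {M : Type*} [AddCommGroup M] [Module A M] {X : ModuleIn k A C} {T : C}
    {β : M →+ (X.obj ⟶ T)} (h : IsTensor X β) (V : C) (β' : M →+ (X.obj ⊗ V ⟶ T ⊗ V))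
    (hβ' : ∀ m, β' m = β m ▷ V) : IsTensor (X.whiskerRight V) β' where
  balanced a m := by
    rw [hβ', hβ', h.balanced, MonoidalCategory.comp_whiskerRight]; rfl
  existsUnique Y γ hγ := by
    refine existsUnique_congr_equiv (tensorRightHomEquiv T V (Vᘁ : C) Y) (fun g => ?_)
      (h.existsUnique _
        { toFun := fun m => tensorRightHomEquiv X.obj V (Vᘁ : C) Y (γ m)
          map_zero' := by rw [map_zero]; simp [tensorRightHomEquiv, MonoidalPreadditive.zero_whiskerRight]
          map_add' := fun a b => by rw [map_add, tensorRightHomEquiv_add] }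
        fun a m => ?_)
    · refine forall_congr' fun m => ?_
      rw [hβ', ← (tensorRightHomEquiv X.obj V (Vᘁ : C) Y).injective.eq_iff,
        tensorRightHomEquiv_comp]; rfl
    · change tensorRightHomEquiv X.obj V (Vᘁ : C) Y (γ (a • m)) =
        X.smul a ≫ tensorRightHomEquiv X.obj V (Vᘁ : C) Y (γ m)
      rw [hγ, ← tensorRightHomEquiv_comp]; rfl

/-- Every object has duals on both sides, so tensoring with it is both a left and a right adjoint;
this gives the preservation of epimorphisms and of monomorphisms below. -/
instance (V : C) : (tensorLeft V).IsLeftAdjoint := (tensorLeftAdjunction (ᘁV : C) V).isLeftAdjoint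

instance (V : C) : (tensorLeft V).IsRightAdjoint := (tensorLeftAdjunction V (Vᘁ : C)).isRightAdjoint

instance (V : C) : (tensorRight V).IsLeftAdjoint :=
  (tensorRightAdjunction V (Vᘁ : C)).isLeftAdjoint

instance (V : C) : (tensorRight V).IsRightAdjoint :=
  (tensorRightAdjunction (ᘁV : C) V).isRightAdjoint

instance epi_whiskerLeft (V : C) {X Y : C} (f : X ⟶ Y) [Epi f] : Epi (V ◁ f) :=
  inferInstanceAs (Epi ((tensorLeft V).map f))

instance epi_whiskerRight (V : C) {X Y : C} (f : X ⟶ Y) [Epi f] : Epi (f ▷ V) :=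
  inferInstanceAs (Epi ((tensorRight V).map f))

instance mono_whiskerLeft (V : C) {X Y : C} (f : X ⟶ Y) [Mono f] : Mono (V ◁ f) :=
  inferInstanceAs (Mono ((tensorLeft V).map f))

instance mono_whiskerRight (V : C) {X Y : C} (f : X ⟶ Y) [Mono f] : Mono (f ▷ V) :=
  inferInstanceAs (Mono ((tensorRight V).map f))

end Whisker

/-! ### Tensor products over a finite algebra -/

section TensorProduct

variable {k : Type u} [Field k] {A : Type w} [CommRing A] [Algebra k A]
variable {C : Type u₁} [Category.{v₁} C] [Preadditive C] [Linear k C] [MonoidalCategory C]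

namespace IsTensorProduct

variable {X Y Z : ModuleIn k A C} {μ : X.obj ⊗ Y.obj ⟶ Z.obj} (h : IsTensorProduct X Y Z μ)

include h

lemma smul_left_assoc (a : A) {T : C} (t : Z.obj ⟶ T) :
    X.smul a ▷ Y.obj ≫ μ ≫ t = μ ≫ Z.smul a ≫ t := by
  simpa only [Category.assoc] using h.smul_left a =≫ t

lemma condition (a : A) : X.smul a ▷ Y.obj ≫ μ = X.obj ◁ Y.smul a ≫ μ := by
  rw [h.smul_left, h.smul_right]

lemma epi : Epi μ where
  left_cancellation {T} f g hfg :=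
    (h.existsUnique T (μ ≫ g) fun a => by rw [← Category.assoc, h.condition, Category.assoc]).unique
      hfg rfl

lemma hom_ext {T : C} {f g : Z.obj ⟶ T} (hfg : μ ≫ f = μ ≫ g) : f = g :=
  have := h.epi
  (cancel_epi μ).1 hfg

variable [MonoidalPreadditive C] [RigidCategory C]

/-- The quotient defining `X ⊗_A Y` is preserved by the left adjoint `V ⊗ -`. This is what makes the
tensor product over `A` associative. -/
lemma existsUnique_whiskerLeft (V : C) {T : C} (g : V ⊗ X.obj ⊗ Y.obj ⟶ T)
    (hg : ∀ a, V ◁ X.smul a ▷ Y.obj ≫ g = V ◁ X.obj ◁ Y.smul a ≫ g) :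
    ∃! f : V ⊗ Z.obj ⟶ T, V ◁ μ ≫ f = g :=
  existsUnique_congr_equiv (tensorLeftHomEquiv Z.obj (ᘁV : C) V T) (fun f => by
      rw [← tensorLeftHomEquiv_comp, (tensorLeftHomEquiv _ (ᘁV : C) V T).injective.eq_iff])
    (h.existsUnique _ (tensorLeftHomEquiv _ (ᘁV : C) V T g) fun a => by
      rw [← tensorLeftHomEquiv_comp, hg, tensorLeftHomEquiv_comp])

lemma existsUnique_whiskerRight (V : C) {T : C} (g : (X.obj ⊗ Y.obj) ⊗ V ⟶ T)
    (hg : ∀ a, X.smul a ▷ Y.obj ▷ V ≫ g = (X.obj ◁ Y.smul a) ▷ V ≫ g) :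
    ∃! f : Z.obj ⊗ V ⟶ T, μ ▷ V ≫ f = g :=
  existsUnique_congr_equiv (tensorRightHomEquiv Z.obj V (Vᘁ : C) T) (fun f => by
      rw [← tensorRightHomEquiv_comp, (tensorRightHomEquiv _ V (Vᘁ : C) T).injective.eq_iff])
    (h.existsUnique _ (tensorRightHomEquiv _ V (Vᘁ : C) T g) fun a => by
      rw [← tensorRightHomEquiv_comp, hg, tensorRightHomEquiv_comp])

end IsTensorProduct

end TensorProduct

/-! ### Existence of the tensor product over a finite algebra -/

section Exists

variable {k : Type u} [Field k] {A : Type w} [CommRing A] [Algebra k A] [Module.Finite k A]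
variable {C : Type u₁} [Category.{v₁} C] [Abelian C] [Linear k C] [MonoidalCategory C]
  [MonoidalPreadditive C] [MonoidalLinear k C]

/-- The difference of the two actions is `k`-linear in `a`, so it is enough to impose the relations
for a basis of `A`. They are finitely many, and the quotient is a cokernel. -/
lemma exists_isTensorProduct (X Y : ModuleIn k A C) :
    ∃ (Z : ModuleIn k A C) (μ : X.obj ⊗ Y.obj ⟶ Z.obj), IsTensorProduct X Y Z μ := by
  have : HasFiniteBiproducts C := Abelian.hasFiniteBiproducts
  let b := Module.finBasis k A
  let rel : (⨁ fun _ : Fin (Module.finrank k A) => X.obj ⊗ Y.obj) ⟶ X.obj ⊗ Y.obj :=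
    biproduct.desc fun i => X.smul (b i) ▷ Y.obj - X.obj ◁ Y.smul (b i)
  have hrel {T : C} (g : X.obj ⊗ Y.obj ⟶ T) :
      rel ≫ g = 0 ↔ ∀ a, X.smul a ▷ Y.obj ≫ g = X.obj ◁ Y.smul a ≫ g := by
    let L : A →ₗ[k] (X.obj ⊗ Y.obj ⟶ T) :=
      { toFun := fun a => X.smul a ▷ Y.obj ≫ g - X.obj ◁ Y.smul a ≫ g
        map_add' := fun a b => by
          simp [ModuleIn.smul_add, MonoidalPreadditive.add_whiskerRight,
            MonoidalPreadditive.whiskerLeft_add]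
          abel
        map_smul' := fun r a => by simp [ModuleIn.smul_smul, _root_.smul_sub] }
    constructor
    · intro h a
      have : L = 0 := b.ext fun i => by
        have := biproduct.ι (fun _ => X.obj ⊗ Y.obj) i ≫= h
        simpa [rel, L] using this
      exact sub_eq_zero.1 (congrArg (fun L => L a) this)
    · intro h
      ext i
      simp [rel, h]
  have hπ := (hrel (cokernel.π rel)).1 (cokernel.condition rel)
  -- The action through `X` preserves the relations: it commutes with the action on `Y` by exchange,
  -- and with the action on `X` because `A` is commutative.
  have hdesc : ∀ a, rel ≫ X.smul a ▷ Y.obj ≫ cokernel.π rel = 0 := fun a => (hrel _).2 fun b => by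
    rw [← comp_whiskerRight_assoc, X.smul_comm, comp_whiskerRight_assoc, hπ,
      whisker_exchange_assoc]
  have hext {T : C} {f g : cokernel rel ⟶ T} (h : cokernel.π rel ≫ f = cokernel.π rel ≫ g) :
    f = g := (cancel_epi _).1 h
  let Z : ModuleIn k A C := .ofSmul (cokernel rel) (fun a => cokernel.desc rel _ (hdesc a))
    (fun a b => hext <| by simp [ModuleIn.smul_add, MonoidalPreadditive.add_whiskerRight])
    (fun r a => hext <| by simp [ModuleIn.smul_smul])
    (hext <| by simp [ModuleIn.smul_one])
    (fun a b => hext <| by simp [ModuleIn.smul_mul])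
  have hZ : ∀ a, cokernel.π rel ≫ Z.smul a = X.smul a ▷ Y.obj ≫ cokernel.π rel :=
    fun a => cokernel.π_desc _ _ _
  exact ⟨Z, cokernel.π rel, fun a => (hZ a).symm, fun a => by rw [← hπ, hZ], fun T g hg =>
    ⟨cokernel.desc rel g ((hrel g).2 hg), cokernel.π_desc _ _ _,
      fun f hf => hext (by rw [hf, cokernel.π_desc])⟩⟩

end Exists

end Prolong

namespace Prolong

/-! ### Functoriality, symmetry and associativity of the tensor product over `A` -/

section Tens

variable {k : Type u} [Field k] {A : Type w} [CommRing A] [Algebra k A]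
variable {C : Type u₁} [Category.{v₁} C]

namespace IsTensorProduct

variable [Preadditive C] [Linear k C] [MonoidalCategory C]
variable {X Y Z : ModuleIn k A C} {μ : X.obj ⊗ Y.obj ⟶ Z.obj} (h : IsTensorProduct X Y Z μ)

/-- The morphism out of a tensor product given by a balanced morphism. -/
def desc {T : C} (g : X.obj ⊗ Y.obj ⟶ T)
    (hg : ∀ a, X.smul a ▷ Y.obj ≫ g = X.obj ◁ Y.smul a ≫ g) : Z.obj ⟶ T :=
  (h.existsUnique T g hg).choose

@[simp]
lemma fac {T : C} (g : X.obj ⊗ Y.obj ⟶ T)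
    (hg : ∀ a, X.smul a ▷ Y.obj ≫ g = X.obj ◁ Y.smul a ≫ g) : μ ≫ h.desc g hg = g :=
  (h.existsUnique T g hg).choose_spec.1

@[simp]
lemma fac_assoc {T : C} (g : X.obj ⊗ Y.obj ⟶ T)
    (hg : ∀ a, X.smul a ▷ Y.obj ≫ g = X.obj ◁ Y.smul a ≫ g) {T' : C} (t : T ⟶ T') :
    μ ≫ h.desc g hg ≫ t = g ≫ t := by
  rw [← Category.assoc, fac]

/-- The morphism of modules out of a tensor product given by a bilinear morphism. -/
def lift {W : ModuleIn k A C} (g : X.obj ⊗ Y.obj ⟶ W.obj)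
    (h₁ : ∀ a, X.smul a ▷ Y.obj ≫ g = g ≫ W.smul a)
    (h₂ : ∀ a, X.obj ◁ Y.smul a ≫ g = g ≫ W.smul a) : Z ⟶ W where
  hom := h.desc g fun a => by rw [h₁, h₂]
  smul_hom a := h.hom_ext <| by rw [← h.smul_left_assoc, h.fac, h.fac_assoc, h₁]

@[simp]
lemma lift_fac {W : ModuleIn k A C} (g : X.obj ⊗ Y.obj ⟶ W.obj)
    (h₁ : ∀ a, X.smul a ▷ Y.obj ≫ g = g ≫ W.smul a)
    (h₂ : ∀ a, X.obj ◁ Y.smul a ≫ g = g ≫ W.smul a) : μ ≫ (h.lift g h₁ h₂).hom = g :=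
  h.fac g fun a => by rw [h₁, h₂]

@[simp]
lemma lift_fac_assoc {W : ModuleIn k A C} (g : X.obj ⊗ Y.obj ⟶ W.obj)
    (h₁ : ∀ a, X.smul a ▷ Y.obj ≫ g = g ≫ W.smul a)
    (h₂ : ∀ a, X.obj ◁ Y.smul a ≫ g = g ≫ W.smul a) {T : C} (t : W.obj ⟶ T) :
    μ ≫ (h.lift g h₁ h₂).hom ≫ t = g ≫ t := by
  rw [← Category.assoc, lift_fac]

/-- Two tensor products are isomorphic. -/
@[simps]
def iso {Z' : ModuleIn k A C} {μ' : X.obj ⊗ Y.obj ⟶ Z'.obj} (h' : IsTensorProduct X Y Z' μ') :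
    Z ≅ Z' where
  hom := h.lift μ' h'.smul_left h'.smul_right
  inv := h'.lift μ h.smul_left h.smul_right
  hom_inv_id := ModuleIn.hom_ext <| h.hom_ext <| by simp
  inv_hom_id := ModuleIn.hom_ext <| h'.hom_ext <| by simp

end IsTensorProduct

variable [Abelian C] [Linear k C] [MonoidalCategory C]
  [MonoidalPreadditive C] [MonoidalLinear k C] [Module.Finite k A]

/-- The tensor product `X ⊗_A Y`. -/
def tens (X Y : ModuleIn k A C) : ModuleIn k A C := (exists_isTensorProduct X Y).choose

/-- The quotient morphism from `X ⊗ Y` to `X ⊗_A Y`. -/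
def tmk (X Y : ModuleIn k A C) : X.obj ⊗ Y.obj ⟶ (tens X Y).obj :=
  (exists_isTensorProduct X Y).choose_spec.choose

lemma isTensorProduct_tmk (X Y : ModuleIn k A C) : IsTensorProduct X Y (tens X Y) (tmk X Y) :=
  (exists_isTensorProduct X Y).choose_spec.choose_spec

instance (X Y : ModuleIn k A C) : Epi (tmk X Y) := (isTensorProduct_tmk X Y).epi

lemma tmk_smul_left (X Y : ModuleIn k A C) (a : A) :
    X.smul a ▷ Y.obj ≫ tmk X Y = tmk X Y ≫ (tens X Y).smul a :=
  (isTensorProduct_tmk X Y).smul_left a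

lemma tmk_smul_left_assoc (X Y : ModuleIn k A C) (a : A) {T : C} (t : (tens X Y).obj ⟶ T) :
    X.smul a ▷ Y.obj ≫ tmk X Y ≫ t = tmk X Y ≫ (tens X Y).smul a ≫ t := by
  simpa only [Category.assoc] using tmk_smul_left X Y a =≫ t

lemma tmk_smul_right (X Y : ModuleIn k A C) (a : A) :
    X.obj ◁ Y.smul a ≫ tmk X Y = tmk X Y ≫ (tens X Y).smul a :=
  (isTensorProduct_tmk X Y).smul_right a

lemma tmk_smul_right_assoc (X Y : ModuleIn k A C) (a : A) {T : C} (t : (tens X Y).obj ⟶ T) :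
    X.obj ◁ Y.smul a ≫ tmk X Y ≫ t = tmk X Y ≫ (tens X Y).smul a ≫ t := by
  simpa only [Category.assoc] using tmk_smul_right X Y a =≫ t

/-- The functoriality of `X ⊗_A Y`. -/
def tensMap {X Y X' Y' : ModuleIn k A C} (f : X ⟶ X') (g : Y ⟶ Y') : tens X Y ⟶ tens X' Y' :=
  (isTensorProduct_tmk X Y).lift ((f.hom ⊗ₘ g.hom) ≫ tmk X' Y')
    (fun a => by
      rw [Category.assoc, ← tmk_smul_left, ← tensorHom_id, ← tensorHom_id,
        tensorHom_comp_tensorHom_assoc, tensorHom_comp_tensorHom_assoc, f.smul_hom]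
      simp)
    (fun a => by
      rw [Category.assoc, ← tmk_smul_right, ← id_tensorHom, ← id_tensorHom,
        tensorHom_comp_tensorHom_assoc, tensorHom_comp_tensorHom_assoc, g.smul_hom]
      simp)

@[simp]
lemma tmk_tensMap {X Y X' Y' : ModuleIn k A C} (f : X ⟶ X') (g : Y ⟶ Y') :
    tmk X Y ≫ (tensMap f g).hom = (f.hom ⊗ₘ g.hom) ≫ tmk X' Y' :=
  (isTensorProduct_tmk X Y).lift_fac _ _ _

@[simp]
lemma tmk_tensMap_assoc {X Y X' Y' : ModuleIn k A C} (f : X ⟶ X') (g : Y ⟶ Y') {T : C}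
    (t : (tens X' Y').obj ⟶ T) :
    tmk X Y ≫ (tensMap f g).hom ≫ t = (f.hom ⊗ₘ g.hom) ≫ tmk X' Y' ≫ t := by
  simpa only [Category.assoc] using tmk_tensMap f g =≫ t

lemma tens_hom_ext {X Y : ModuleIn k A C} {T : C} {f g : (tens X Y).obj ⟶ T}
    (h : tmk X Y ≫ f = tmk X Y ≫ g) : f = g := (cancel_epi _).1 h

@[simp]
lemma tensMap_id (X Y : ModuleIn k A C) : tensMap (𝟙 X) (𝟙 Y) = 𝟙 _ :=
  ModuleIn.hom_ext <| tens_hom_ext <| by simp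

lemma tensMap_comp {X Y X' Y' X'' Y'' : ModuleIn k A C} (f : X ⟶ X') (g : Y ⟶ Y')
    (f' : X' ⟶ X'') (g' : Y' ⟶ Y'') :
    tensMap f g ≫ tensMap f' g' = tensMap (f ≫ f') (g ≫ g') :=
  ModuleIn.hom_ext <| tens_hom_ext <| by simp

section Braiding

variable [SymmetricCategory C]

/-- The symmetry of `X ⊗_A Y`. -/
def tensBraid (X Y : ModuleIn k A C) : tens X Y ≅ tens Y X where
  hom := (isTensorProduct_tmk X Y).lift ((β_ _ _).hom ≫ tmk Y X)
    (fun a => by simp [tmk_smul_right])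
    (fun a => by simp [tmk_smul_left])
  inv := (isTensorProduct_tmk Y X).lift ((β_ _ _).hom ≫ tmk X Y)
    (fun a => by simp [tmk_smul_right])
    (fun a => by simp [tmk_smul_left])
  hom_inv_id := ModuleIn.hom_ext <| tens_hom_ext <| by simp
  inv_hom_id := ModuleIn.hom_ext <| tens_hom_ext <| by simp

@[simp]
lemma tmk_tensBraid_hom (X Y : ModuleIn k A C) :
    tmk X Y ≫ (tensBraid X Y).hom.hom = (β_ _ _).hom ≫ tmk Y X := by
  simp [tensBraid]

@[simp]
lemma tmk_tensBraid_hom_assoc (X Y : ModuleIn k A C) {T : C} (t : (tens Y X).obj ⟶ T) :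
    tmk X Y ≫ (tensBraid X Y).hom.hom ≫ t = (β_ _ _).hom ≫ tmk Y X ≫ t := by
  simpa only [Category.assoc] using tmk_tensBraid_hom X Y =≫ t

lemma tensBraid_naturality {X Y X' Y' : ModuleIn k A C} (f : X ⟶ X') (g : Y ⟶ Y') :
    tensMap f g ≫ (tensBraid X' Y').hom = (tensBraid X Y).hom ≫ tensMap g f :=
  ModuleIn.hom_ext <| tens_hom_ext <| by simp

end Braiding

section Assoc

variable [RigidCategory C] (X Y Z : ModuleIn k A C)

/-- The morphism `t` intertwines each of the three actions with the action on the target. Agreement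
of those on `X` and `Y` makes it factor through `(X ⊗_A Y) ⊗ Z`, and agreement with that on `Z`
through the outer quotient. -/
lemma exists_tensAssoc_hom :
    ∃ f : tens (tens X Y) Z ⟶ tens X (tens Y Z),
      tmk X Y ▷ Z.obj ≫ tmk (tens X Y) Z ≫ f.hom =
        (α_ _ _ _).hom ≫ X.obj ◁ tmk Y Z ≫ tmk X (tens Y Z) := by
  let t := (α_ X.obj Y.obj Z.obj).hom ≫ X.obj ◁ tmk Y Z ≫ tmk X (tens Y Z)
  have ht₁ : ∀ a, X.smul a ▷ Y.obj ▷ Z.obj ≫ t = t ≫ (tens X (tens Y Z)).smul a := fun a => by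
    simp only [t, Category.assoc, ← tmk_smul_left]
    rw [associator_naturality_left_assoc, ← whisker_exchange_assoc]
  have ht₂ : ∀ a, (X.obj ◁ Y.smul a) ▷ Z.obj ≫ t = t ≫ (tens X (tens Y Z)).smul a := fun a => by
    simp only [t, Category.assoc, ← tmk_smul_right (Y := tens Y Z),
      ← MonoidalCategory.whiskerLeft_comp_assoc]
    rw [← tmk_smul_left Y Z]
    simp
  have ht₃ : ∀ a, (X.obj ⊗ Y.obj) ◁ Z.smul a ≫ t = t ≫ (tens X (tens Y Z)).smul a := fun a => by
    simp only [t, Category.assoc, ← tmk_smul_right (Y := tens Y Z),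
      ← MonoidalCategory.whiskerLeft_comp_assoc]
    rw [← tmk_smul_right Y Z]
    simp
  obtain ⟨g, hg, -⟩ := (isTensorProduct_tmk X Y).existsUnique_whiskerRight Z.obj t
    fun a => by rw [ht₁, ht₂]
  refine ⟨(isTensorProduct_tmk (tens X Y) Z).lift g (fun a => ?_) (fun a => ?_), ?_⟩
  · rw [← cancel_epi (tmk X Y ▷ Z.obj), ← comp_whiskerRight_assoc, ← tmk_smul_left,
      comp_whiskerRight_assoc, hg, ht₁, reassoc_of% hg]
  · rw [← cancel_epi (tmk X Y ▷ Z.obj), ← whisker_exchange_assoc, hg, ht₃, reassoc_of% hg]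
  · rw [IsTensorProduct.lift_fac, hg]

lemma exists_tensAssoc_inv :
    ∃ f : tens X (tens Y Z) ⟶ tens (tens X Y) Z,
      X.obj ◁ tmk Y Z ≫ tmk X (tens Y Z) ≫ f.hom =
        (α_ _ _ _).inv ≫ tmk X Y ▷ Z.obj ≫ tmk (tens X Y) Z := by
  let t := (α_ X.obj Y.obj Z.obj).inv ≫ tmk X Y ▷ Z.obj ≫ tmk (tens X Y) Z
  have ht₁ : ∀ a, X.smul a ▷ (Y.obj ⊗ Z.obj) ≫ t = t ≫ (tens (tens X Y) Z).smul a := fun a => by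
    simp only [t, Category.assoc, ← tmk_smul_left (X := tens X Y),
      ← MonoidalCategory.comp_whiskerRight_assoc]
    rw [← tmk_smul_left X Y]
    simp
  have ht₂ : ∀ a, X.obj ◁ Y.smul a ▷ Z.obj ≫ t = t ≫ (tens (tens X Y) Z).smul a := fun a => by
    simp only [t, Category.assoc, ← tmk_smul_left (X := tens X Y),
      ← MonoidalCategory.comp_whiskerRight_assoc]
    rw [← tmk_smul_right X Y]
    simp
  have ht₃ : ∀ a, X.obj ◁ Y.obj ◁ Z.smul a ≫ t = t ≫ (tens (tens X Y) Z).smul a := fun a => by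
    simp only [t, Category.assoc, ← tmk_smul_right]
    rw [associator_inv_naturality_right_assoc, whisker_exchange_assoc]
  obtain ⟨g, hg, -⟩ := (isTensorProduct_tmk Y Z).existsUnique_whiskerLeft X.obj t
    fun a => by rw [ht₂, ht₃]
  refine ⟨(isTensorProduct_tmk X (tens Y Z)).lift g (fun a => ?_) (fun a => ?_), ?_⟩
  · rw [← cancel_epi (X.obj ◁ tmk Y Z), whisker_exchange_assoc, hg, ht₁, reassoc_of% hg]
  · rw [← cancel_epi (X.obj ◁ tmk Y Z), ← MonoidalCategory.whiskerLeft_comp_assoc,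
      ← tmk_smul_right, MonoidalCategory.whiskerLeft_comp_assoc, hg, ht₃, reassoc_of% hg]
  · rw [IsTensorProduct.lift_fac, hg]

/-- The associativity of the tensor product over `A`. -/
def tensAssoc : tens (tens X Y) Z ≅ tens X (tens Y Z) where
  hom := (exists_tensAssoc_hom X Y Z).choose
  inv := (exists_tensAssoc_inv X Y Z).choose
  hom_inv_id := ModuleIn.hom_ext <| tens_hom_ext <| (cancel_epi (tmk X Y ▷ Z.obj)).1 <| by
    simp only [ModuleIn.comp_hom, ModuleIn.id_hom, Category.comp_id]
    rw [reassoc_of% (exists_tensAssoc_hom X Y Z).choose_spec,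
      (exists_tensAssoc_inv X Y Z).choose_spec, Iso.hom_inv_id_assoc]
  inv_hom_id := ModuleIn.hom_ext <| tens_hom_ext <| (cancel_epi (X.obj ◁ tmk Y Z)).1 <| by
    simp only [ModuleIn.comp_hom, ModuleIn.id_hom, Category.comp_id]
    rw [reassoc_of% (exists_tensAssoc_inv X Y Z).choose_spec,
      (exists_tensAssoc_hom X Y Z).choose_spec, Iso.inv_hom_id_assoc]

lemma tmk_tensAssoc_hom :
    tmk X Y ▷ Z.obj ≫ tmk (tens X Y) Z ≫ (tensAssoc X Y Z).hom.hom =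
      (α_ _ _ _).hom ≫ X.obj ◁ tmk Y Z ≫ tmk X (tens Y Z) :=
  (exists_tensAssoc_hom X Y Z).choose_spec

lemma tmk_tensAssoc_hom_assoc {T : C} (t : (tens X (tens Y Z)).obj ⟶ T) :
    tmk X Y ▷ Z.obj ≫ tmk (tens X Y) Z ≫ (tensAssoc X Y Z).hom.hom ≫ t =
      (α_ _ _ _).hom ≫ X.obj ◁ tmk Y Z ≫ tmk X (tens Y Z) ≫ t := by
  simpa only [Category.assoc] using tmk_tensAssoc_hom X Y Z =≫ t

lemma tensAssoc_naturality {X Y Z X' Y' Z' : ModuleIn k A C} (f : X ⟶ X') (g : Y ⟶ Y')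
    (h : Z ⟶ Z') : tensMap (tensMap f g) h ≫ (tensAssoc X' Y' Z').hom =
      (tensAssoc X Y Z).hom ≫ tensMap f (tensMap g h) :=
  ModuleIn.hom_ext <| tens_hom_ext <| (cancel_epi (tmk X Y ▷ Z.obj)).1 <| by
    have e₁ : tmk X Y ▷ Z.obj ≫ ((tensMap f g).hom ⊗ₘ h.hom) =
        ((f.hom ⊗ₘ g.hom) ⊗ₘ h.hom) ≫ tmk X' Y' ▷ Z'.obj := by
      rw [← tensorHom_id, ← tensorHom_id, tensorHom_comp_tensorHom, tensorHom_comp_tensorHom,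
        tmk_tensMap]
      simp
    have e₂ : X.obj ◁ tmk Y Z ≫ (f.hom ⊗ₘ (tensMap g h).hom) =
        (f.hom ⊗ₘ g.hom ⊗ₘ h.hom) ≫ X'.obj ◁ tmk Y' Z' := by
      rw [← id_tensorHom, ← id_tensorHom, tensorHom_comp_tensorHom, tensorHom_comp_tensorHom,
        tmk_tensMap]
      simp
    simp only [ModuleIn.comp_hom, tmk_tensMap_assoc, tmk_tensAssoc_hom_assoc, tmk_tensMap]
    rw [reassoc_of% e₁, tmk_tensAssoc_hom, reassoc_of% e₂, associator_naturality_assoc]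

end Assoc

end Tens

/-! ### Constant modules -/

section Const

variable {k : Type u} [Field k] {A : Type w} [CommRing A] [Algebra k A]
variable {C : Type u₁} [Category.{v₁} C]

/-- The `A`-module `L`, with the linear map `ι : M → Hom(𝟙, L)`, is `M ⊗_k 𝟙`. -/
structure IsConst [Preadditive C] [Linear k C] [MonoidalCategory C] {M : Type*} [AddCommGroup M]
    [Module k M] [Module A M] (L : ModuleIn k A C) (ι : M →ₗ[k] (𝟙_ C ⟶ L.obj)) : Prop where
  smul : ∀ (a : A) (m : M), ι (a • m) = ι m ≫ L.smul a
  existsUnique : ∀ (T : C) (γ : M →ₗ[k] (𝟙_ C ⟶ T)), ∃! h : L.obj ⟶ T, ∀ m, ι m ≫ h = γ m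

variable [Abelian C] [Linear k C] [MonoidalCategory C]
  [MonoidalPreadditive C] [MonoidalLinear k C]

/-- A `k`-basis of `M` presents `M ⊗_k 𝟙` as a finite sum of copies of the unit. Its universal
property for `k`-linear maps then produces the action of `A`, independently of the basis. -/
lemma exists_isConst (M : Type*) [AddCommGroup M] [Module k M] [Module A M] [IsScalarTower k A M]
    [Module.Finite k M] :
    ∃ (L : ModuleIn k A C) (ι : M →ₗ[k] (𝟙_ C ⟶ L.obj)), IsConst L ι := by
  have : HasFiniteBiproducts C := Abelian.hasFiniteBiproducts
  let b := Module.finBasis k M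
  let n := Module.finrank k M
  let L₀ : C := ⨁ fun _ : Fin n => 𝟙_ C
  let ι : M →ₗ[k] (𝟙_ C ⟶ L₀) :=
    { toFun := fun m => ∑ i, b.repr m i • biproduct.ι (fun _ : Fin n => 𝟙_ C) i
      map_add' := fun x y => by simp [add_smul, Finset.sum_add_distrib]
      map_smul' := fun r x => by simp [smul_smul, Finset.smul_sum] }
  have hι : ∀ i, ι (b i) = biproduct.ι (fun _ : Fin n => 𝟙_ C) i := fun i => by
    change ∑ j, b.repr (b i) j • biproduct.ι (fun _ : Fin n => 𝟙_ C) j = _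
    rw [Finset.sum_eq_single i (fun j _ hj => by simp [Finsupp.single_eq_of_ne hj]) (by simp)]
    simp
  have hu : ∀ (T : C) (γ : M →ₗ[k] (𝟙_ C ⟶ T)), ∃! h : L₀ ⟶ T, ∀ m, ι m ≫ h = γ m := by
    intro T γ
    have key : ∀ h : L₀ ⟶ T, (∀ m, ι m ≫ h = γ m) ↔ ∀ i, ι (b i) ≫ h = γ (b i) := fun h =>
      ⟨fun H i => H _, fun H m => by
        have : (Linear.rightComp k (𝟙_ C) h).comp ι = γ := b.ext H
        exact congrArg (fun l => l m) this⟩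
    refine ⟨biproduct.desc fun i => γ (b i), (key _).2 fun i => by rw [hι]; simp,
      fun h hh => biproduct.hom_ext' _ _ fun i => ?_⟩
    have := hh (b i)
    rw [hι] at this
    rw [biproduct.ι_desc]
    exact this
  choose d hd hdu using hu
  let s : A → (L₀ ⟶ L₀) := fun a => d L₀ (ι.comp (Algebra.lsmul k k M a))
  have hs : ∀ a m, ι m ≫ s a = ι (a • m) := fun a m => hd _ _ m
  have hext {T : C} {f g : L₀ ⟶ T} (h : ∀ m, ι m ≫ f = ι m ≫ g) : f = g :=
    (hdu T ((Linear.rightComp k (𝟙_ C) g).comp ι) f h).trans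
      (hdu T ((Linear.rightComp k (𝟙_ C) g).comp ι) g fun _ => rfl).symm
  let L : ModuleIn k A C := .ofSmul L₀ s
    (fun a b => hext fun m => by simp [hs, add_smul])
    (fun r a => hext fun m => by simp [hs])
    (hext fun m => by simp [hs])
    (fun a b => hext fun m => by
      rw [hs, ← Category.assoc, hs, hs, smul_smul, mul_comm])
  exact ⟨L, ι, fun a m => (hs a m).symm, fun T γ => ⟨d T γ, hd T γ, hdu T γ⟩⟩

namespace IsConst

variable {M : Type*} [AddCommGroup M] [Module k M] [Module A M]
  {L : ModuleIn k A C} {ι : M →ₗ[k] (𝟙_ C ⟶ L.obj)} (h : IsConst L ι)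

include h

lemma trivial_isTensor :
    IsTensor (ModuleIn.trivial k (𝟙_ C)) (M := M) (T := L.obj) ι.toAddMonoidHom where
  balanced r m := by
    change ι (r • m) = (r • 𝟙 (𝟙_ C)) ≫ ι m
    simp
  existsUnique T γ hγ := h.existsUnique T
    { toFun := γ
      map_add' := map_add γ
      map_smul' := fun r m => (hγ r m).trans
        ((Linear.smul_comp _ _ _ r (𝟙 (𝟙_ C)) (γ m)).trans (congrArg _ (Category.id_comp _))) }

variable [RigidCategory C]

/-- As `- ⊗ V` is a left adjoint, `L ⊗ V` represents the `k`-linear maps from `M` to `Hom(V, T)`. -/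
lemma existsUnique_whiskerRight (V : C) {T : C} (γ : M →ₗ[k] (V ⟶ T)) :
    ∃! f : L.obj ⊗ V ⟶ T, ∀ m, ι m ▷ V ≫ f = (λ_ V).hom ≫ γ m :=
  existsUnique_congr_equiv (tensorRightHomEquiv L.obj V (Vᘁ : C) T)
    (fun f => forall_congr' fun m => by
      rw [← (tensorRightHomEquiv _ V (Vᘁ : C) T).injective.eq_iff, tensorRightHomEquiv_comp]; rfl)
    (h.existsUnique _
      { toFun := fun m => tensorRightHomEquiv _ V (Vᘁ : C) T ((λ_ V).hom ≫ γ m)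
        map_add' := fun x y => by rw [map_add, Preadditive.comp_add, tensorRightHomEquiv_add]
        map_smul' := fun r x => by
          rw [map_smul, Linear.comp_smul, tensorRightHomEquiv_smul]; rfl })

lemma existsUnique_whiskerLeft (V : C) {T : C} (γ : M →ₗ[k] (V ⟶ T)) :
    ∃! f : V ⊗ L.obj ⟶ T, ∀ m, V ◁ ι m ≫ f = (ρ_ V).hom ≫ γ m :=
  existsUnique_congr_equiv (tensorLeftHomEquiv L.obj (ᘁV : C) V T)
    (fun f => forall_congr' fun m => by
      rw [← (tensorLeftHomEquiv _ (ᘁV : C) V T).injective.eq_iff, tensorLeftHomEquiv_comp]; rfl)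
    (h.existsUnique _
      { toFun := fun m => tensorLeftHomEquiv _ (ᘁV : C) V T ((ρ_ V).hom ≫ γ m)
        map_add' := fun x y => by rw [map_add, Preadditive.comp_add, tensorLeftHomEquiv_add]
        map_smul' := fun r x => by
          rw [map_smul, Linear.comp_smul, tensorLeftHomEquiv_smul]; rfl })

lemma hom_ext_whiskerRight {V T : C} {f g : L.obj ⊗ V ⟶ T}
    (hfg : ∀ m, ι m ▷ V ≫ f = ι m ▷ V ≫ g) : f = g := by
  refine (h.existsUnique_whiskerRight V
    { toFun := fun m => (λ_ V).inv ≫ ι m ▷ V ≫ g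
      map_add' := fun x y => by simp [MonoidalPreadditive.add_whiskerRight]
      map_smul' := fun r x => by simp }).unique (y₁ := f) (y₂ := g) (fun m => ?_) (fun m => ?_)
  · simp [hfg]
  · simp

lemma hom_ext_whiskerLeft {V T : C} {f g : V ⊗ L.obj ⟶ T}
    (hfg : ∀ m, V ◁ ι m ≫ f = V ◁ ι m ≫ g) : f = g := by
  refine (h.existsUnique_whiskerLeft V
    { toFun := fun m => (ρ_ V).inv ≫ V ◁ ι m ≫ g
      map_add' := fun x y => by simp [MonoidalPreadditive.whiskerLeft_add]
      map_smul' := fun r x => by simp }).unique (y₁ := f) (y₂ := g) (fun m => ?_) (fun m => ?_)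
  · simp [hfg]
  · simp

/-- `(M ⊗_k 𝟙) ⊗_A X` is `M ⊗_A X`. -/
lemma isTensor {X Z : ModuleIn k A C} {μ : L.obj ⊗ X.obj ⟶ Z.obj} [IsScalarTower k A M]
    (hμ : IsTensorProduct L X Z μ) (β : M →+ (X.obj ⟶ Z.obj))
    (hβ : ∀ m, β m = (λ_ _).inv ≫ ι m ▷ X.obj ≫ μ) : IsTensor X β where
  balanced a m := by
    rw [hβ, hβ, h.smul, comp_whiskerRight_assoc, hμ.condition, ← whisker_exchange_assoc,
      leftUnitor_inv_naturality_assoc]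
  existsUnique T γ hγ := by
    obtain ⟨g, hg, hgu⟩ := h.existsUnique_whiskerRight X.obj (T := T)
      { toFun := γ
        map_add' := map_add γ
        map_smul' := fun r m => by
          rw [← algebraMap_smul A r m, hγ, Algebra.algebraMap_eq_smul_one, X.smul_smul, X.smul_one]
          simp }
    -- `g` was obtained from the `k`-linearity of `γ` alone; its `A`-linearity is what lets `g`
    -- descend to the quotient over `A`.
    have hbal : ∀ a, L.smul a ▷ X.obj ≫ g = L.obj ◁ X.smul a ≫ g := fun a =>
      h.hom_ext_whiskerRight fun m => by
        rw [← comp_whiskerRight_assoc, ← h.smul, hg, ← whisker_exchange_assoc, hg]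
        change _ ≫ γ (a • m) = _ ≫ _ ≫ γ m
        rw [hγ, leftUnitor_naturality_assoc]
    refine ⟨hμ.desc g hbal, fun m => ?_, fun f hf => hμ.hom_ext ?_⟩
    · rw [hβ, Category.assoc, Category.assoc, hμ.fac, hg]
      exact Iso.inv_hom_id_assoc _ _
    · rw [hμ.fac]
      refine hgu _ fun m => ?_
      have := hf m
      rw [hβ] at this
      change _ = _ ≫ γ m
      rw [← this]
      simp

end IsConst

end Const

end Prolong

namespace Prolong

/-! ### The unit of the tensor product over `A` -/

section Unit

variable {k : Type u} [Field k] {A : Type w} [CommRing A] [Algebra k A]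
variable {C : Type u₁} [Category.{v₁} C] [Abelian C] [Linear k C] [MonoidalCategory C]
  [MonoidalPreadditive C] [MonoidalLinear k C]

section

variable (k A C) (M : Type*) [AddCommGroup M] [Module k M] [Module A M] [IsScalarTower k A M]
  [Module.Finite k M]

/-- The `A`-module `M ⊗_k 𝟙`. -/
def constMod : ModuleIn k A C := (exists_isConst (k := k) (A := A) (C := C) M).choose

/-- The universal map from `M` to `Hom(𝟙, M ⊗_k 𝟙)`. -/
def constι : M →ₗ[k] (𝟙_ C ⟶ (constMod k A C M).obj) :=
  (exists_isConst (k := k) (A := A) (C := C) M).choose_spec.choose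

lemma isConst_constι : IsConst (constMod k A C M) (constι k A C M) :=
  (exists_isConst (k := k) (A := A) (C := C) M).choose_spec.choose_spec

end

namespace IsConst

variable {M : Type*} [AddCommGroup M] [Module k M] [Module A M]
  {L : ModuleIn k A C} {ι : M →ₗ[k] (𝟙_ C ⟶ L.obj)} (h : IsConst L ι)

include h in
lemma hom_ext {T : C} {f g : L.obj ⟶ T} (hfg : ∀ m, ι m ≫ f = ι m ≫ g) : f = g :=
  (h.existsUnique T ((Linear.rightComp k (𝟙_ C) g).comp ι)).unique hfg fun _ => rfl

variable {B : Type*} [CommRing B] [Algebra k B] {N : Type*} [AddCommGroup N] [Module k N]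
  [Module B N] {L' : ModuleIn k B C} {ι' : N →ₗ[k] (𝟙_ C ⟶ L'.obj)}

/-- The morphism `M ⊗_k 𝟙 ⟶ N ⊗_k 𝟙` given by a linear map. -/
def map (_ : IsConst L' ι') (f : M →ₗ[k] N) : L.obj ⟶ L'.obj :=
  (h.existsUnique _ (ι'.comp f)).choose

@[simp]
lemma ι_map (h' : IsConst L' ι') (f : M →ₗ[k] N) (m : M) : ι m ≫ h.map h' f = ι' (f m) :=
  (h.existsUnique _ (ι'.comp f)).choose_spec.1 m

end IsConst

variable [RigidCategory C]

/-- The action of `A ⊗_k 𝟙` on an `A`-module. -/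
def unitAct (X : ModuleIn k A C) [Module.Finite k A] : (constMod k A C A).obj ⊗ X.obj ⟶ X.obj :=
  ((isConst_constι k A C A).existsUnique_whiskerRight X.obj
    { toFun := X.smul, map_add' := X.smul_add, map_smul' := X.smul_smul }).choose

variable [Module.Finite k A] (X : ModuleIn k A C)

@[simp]
lemma ι_unitAct (a : A) :
    constι k A C A a ▷ X.obj ≫ unitAct X = (λ_ _).hom ≫ X.smul a :=
  ((isConst_constι k A C A).existsUnique_whiskerRight X.obj
    { toFun := X.smul, map_add' := X.smul_add, map_smul' := X.smul_smul }).choose_spec.1 a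

@[simp]
lemma ι_unitAct_assoc (a : A) {T : C} (t : X.obj ⟶ T) :
    constι k A C A a ▷ X.obj ≫ unitAct X ≫ t = (λ_ _).hom ≫ X.smul a ≫ t := by
  simpa only [Category.assoc] using ι_unitAct X a =≫ t

/-- A balanced morphism out of `A ⊗ X` is determined by its restriction along `1 ∈ A`, since `a ⊗ x`
and `1 ⊗ ax` have the same image. -/
lemma isTensorProduct_unitAct : IsTensorProduct (constMod k A C A) X X (unitAct X) where
  smul_left a := (isConst_constι k A C A).hom_ext_whiskerRight fun m => by
    rw [← comp_whiskerRight_assoc, ← (isConst_constι k A C A).smul, ι_unitAct, ι_unitAct_assoc,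
      smul_eq_mul, X.smul_mul, X.smul_comm]
  smul_right a := (isConst_constι k A C A).hom_ext_whiskerRight fun m => by
    rw [← whisker_exchange_assoc, ι_unitAct, ι_unitAct_assoc, leftUnitor_naturality_assoc,
      X.smul_comm]
  existsUnique T g hg := by
    refine ⟨(λ_ _).inv ≫ constι k A C A 1 ▷ _ ≫ g,
      (isConst_constι k A C A).hom_ext_whiskerRight fun m => ?_, fun f hf => ?_⟩
    · have : m = m • (1 : A) := by simp
      conv_rhs => rw [this, (isConst_constι k A C A).smul, comp_whiskerRight_assoc, hg]
      rw [ι_unitAct_assoc, leftUnitor_inv_naturality_assoc, Iso.hom_inv_id_assoc,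
        whisker_exchange_assoc]
    · rw [← hf, ι_unitAct_assoc, X.smul_one]
      simp

/-- The unit constraint of the tensor product over `A`. -/
def tensUnit : tens (constMod k A C A) X ≅ X :=
  (isTensorProduct_tmk _ _).iso (isTensorProduct_unitAct X)

@[simp]
lemma tmk_tensUnit_hom : tmk (constMod k A C A) X ≫ (tensUnit X).hom.hom = unitAct X := by
  simp [tensUnit]

@[simp]
lemma tmk_tensUnit_hom_assoc {T : C} (t : X.obj ⟶ T) :
    tmk (constMod k A C A) X ≫ (tensUnit X).hom.hom ≫ t = unitAct X ≫ t := by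
  rw [← Category.assoc, tmk_tensUnit_hom]

lemma tmk_tensUnit_right [SymmetricCategory C] :
    tmk X (constMod k A C A) ≫ (tensBraid X (constMod k A C A) ≪≫ tensUnit X).hom.hom =
      (β_ _ _).hom ≫ unitAct X := by
  simp

lemma tmk_tensUnit_right_assoc [SymmetricCategory C] {T : C} (t : X.obj ⟶ T) :
    tmk X (constMod k A C A) ≫ (tensBraid X (constMod k A C A) ≪≫ tensUnit X).hom.hom ≫ t =
      (β_ _ _).hom ≫ unitAct X ≫ t := by
  simp

lemma ι_one_unitAct : constι k A C A 1 ▷ X.obj ≫ unitAct X = (λ_ _).hom := by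
  rw [ι_unitAct, ModuleIn.smul_one, Category.comp_id]

end Unit

/-! ### The symmetric monoidal category of systems -/

section Systems

variable {k : Type u} [Field k] {J : Type u₂} [Category.{v₂} J] {E : J ⥤ CommAlgCat.{w} k}
  {C : Type u₁} [Category.{v₁} C]

namespace ModuleSystem

section

variable [Preadditive C] [Linear k C]

lemma naturality {X Y : ModuleSystem E C} (g : X ⟶ Y) {i j : J} (f : i ⟶ j) :
    X.map f ≫ g.app j = g.app i ≫ Y.map f := g.naturality f

/-- A member of a morphism of systems, as a morphism of modules. -/
@[simps]
def appHom {X Y : ModuleSystem E C} (f : X ⟶ Y) (j : J) : X.module j ⟶ Y.module j :=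
  ⟨f.app j, f.smul_app j⟩

/-- An isomorphism of systems, from isomorphisms of their members. -/
def isoMk {X Y : ModuleSystem E C} (e : ∀ j, X.module j ≅ Y.module j)
    (h : ∀ {i j : J} (f : i ⟶ j), X.map f ≫ (e j).hom.hom = (e i).hom.hom ≫ Y.map f) : X ≅ Y where
  hom := ⟨fun j => (e j).hom.hom, fun j => (e j).hom.smul_hom, h⟩
  inv := ⟨fun j => (e j).inv.hom, fun j => (e j).inv.smul_hom, fun {i j} f => by
    rw [← cancel_epi (e i).hom.hom, ModuleIn.hom_inv_id_hom_assoc, ← Category.assoc, ← h,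
      Category.assoc, ModuleIn.hom_inv_id_hom, Category.comp_id]⟩
  hom_inv_id := ModuleSystem.hom_ext fun j => ModuleIn.hom_inv_id_hom (e j)
  inv_hom_id := ModuleSystem.hom_ext fun j => ModuleIn.inv_hom_id_hom (e j)

end

variable [Abelian C] [Linear k C] [MonoidalCategory C] [MonoidalPreadditive C]
  [MonoidalLinear k C] [∀ j, Module.Finite k (E.obj j)]

lemma tensorMap_condition (X Y : ModuleSystem E C) {i j : J} (f : i ⟶ j) (a : E.obj i) :
    (X.module i).smul a ▷ (Y.module i).obj ≫ (X.map f ⊗ₘ Y.map f) ≫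
        tmk (X.module j) (Y.module j) =
      ((X.map f ⊗ₘ Y.map f) ≫ tmk (X.module j) (Y.module j)) ≫
        (tens (X.module j) (Y.module j)).smul ((E.map f).hom a) := by
  rw [Category.assoc, ← tmk_smul_left, ← tensorHom_id, ← tensorHom_id,
    tensorHom_comp_tensorHom_assoc, tensorHom_comp_tensorHom_assoc, X.smul_map, Category.comp_id,
    Category.id_comp]

lemma tensorMap_condition' (X Y : ModuleSystem E C) {i j : J} (f : i ⟶ j) (a : E.obj i) :
    (X.module i).obj ◁ (Y.module i).smul a ≫ (X.map f ⊗ₘ Y.map f) ≫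
        tmk (X.module j) (Y.module j) =
      ((X.map f ⊗ₘ Y.map f) ≫ tmk (X.module j) (Y.module j)) ≫
        (tens (X.module j) (Y.module j)).smul ((E.map f).hom a) := by
  rw [Category.assoc, ← tmk_smul_right, ← id_tensorHom, ← id_tensorHom,
    tensorHom_comp_tensorHom_assoc, tensorHom_comp_tensorHom_assoc, Y.smul_map, Category.comp_id,
    Category.id_comp]

/-- The transition morphisms of a tensor product of systems. -/
def tensorMap (X Y : ModuleSystem E C) {i j : J} (f : i ⟶ j) :
    (tens (X.module i) (Y.module i)).obj ⟶ (tens (X.module j) (Y.module j)).obj :=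
  (isTensorProduct_tmk _ _).desc ((X.map f ⊗ₘ Y.map f) ≫ tmk _ _) fun a => by
    rw [tensorMap_condition, tensorMap_condition']

@[simp]
lemma tmk_tensorMap (X Y : ModuleSystem E C) {i j : J} (f : i ⟶ j) :
    tmk (X.module i) (Y.module i) ≫ X.tensorMap Y f =
      (X.map f ⊗ₘ Y.map f) ≫ tmk (X.module j) (Y.module j) :=
  (isTensorProduct_tmk _ _).fac _ _

@[simp]
lemma tmk_tensorMap_assoc (X Y : ModuleSystem E C) {i j : J} (f : i ⟶ j) {T : C}
    (t : (tens (X.module j) (Y.module j)).obj ⟶ T) :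
    tmk (X.module i) (Y.module i) ≫ X.tensorMap Y f ≫ t =
      (X.map f ⊗ₘ Y.map f) ≫ tmk (X.module j) (Y.module j) ≫ t := by
  simpa only [Category.assoc] using tmk_tensorMap X Y f =≫ t

variable [RigidCategory C]

/-- The transition morphisms of the unit system. -/
def unitTransition {i j : J} (f : i ⟶ j) :
    (constMod k (E.obj i) C (E.obj i)).obj ⟶ (constMod k (E.obj j) C (E.obj j)).obj :=
  (isConst_constι _ _ _ _).map (isConst_constι _ _ _ _) (E.map f).hom.toLinearMap

@[simp]
lemma ι_unitTransition {i j : J} (f : i ⟶ j) (a : E.obj i) :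
    constι k (E.obj i) C (E.obj i) a ≫ unitTransition f =
      constι k (E.obj j) C (E.obj j) ((E.map f).hom a) :=
  (isConst_constι _ _ _ _).ι_map (isConst_constι _ _ _ _) _ _

@[simp]
lemma ι_unitTransition_assoc {i j : J} (f : i ⟶ j) (a : E.obj i) {T : C}
    (t : (constMod k (E.obj j) C (E.obj j)).obj ⟶ T) :
    constι k (E.obj i) C (E.obj i) a ≫ unitTransition f ≫ t =
      constι k (E.obj j) C (E.obj j) ((E.map f).hom a) ≫ t := by
  rw [← Category.assoc, ι_unitTransition]

variable (E C) in
/-- The unit system. -/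
abbrev unit : ModuleSystem E C where
  module j := constMod k (E.obj j) C (E.obj j)
  map f := unitTransition f
  map_id j := (isConst_constι _ _ _ _).hom_ext fun m => by simp
  map_comp f g := (isConst_constι _ _ _ _).hom_ext fun m => by simp
  smul_map {i j} f e := (isConst_constι _ _ _ _).hom_ext fun m => by
    rw [← Category.assoc, ← (isConst_constι _ _ _ _).smul, ι_unitTransition, ι_unitTransition_assoc,
      ← (isConst_constι _ _ _ _).smul]
    simp

/-- Semilinearity of the transition morphism, in the form that makes the unitors morphisms of
systems. -/
lemma unit_map_unitAct (X : ModuleSystem E C) {i j : J} (f : i ⟶ j) :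
    (unitTransition f ⊗ₘ X.map f) ≫ unitAct (X.module j) = unitAct (X.module i) ≫ X.map f :=
  (isConst_constι _ _ _ _).hom_ext_whiskerRight fun m => by
    rw [ι_unitAct_assoc, X.smul_map, ← tensorHom_id, tensorHom_comp_tensorHom_assoc,
      ι_unitTransition, Category.id_comp, MonoidalCategory.tensorHom_def', Category.assoc,
      ι_unitAct]
    simp

variable [SymmetricCategory C]

/-- The tensor product of two systems. -/
abbrev tensorSystem (X Y : ModuleSystem E C) : ModuleSystem E C where
  module j := tens (X.module j) (Y.module j)
  map f := X.tensorMap Y f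
  map_id j := tens_hom_ext <| by simp [X.map_id, Y.map_id]
  map_comp f g := tens_hom_ext <| by simp [X.map_comp, Y.map_comp]
  smul_map f e := tens_hom_ext <| by
    rw [← tmk_smul_left_assoc, tmk_tensorMap, tmk_tensorMap_assoc, tensorMap_condition,
      Category.assoc]

/-- The tensor product of two morphisms of systems. -/
def tensorSystemMap {X Y X' Y' : ModuleSystem E C} (f : X ⟶ X') (g : Y ⟶ Y') :
    tensorSystem X Y ⟶ tensorSystem X' Y' where
  app j := (tensMap (appHom f j) (appHom g j)).hom
  smul_app j := (tensMap (appHom f j) (appHom g j)).smul_hom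
  naturality h := tens_hom_ext <| by
    refine (tmk_tensorMap_assoc _ _ _ _).trans ?_
    refine Eq.trans ?_ (tmk_tensMap_assoc _ _ _).symm
    refine Eq.trans ?_ (congrArg _ (tmk_tensorMap _ _ _).symm)
    simp [ModuleSystem.naturality]

lemma tensorMap_tensAssoc (X Y Z : ModuleSystem E C) {i j : J} (f : i ⟶ j) :
    (tensorSystem X Y).tensorMap Z f ≫ (tensAssoc _ _ _).hom.hom =
      (tensAssoc _ _ _).hom.hom ≫ X.tensorMap (tensorSystem Y Z) f :=
  tens_hom_ext <| (cancel_epi (tmk (X.module i) (Y.module i) ▷ (Z.module i).obj)).1 <| by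
    have e₁ : tmk (X.module i) (Y.module i) ▷ (Z.module i).obj ≫
        (X.tensorMap Y f ⊗ₘ Z.map f) = ((X.map f ⊗ₘ Y.map f) ⊗ₘ Z.map f) ≫
          tmk (X.module j) (Y.module j) ▷ (Z.module j).obj := by
      rw [← tensorHom_id, ← tensorHom_id, tensorHom_comp_tensorHom, tensorHom_comp_tensorHom,
        tmk_tensorMap, Category.id_comp, Category.comp_id]
    have e₂ : (X.module i).obj ◁ tmk (Y.module i) (Z.module i) ≫
        (X.map f ⊗ₘ Y.tensorMap Z f) = (X.map f ⊗ₘ Y.map f ⊗ₘ Z.map f) ≫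
          (X.module j).obj ◁ tmk (Y.module j) (Z.module j) := by
      rw [← id_tensorHom, ← id_tensorHom, tensorHom_comp_tensorHom, tensorHom_comp_tensorHom,
        tmk_tensorMap, Category.id_comp, Category.comp_id]
    refine (congrArg _ (tmk_tensorMap_assoc (tensorSystem X Y) Z f _)).trans ?_
    refine Eq.trans ?_ (tmk_tensAssoc_hom_assoc _ _ _ _).symm
    refine Eq.trans ?_ (congrArg (fun t => (α_ _ _ _).hom ≫ _ ◁ tmk _ _ ≫ t)
      (tmk_tensorMap X (tensorSystem Y Z) f)).symm
    rw [reassoc_of% e₁, reassoc_of% e₂, tmk_tensAssoc_hom, associator_naturality_assoc]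

/-- The right unitor is the symmetry followed by the left unitor, so that only the left action
`unitAct` is needed. -/
instance : MonoidalCategoryStruct (ModuleSystem E C) where
  tensorObj := tensorSystem
  whiskerLeft X _ _ f := tensorSystemMap (𝟙 X) f
  whiskerRight f Z := tensorSystemMap f (𝟙 Z)
  tensorHom := tensorSystemMap
  tensorUnit := unit E C
  associator X Y Z := isoMk (fun j => tensAssoc _ _ _) (tensorMap_tensAssoc X Y Z)
  leftUnitor X := isoMk (fun j => tensUnit (X.module j)) fun {i j} f => tens_hom_ext <| by
    refine (tmk_tensorMap_assoc (unit E C) X f _).trans ?_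
    refine (congrArg _ (tmk_tensUnit_hom _)).trans ?_
    exact (unit_map_unitAct X f).trans (tmk_tensUnit_hom_assoc _ _).symm
  rightUnitor X := isoMk (fun j => tensBraid (X.module j) (constMod k (E.obj j) C (E.obj j)) ≪≫
      tensUnit (X.module j)) fun {i j} f => tens_hom_ext <| by
    refine (tmk_tensorMap_assoc X (unit E C) f _).trans ?_
    refine (congrArg _ (tmk_tensUnit_right _)).trans ?_
    refine Eq.trans ?_ (tmk_tensUnit_right_assoc _ _).symm
    rw [← unit_map_unitAct]
    exact BraidedCategory.braiding_naturality_assoc _ _ _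

variable (E C) in
/-- The operations on systems are induced by those on their members. -/
def laxInduced : LaxInduced (fun j : J => eval (E := E) (C := C) j) where
  faithful h := ModuleSystem.hom_ext h
  μ j X Y := tmk (X.module j) (Y.module j)
  ε j := constι k (E.obj j) C (E.obj j) 1
  epi_μ j X Y := inferInstanceAs (Epi (tmk (X.module j) (Y.module j)))
  epi_whiskerRight j X Y Z := inferInstanceAs (Epi (tmk (X.module j) (Y.module j) ▷ Z))
  tensorHom_def f g := ModuleSystem.hom_ext fun j => congrArg ModuleIn.Hom.hom
    (show tensMap (appHom f j) (appHom g j) = tensMap (appHom f j) (𝟙 _) ≫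
      tensMap (𝟙 _) (appHom g j) by rw [tensMap_comp, Category.id_comp, Category.comp_id])
  whiskerRight j X Y f Z := (tmk_tensMap _ _).trans (congrArg (· ≫ _) (tensorHom_id _ _))
  whiskerLeft j X Y Z f := (tmk_tensMap _ _).trans (congrArg (· ≫ _) (id_tensorHom _ _))
  associator j X Y Z := tmk_tensAssoc_hom _ _ _
  leftUnitor j X := by
    exact (congrArg _ (tmk_tensUnit_hom (X.module j))).trans (ι_one_unitAct _)
  rightUnitor j X := by
    refine (congrArg _ (tmk_tensUnit_right (X.module j))).trans ?_
    refine (BraidedCategory.braiding_naturality_right_assoc _ _ _).trans ?_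
    exact (congrArg _ (ι_one_unitAct _)).trans (braiding_leftUnitor _)

instance : MonoidalCategory (ModuleSystem E C) := (laxInduced E C).monoidalCategory

/-- The symmetry of the tensor product of systems. -/
def braid (X Y : ModuleSystem E C) : X ⊗ Y ≅ Y ⊗ X :=
  isoMk (fun j => tensBraid _ _) fun f => tens_hom_ext <| by
    refine (tmk_tensorMap_assoc _ _ _ _).trans ?_
    rw [tmk_tensBraid_hom, tmk_tensBraid_hom_assoc]
    refine Eq.trans ?_ (congrArg _ (tmk_tensorMap _ _ _).symm)
    simp

lemma braid_condition (j : J) (X Y : ModuleSystem E C) :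
    (laxInduced E C).μ j X Y ≫ (eval j).map (braid X Y).hom = (β_ _ _).hom ≫
      (laxInduced E C).μ j Y X :=
  tmk_tensBraid_hom _ _

instance : SymmetricCategory (ModuleSystem E C) :=
  (laxInduced E C).symmetricCategory braid braid_condition

instance (j : J) : (eval (E := E) (C := C) j).LaxBraided :=
  (laxInduced E C).laxBraided braid braid_condition j

end ModuleSystem

end Systems

end Prolong

namespace Prolong

/-! ### Right exact sequences -/

section RightExact

variable {C : Type u₁} [Category.{v₁} C]

/-- The sequence `X ⟶ Y ⟶ Z ⟶ 0` is exact. -/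
structure RightExact [HasZeroMorphisms C] {X Y Z : C} (f : X ⟶ Y) (g : Y ⟶ Z) : Prop where
  zero : f ≫ g = 0
  epi : Epi g
  exists_desc : ∀ {T : C} (t : Y ⟶ T), f ≫ t = 0 → ∃ d : Z ⟶ T, g ≫ d = t

variable [Abelian C]

lemma rightExact_cokernel {X Y : C} (f : X ⟶ Y) : RightExact f (cokernel.π f) where
  zero := cokernel.condition f
  epi := inferInstance
  exists_desc t ht := ⟨cokernel.desc f t ht, cokernel.π_desc f t ht⟩

lemma rightExact_kernel {X Y : C} (g : X ⟶ Y) [Epi g] : RightExact (kernel.ι g) g where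
  zero := kernel.condition g
  epi := inferInstance
  exists_desc t ht := ⟨Abelian.epiDesc g t ht, Abelian.comp_epiDesc g t ht⟩

namespace RightExact

/-- The kernel of `g` factors through `f`, so a morphism killed by `f` is killed by the kernel of
`g`; and `g`, being epi, is the cokernel of its kernel. -/
lemma of_exists_lift {X Y Z : C} {f : X ⟶ Y} {g : Y ⟶ Z} (zero : f ≫ g = 0) (epi : Epi g)
    (h : ∀ {T : C} (x : T ⟶ Y), x ≫ g = 0 → ∃ y, x = y ≫ f) : RightExact f g where
  zero := zero
  epi := epi
  exists_desc t ht := by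
    obtain ⟨y, hy⟩ := h (kernel.ι g) (kernel.condition g)
    exact (rightExact_kernel g).exists_desc t (by rw [hy, Category.assoc, ht, comp_zero])

lemma exact {X Y Z : C} {f : X ⟶ Y} {g : Y ⟶ Z} (h : RightExact f g) :
    (ShortComplex.mk f g h.zero).Exact :=
  have := h.epi
  ShortComplex.exact_of_g_is_cokernel _ <|
    CokernelCofork.IsColimit.ofπ g h.zero (fun t ht => (h.exists_desc t ht).choose)
      (fun t ht => (h.exists_desc t ht).choose_spec)
      fun t ht m hm => by rw [← cancel_epi g, hm, (h.exists_desc t ht).choose_spec]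

lemma exists_lift {X Y Z : C} {f : X ⟶ Y} {g : Y ⟶ Z} (h : RightExact f g) {T : C} (x : T ⟶ Y)
    (hx : x ≫ g = 0) : ∃ (T' : C) (π : T' ⟶ T) (_ : Epi π) (y : T' ⟶ X), π ≫ x = y ≫ f :=
  h.exact.exact_up_to_refinements x hx

end RightExact

variable {X₁ X₂ X₃ Y₁ Y₂ Y₃ Z₁ Z₂ : C} {f₁ : X₁ ⟶ X₂} {f₂ : X₂ ⟶ X₃} {g₁ : Y₁ ⟶ Y₂}
  {g₂ : Y₂ ⟶ Y₃} {h₁ : Z₁ ⟶ Z₂} {u₁ : X₁ ⟶ Y₁} {u₂ : X₂ ⟶ Y₂} {u₃ : X₃ ⟶ Y₃}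

/-- The part of the snake lemma on the injectivity of a map of cokernels. -/
lemma mono_of_snake {v₁ : Y₁ ⟶ Z₁} {v₂ : Y₂ ⟶ Z₂} (hf : RightExact f₁ f₂) (hg : g₁ ≫ g₂ = 0)
    (hu : RightExact u₂ v₂) (hv : Epi v₁) (huv : u₁ ≫ v₁ = 0) (hg₁ : Mono g₁) (hu₃ : Mono u₃)
    (c₁ : f₁ ≫ u₂ = u₁ ≫ g₁) (c₂ : f₂ ≫ u₃ = u₂ ≫ g₂) (c₃ : g₁ ≫ v₂ = v₁ ≫ h₁) : Mono h₁ := by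
  refine Preadditive.mono_of_cancel_zero _ fun {T} c hc => ?_
  -- A diagram chase up to epimorphic covers: `b` lifts `c` to `Y₁`, its image in `Y₂` comes from
  -- `a` in `X₂`, and `a` dies in `X₃` because `u₃` is mono, hence comes from `X₁`. So `b` comes
  -- from `X₁` and its image `c` vanishes.
  obtain ⟨T₁, π₁, _, b, hb⟩ := surjective_up_to_refinements_of_epi v₁ c
  obtain ⟨T₂, π₂, _, a, ha⟩ := hu.exists_lift (b ≫ g₁) (by
    rw [Category.assoc, c₃, ← reassoc_of% hb, hc, comp_zero])
  obtain ⟨T₃, π₃, _, a', ha'⟩ := hf.exists_lift a (by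
    rw [← cancel_mono u₃, Category.assoc, c₂, ← reassoc_of% ha, hg, comp_zero, comp_zero,
      zero_comp])
  have : π₃ ≫ π₂ ≫ b = a' ≫ u₁ := by
    rw [← cancel_mono g₁, Category.assoc, Category.assoc, ha, reassoc_of% ha', c₁, Category.assoc]
  rw [← cancel_epi π₁, hb, ← cancel_epi π₂, ← cancel_epi π₃, reassoc_of% this, huv]
  simp

/-- The middle map of a morphism of exact sequences is a monomorphism if the outer ones are. -/
lemma mono_of_mono_of_mono (hf : RightExact f₁ f₂) (hg₁ : Mono g₁) (hu₁ : Mono u₁)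
    (hu₃ : Mono u₃) (c₁ : f₁ ≫ u₂ = u₁ ≫ g₁) (c₂ : f₂ ≫ u₃ = u₂ ≫ g₂) : Mono u₂ := by
  refine Preadditive.mono_of_cancel_zero _ fun {T} x hx => ?_
  obtain ⟨T₁, π₁, _, y, hy⟩ := hf.exists_lift x (by
    rw [← cancel_mono u₃, Category.assoc, c₂, reassoc_of% hx, zero_comp, zero_comp])
  have : y = 0 := by
    rw [← cancel_mono u₁, ← cancel_mono g₁, Category.assoc, ← c₁, ← reassoc_of% hy, hx]
    simp
  rw [← cancel_epi π₁, hy, this, zero_comp, comp_zero]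

/-- The last map of a morphism of right exact sequences is an isomorphism if the middle one is an
isomorphism and the first one is an epimorphism. -/
lemma isIso_of_epi_of_isIso (hf : RightExact f₁ f₂) (hg : RightExact g₁ g₂) (hu₁ : Epi u₁)
    (hu₂ : IsIso u₂) (c₁ : f₁ ≫ u₂ = u₁ ≫ g₁) (c₂ : f₂ ≫ u₃ = u₂ ≫ g₂) : IsIso u₃ := by
  have := hf.epi
  have := hg.epi
  obtain ⟨d, hd⟩ := hg.exists_desc (inv u₂ ≫ f₂) (by
    rw [← cancel_epi u₁, ← reassoc_of% c₁, IsIso.hom_inv_id_assoc, hf.zero, comp_zero])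
  refine ⟨d, ?_, ?_⟩
  · rw [← cancel_epi f₂, reassoc_of% c₂, hd, IsIso.hom_inv_id_assoc, Category.comp_id]
  · rw [← cancel_epi g₂, reassoc_of% hd, c₂, IsIso.inv_hom_id_assoc, Category.comp_id]

end RightExact

/-! ### Kernels and cokernels of morphisms of modules -/

section Kernels

variable {k : Type u} [Field k] {A : Type w} [CommRing A] [Algebra k A]
variable {C : Type u₁} [Category.{v₁} C] [Abelian C] [Linear k C]

namespace ModuleIn

variable {X Y : ModuleIn k A C} (f : X ⟶ Y)

/-- The kernel of a morphism of modules. -/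
abbrev ker : ModuleIn k A C :=
  .ofSmul (kernel f.hom)
    (fun a => kernel.map f.hom f.hom (X.smul a) (Y.smul a) (f.smul_hom a).symm)
    (fun a b => by simp [← cancel_mono (kernel.ι f.hom), X.smul_add, Preadditive.add_comp])
    (fun r a => by simp [← cancel_mono (kernel.ι f.hom), X.smul_smul])
    (by simp [X.smul_one])
    (fun a b => by simp [← cancel_mono (kernel.ι f.hom), X.smul_mul])

/-- The inclusion of the kernel of a morphism of modules. -/
@[simps]
def kerι : ker f ⟶ X := ⟨kernel.ι f.hom, fun _ => kernel.lift_ι _ _ _⟩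

/-- The cokernel of a morphism of modules. -/
abbrev coker : ModuleIn k A C :=
  .ofSmul (cokernel f.hom)
    (fun a => cokernel.map f.hom f.hom (X.smul a) (Y.smul a) (f.smul_hom a).symm)
    (fun a b => by simp [← cancel_epi (cokernel.π f.hom), Y.smul_add, Preadditive.add_comp])
    (fun r a => by simp [← cancel_epi (cokernel.π f.hom), Y.smul_smul])
    (by simp [Y.smul_one])
    (fun a b => by simp [← cancel_epi (cokernel.π f.hom), Y.smul_mul])

/-- The projection to the cokernel of a morphism of modules. -/
@[simps]
def cokerπ : Y ⟶ coker f := ⟨cokernel.π f.hom, fun _ => (cokernel.π_desc _ _ _).symm⟩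

instance : Mono (kerι f).hom := inferInstanceAs (Mono (kernel.ι f.hom))

instance : Epi (cokerπ f).hom := inferInstanceAs (Epi (cokernel.π f.hom))

lemma rightExact_cokerπ : RightExact f.hom (cokerπ f).hom := rightExact_cokernel _

lemma rightExact_kerι [Epi f.hom] : RightExact (kerι f).hom f.hom := rightExact_kernel _

/-- Multiplication by `a`, as a morphism of modules. -/
@[simps]
def smulHom (X : ModuleIn k A C) (a : A) : X ⟶ X := ⟨X.smul a, fun b => X.smul_comm b a⟩

end ModuleIn

variable [MonoidalCategory C] [MonoidalPreadditive C] [MonoidalLinear k C] [Module.Finite k A]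

section

variable [RigidCategory C]

lemma RightExact.whiskerLeft {X Y Z : C} {f : X ⟶ Y} {g : Y ⟶ Z} (h : RightExact f g) (V : C) :
    RightExact (V ◁ f) (V ◁ g) where
  zero := by rw [← MonoidalCategory.whiskerLeft_comp, h.zero, MonoidalPreadditive.whiskerLeft_zero]
  epi := have := h.epi; inferInstance
  exists_desc {T} t ht := by
    obtain ⟨d, hd⟩ := h.exists_desc (tensorLeftHomEquiv Y (ᘁV : C) V T t) (by
      rw [← tensorLeftHomEquiv_comp, ht]
      simp [tensorLeftHomEquiv, MonoidalPreadditive.whiskerLeft_zero])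
    refine ⟨(tensorLeftHomEquiv Z (ᘁV : C) V T).symm d, ?_⟩
    rw [← (tensorLeftHomEquiv Y (ᘁV : C) V T).injective.eq_iff, tensorLeftHomEquiv_comp,
      Equiv.apply_symm_apply, hd]

/-- Right exactness of `W ⊗ -` in `C` passes to the quotient over `A`: the factorisation found in
`C` is balanced, as one sees after cancelling the epimorphism `W ◁ g`. -/
lemma RightExact.tensMap {X Y Z : ModuleIn k A C} {f : X ⟶ Y} {g : Y ⟶ Z}
    (h : RightExact f.hom g.hom) (W : ModuleIn k A C) :
    RightExact (tensMap (𝟙 W) f).hom (tensMap (𝟙 W) g).hom where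
  zero := tens_hom_ext <| by
    rw [tmk_tensMap_assoc, tmk_tensMap, tensorHom_comp_tensorHom_assoc, h.zero]
    simp
  epi := by
    have := h.epi
    have : Epi (tmk W Y ≫ (Prolong.tensMap (𝟙 W) g).hom) := by
      rw [tmk_tensMap, ModuleIn.id_hom, id_tensorHom]
      infer_instance
    exact epi_of_epi (tmk W Y) _
  exists_desc {T} t ht := by
    have := h.epi
    obtain ⟨d, hd⟩ := (h.whiskerLeft W.obj).exists_desc (tmk W Y ≫ t) (by
      rw [← id_tensorHom, ← ModuleIn.id_hom, ← tmk_tensMap_assoc, ht, comp_zero])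
    refine ⟨(isTensorProduct_tmk W Z).desc d fun a => ?_, tens_hom_ext ?_⟩
    · rw [← cancel_epi (W.obj ◁ g.hom), whisker_exchange_assoc, hd, ← whiskerLeft_comp_assoc,
        ← g.smul_hom, whiskerLeft_comp_assoc, hd, tmk_smul_left_assoc, ← tmk_smul_right_assoc]
    · rw [tmk_tensMap_assoc, IsTensorProduct.fac, ModuleIn.id_hom, id_tensorHom, hd]

end

end Kernels

end Prolong

namespace Prolong

/-! ### Flatness with respect to all modules in `C` -/

section MonoFlat

variable {k : Type u} [Field k] {A : Type w} [CommRing A] [Algebra k A]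
variable {C : Type u₁} [Category.{v₁} C] [Abelian C] [Linear k C] [MonoidalCategory C]
  [MonoidalPreadditive C] [MonoidalLinear k C]

lemma RightExact.of_iso {X Y Z X' Y' Z' : C} {f : X ⟶ Y} {g : Y ⟶ Z} {f' : X' ⟶ Y'}
    {g' : Y' ⟶ Z'} (h : RightExact f g) (e₁ : X ≅ X') (e₂ : Y ≅ Y') (e₃ : Z ≅ Z')
    (hf : f ≫ e₂.hom = e₁.hom ≫ f') (hg : g ≫ e₃.hom = e₂.hom ≫ g') : RightExact f' g' where
  zero := by rw [← cancel_epi e₁.hom, ← reassoc_of% hf, ← hg, reassoc_of% h.zero]; simp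
  epi := by
    have := h.epi
    have : g' = e₂.inv ≫ g ≫ e₃.hom := by simp [hg]
    rw [this]; infer_instance
  exists_desc t ht := by
    obtain ⟨d, hd⟩ := h.exists_desc (e₂.hom ≫ t) (by rw [reassoc_of% hf, ht, comp_zero])
    refine ⟨e₃.inv ≫ d, ?_⟩
    rw [← cancel_epi e₂.hom, ← reassoc_of% hg, e₃.hom_inv_id_assoc, hd]

namespace IsTensorProduct

variable {X Y Z X' Y' Z' : ModuleIn k A C} {μ : X.obj ⊗ Y.obj ⟶ Z.obj}
  {μ' : X'.obj ⊗ Y'.obj ⟶ Z'.obj} (h : IsTensorProduct X Y Z μ)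

include h

/-- Lets injectivity of a map of tensor products be tested on any convenient models in place of the
chosen ones. -/
lemma mono_tensMap_iff [Module.Finite k A] (h' : IsTensorProduct X' Y' Z' μ') (f : X ⟶ X')
    (g : Y ⟶ Y') (m : Z.obj ⟶ Z'.obj) (hm : μ ≫ m = (f.hom ⊗ₘ g.hom) ≫ μ') :
    Mono (tensMap f g).hom ↔ Mono m := by
  let e := (isTensorProduct_tmk X Y).iso h
  let e' := (isTensorProduct_tmk X' Y').iso h'
  have h₁ : (tensMap f g).hom ≫ e'.hom.hom = e.hom.hom ≫ m := tens_hom_ext <| by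
    rw [tmk_tensMap_assoc]
    simp [e, e', hm]
  have h₂ : (tensMap f g).hom = e.hom.hom ≫ m ≫ e'.inv.hom := by
    rw [← reassoc_of% h₁, ModuleIn.hom_inv_id_hom, Category.comp_id]
  have h₃ : m = e.inv.hom ≫ (tensMap f g).hom ≫ e'.hom.hom := by
    rw [h₁, ModuleIn.inv_hom_id_hom_assoc]
  exact ⟨fun _ => h₃ ▸ inferInstance, fun _ => h₂ ▸ inferInstance⟩

variable [RigidCategory C]

/-- Tensoring with `V` preserves the defining quotient, so `X ⊗_A (Y ⊗ V)` is `(X ⊗_A Y) ⊗ V`. -/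
lemma whiskerRight (V : C) : IsTensorProduct X (Y.whiskerRight V) (Z.whiskerRight V)
    ((α_ _ _ _).inv ≫ μ ▷ V) where
  smul_left a := by
    rw [associator_inv_naturality_left_assoc, ← comp_whiskerRight, h.smul_left, comp_whiskerRight,
      Category.assoc]; rfl
  smul_right a := by
    change _ ◁ _ ▷ _ ≫ _ = _
    rw [associator_inv_naturality_middle_assoc, ← comp_whiskerRight, h.smul_right,
      comp_whiskerRight, Category.assoc]; rfl
  existsUnique T g hg := by
    obtain ⟨f, hf, hu⟩ := h.existsUnique_whiskerRight V ((α_ _ _ _).hom ≫ g) fun a => by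
      rw [associator_naturality_left_assoc, associator_naturality_middle_assoc]
      exact congrArg _ (hg a)
    refine ⟨f, ?_, fun f' hf' => hu f' ?_⟩
    · change _ = g
      rw [Category.assoc, hf, Iso.inv_hom_id_assoc]
    · change _ = _ ≫ g
      rw [← hf', Category.assoc, Iso.hom_inv_id_assoc]

lemma whiskerLeft (V : C) : IsTensorProduct (X.whiskerLeft V) Y (Z.whiskerLeft V)
    ((α_ _ _ _).hom ≫ V ◁ μ) where
  smul_left a := by
    change (_ ◁ _) ▷ _ ≫ _ = _
    rw [associator_naturality_middle_assoc, ← MonoidalCategory.whiskerLeft_comp, h.smul_left,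
      MonoidalCategory.whiskerLeft_comp, Category.assoc]; rfl
  smul_right a := by
    rw [associator_naturality_right_assoc, ← MonoidalCategory.whiskerLeft_comp, h.smul_right,
      MonoidalCategory.whiskerLeft_comp, Category.assoc]; rfl
  existsUnique T g hg := by
    obtain ⟨f, hf, hu⟩ := h.existsUnique_whiskerLeft V ((α_ _ _ _).inv ≫ g) fun a => by
      rw [associator_inv_naturality_middle_assoc, associator_inv_naturality_right_assoc]
      exact congrArg _ (hg a)
    refine ⟨f, ?_, fun f' hf' => hu f' ?_⟩
    · change _ = g
      rw [Category.assoc, hf, Iso.hom_inv_id_assoc]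
    · change _ = _ ≫ g
      rw [← hf', Category.assoc, Iso.inv_hom_id_assoc]

end IsTensorProduct

variable [Module.Finite k A]

/-- Tensoring with `X` over `A` preserves monomorphisms of `A`-modules in `C`. -/
def ModuleIn.IsMonoFlat (X : ModuleIn k A C) : Prop :=
  ∀ {W W' : ModuleIn k A C} (f : W ⟶ W'), Mono f.hom → Mono (tensMap f (𝟙 X)).hom

variable [SymmetricCategory C]

lemma IsTensorProduct.symm {X Y Z : ModuleIn k A C} {μ : X.obj ⊗ Y.obj ⟶ Z.obj}
    (h : IsTensorProduct X Y Z μ) : IsTensorProduct Y X Z ((β_ _ _).hom ≫ μ) where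
  smul_left a := by
    rw [BraidedCategory.braiding_naturality_left_assoc, h.smul_right, Category.assoc]
  smul_right a := by
    rw [BraidedCategory.braiding_naturality_right_assoc, h.smul_left, Category.assoc]
  existsUnique T g hg := by
    have hg' : ∀ a, X.smul a ▷ Y.obj ≫ (β_ _ _).hom ≫ g = X.obj ◁ Y.smul a ≫ (β_ _ _).hom ≫ g :=
      fun a => by
        rw [BraidedCategory.braiding_naturality_left_assoc,
          BraidedCategory.braiding_naturality_right_assoc, hg]
    refine ⟨h.desc _ hg', by simp, fun f hf => h.hom_ext ?_⟩
    rw [h.fac, ← hf]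
    simp

lemma RightExact.of_tensMap_symm {X Y Z : ModuleIn k A C} {f : X ⟶ Y} {g : Y ⟶ Z}
    {W : ModuleIn k A C} (h : RightExact (Prolong.tensMap (𝟙 W) f).hom (Prolong.tensMap (𝟙 W) g).hom) :
    RightExact (Prolong.tensMap f (𝟙 W)).hom (Prolong.tensMap g (𝟙 W)).hom := by
  let e (X : ModuleIn k A C) : (tens W X).obj ≅ (tens X W).obj :=
    ⟨(tensBraid W X).hom.hom, (tensBraid W X).inv.hom, by simp, by simp⟩
  exact h.of_iso (e X) (e Y) (e Z) (congrArg ModuleIn.Hom.hom (tensBraid_naturality (𝟙 W) f))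
    (congrArg ModuleIn.Hom.hom (tensBraid_naturality (𝟙 W) g))

variable [RigidCategory C]

lemma RightExact.tensMap_left {X Y Z : ModuleIn k A C} {f : X ⟶ Y} {g : Y ⟶ Z}
    (h : RightExact f.hom g.hom) (W : ModuleIn k A C) :
    RightExact (Prolong.tensMap f (𝟙 W)).hom (Prolong.tensMap g (𝟙 W)).hom :=
  (h.tensMap W).of_tensMap_symm

namespace ModuleIn.IsMonoFlat

variable {X Y : ModuleIn k A C}

lemma mono_right (h : X.IsMonoFlat) {W W' : ModuleIn k A C} (f : W ⟶ W') [Mono f.hom] :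
    Mono (tensMap (𝟙 X) f).hom := by
  have := h f inferInstance
  have e := congrArg ModuleIn.Hom.hom (tensBraid_naturality (𝟙 X) f)
  simp only [ModuleIn.comp_hom] at e
  have : Mono ((tensMap (𝟙 X) f).hom ≫ (tensBraid X W').hom.hom) := by
    rw [e]; infer_instance
  exact mono_of_mono _ (tensBraid X W').hom.hom

lemma of_iso (h : X.IsMonoFlat) (e : X ≅ Y) : Y.IsMonoFlat := fun {W W'} f hf => by
  have := h f hf
  have h₁ : tensMap f (𝟙 Y) = tensMap (𝟙 W) e.inv ≫ tensMap f (𝟙 X) ≫ tensMap (𝟙 W') e.hom := by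
    rw [tensMap_comp, tensMap_comp]; simp
  have h₂ : ∀ V : ModuleIn k A C, tensMap (𝟙 V) e.inv ≫ tensMap (𝟙 V) e.hom = 𝟙 _ := fun V => by
    rw [tensMap_comp]; simp
  have h₃ : ∀ V : ModuleIn k A C, tensMap (𝟙 V) e.hom ≫ tensMap (𝟙 V) e.inv = 𝟙 _ := fun V => by
    rw [tensMap_comp]; simp
  have : IsIso (tensMap (𝟙 W) e.inv).hom :=
    ⟨_, congrArg ModuleIn.Hom.hom (h₂ W), congrArg ModuleIn.Hom.hom (h₃ W)⟩
  have : IsIso (tensMap (𝟙 W') e.hom).hom :=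
    ⟨_, congrArg ModuleIn.Hom.hom (h₃ W'), congrArg ModuleIn.Hom.hom (h₂ W')⟩
  rw [h₁]
  exact inferInstanceAs (Mono ((tensMap (𝟙 W) e.inv).hom ≫ (tensMap f (𝟙 X)).hom ≫
    (tensMap (𝟙 W') e.hom).hom))

/-- `W ⊗_A (X ⊗ V)` is `(W ⊗_A X) ⊗ V`, and `- ⊗ V` preserves monomorphisms. With `constMod` below,
this makes all free modules `A ⊗ V` flat. -/
lemma whiskerRight (h : X.IsMonoFlat) (V : C) : (X.whiskerRight V).IsMonoFlat :=
  fun {W W'} f hf => by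
    have := h f hf
    rw [((isTensorProduct_tmk W X).whiskerRight V).mono_tensMap_iff
      ((isTensorProduct_tmk W' X).whiskerRight V) f (𝟙 (X.whiskerRight V))
      ((tensMap f (𝟙 X)).hom ▷ V)]
    · infer_instance
    · rw [Category.assoc, ← comp_whiskerRight, tmk_tensMap]
      simp

lemma constMod : (constMod k A C A).IsMonoFlat := fun {W W'} f hf => by
  rwa [(isTensorProduct_unitAct W).symm.mono_tensMap_iff (isTensorProduct_unitAct W').symm
    f (𝟙 _) f.hom]
  rw [ModuleIn.id_hom, tensorHom_id, BraidedCategory.braiding_naturality_left_assoc,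
    Category.assoc]
  congr 1
  refine (isConst_constι k A C A).hom_ext_whiskerRight fun m => ?_
  rw [ι_unitAct_assoc, ← whisker_exchange_assoc, ι_unitAct, f.smul_hom,
    leftUnitor_naturality_assoc]

lemma tens (hX : X.IsMonoFlat) (hY : Y.IsMonoFlat) : (tens X Y).IsMonoFlat :=
  fun {W W'} f hf => by
    have := hY _ (hX f hf)
    have e := congrArg ModuleIn.Hom.hom (tensAssoc_naturality f (𝟙 X) (𝟙 Y))
    simp only [ModuleIn.comp_hom, tensMap_id] at e
    have : Mono ((tensAssoc W X Y).hom.hom ≫ (tensMap f (𝟙 (Prolong.tens X Y))).hom) := by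
      rw [← e]; infer_instance
    have h : (tensMap f (𝟙 (Prolong.tens X Y))).hom = (tensAssoc W X Y).inv.hom ≫
      (tensAssoc W X Y).hom.hom ≫ (tensMap f (𝟙 (Prolong.tens X Y))).hom := by simp
    rw [h]
    exact mono_comp _ _

end ModuleIn.IsMonoFlat

end MonoFlat

end Prolong

namespace Prolong

/-! ### Exactness of the functor `M ↦ M ⊗_k 𝟙` -/

section ConstMap

variable {k : Type u} [Field k] {A : Type w} [CommRing A] [Algebra k A]
variable {C : Type u₁} [Category.{v₁} C] [Abelian C] [Linear k C] [MonoidalCategory C]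
  [MonoidalPreadditive C] [MonoidalLinear k C]

section

variable {M N P : Type w} [AddCommGroup M] [Module k M] [Module A M] [IsScalarTower k A M]
  [Module.Finite k M] [AddCommGroup N] [Module k N] [Module A N] [IsScalarTower k A N]
  [Module.Finite k N] [AddCommGroup P] [Module k P] [Module A P] [IsScalarTower k A P]
  [Module.Finite k P]

/-- The morphism of modules `M ⊗_k 𝟙 ⟶ N ⊗_k 𝟙` given by a linear map. -/
def constMap (f : M →ₗ[A] N) : constMod k A C M ⟶ constMod k A C N where
  hom := (isConst_constι k A C M).map (isConst_constι k A C N) (f.restrictScalars k)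
  smul_hom a := (isConst_constι k A C M).hom_ext fun m => by
    rw [← Category.assoc, ← (isConst_constι k A C M).smul, IsConst.ι_map, ← Category.assoc,
      IsConst.ι_map, ← (isConst_constι k A C N).smul]
    simp

@[simp]
lemma ι_constMap (f : M →ₗ[A] N) (m : M) :
    constι k A C M m ≫ (constMap (k := k) (C := C) f).hom = constι k A C N (f m) :=
  (isConst_constι k A C M).ι_map (isConst_constι k A C N) _ _

/-- Over the field `k` the map `f` has a linear retraction. It need not be `A`-linear, but it still
induces a retraction in `C`. -/
lemma mono_constMap {f : M →ₗ[A] N} (hf : Function.Injective f) :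
    Mono (constMap (k := k) (C := C) f).hom := by
  obtain ⟨r, hr⟩ := (f.restrictScalars k).exists_leftInverse_of_injective
    (LinearMap.ker_eq_bot.2 hf)
  have : (constMap (k := k) (C := C) f).hom ≫
      (isConst_constι k A C N).map (isConst_constι k A C M) r = 𝟙 _ :=
    (isConst_constι k A C M).hom_ext fun m => by
      rw [← Category.assoc, ι_constMap, IsConst.ι_map, Category.comp_id]
      exact congrArg _ (LinearMap.congr_fun hr m)
  have : Mono ((constMap (k := k) (C := C) f).hom ≫
      (isConst_constι k A C N).map (isConst_constι k A C M) r) := by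
    rw [this]; infer_instance
  exact mono_of_mono _ ((isConst_constι k A C N).map (isConst_constι k A C M) r)

/-- A `k`-linear section `s` of `g` provides the factorisation: `s (g n) - n` lies in the kernel of
`g`, hence in the image of `f`. -/
lemma rightExact_constMap {f : M →ₗ[A] N} {g : N →ₗ[A] P} (hfg : Function.Exact f g)
    (hg : Function.Surjective g) :
    RightExact (constMap (k := k) (C := C) f).hom (constMap (k := k) (C := C) g).hom where
  zero := (isConst_constι k A C M).hom_ext fun m => by
    rw [← Category.assoc, ι_constMap, ι_constMap, hfg.apply_apply_eq_zero, map_zero, comp_zero]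
  epi := ⟨fun s t hst => (isConst_constι k A C P).hom_ext fun m => by
    obtain ⟨n, rfl⟩ := hg m
    rw [← ι_constMap, Category.assoc, hst, Category.assoc]⟩
  exists_desc {T} t ht := by
    obtain ⟨s, hs⟩ := (g.restrictScalars k).exists_rightInverse_of_surjective
      (LinearMap.range_eq_top.2 hg)
    refine ⟨(isConst_constι k A C P).map (isConst_constι k A C N) s ≫ t,
      (isConst_constι k A C N).hom_ext fun n => ?_⟩
    have h₁ : g (s (g n) - n) = 0 := by
      rw [map_sub, sub_eq_zero]
      exact LinearMap.congr_fun hs (g n)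
    obtain ⟨m, hm⟩ := (hfg _).1 h₁
    have h₂ : constι k A C N (s (g n) - n) ≫ t = 0 := by
      rw [← hm, ← ι_constMap, Category.assoc, ht, comp_zero]
    rw [map_sub, Preadditive.sub_comp, sub_eq_zero] at h₂
    rw [← Category.assoc, ι_constMap, ← Category.assoc, IsConst.ι_map, h₂]

end

end ConstMap

/-! ### Comparison of the functors `M ⊗_A X` -/

section Comparison

variable {k : Type u} [Field k] {A : Type w} [CommRing A] [Algebra k A] [Module.Finite k A]
variable {C : Type u₁} [Category.{v₁} C] [Abelian C] [Linear k C]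

/-- Two objects with the universal property of `M ⊗_A X` are isomorphic. -/
lemma IsTensor.exists_iso {M : Type*} [AddCommGroup M] [Module A M] {X : ModuleIn k A C} {T T' : C}
    {β : M →+ (X.obj ⟶ T)} {β' : M →+ (X.obj ⟶ T')} (h : IsTensor X β) (h' : IsTensor X β') :
    ∃ e : T ≅ T', ∀ m, β m ≫ e.hom = β' m := by
  obtain ⟨f, hf, -⟩ := h.existsUnique _ β' h'.balanced
  obtain ⟨g, hg, -⟩ := h'.existsUnique _ β h.balanced
  exact ⟨⟨f, g,
    (h.existsUnique _ β h.balanced).unique (fun m => by rw [← Category.assoc, hf, hg])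
      fun m => Category.comp_id _,
    (h'.existsUnique _ β' h'.balanced).unique (fun m => by rw [← Category.assoc, hg, hf])
      fun m => Category.comp_id _⟩, hf⟩

variable [MonoidalCategory C] [MonoidalPreadditive C] [MonoidalLinear k C] [RigidCategory C]

section

variable {M N : Type w} [AddCommGroup M] [Module k M] [Module A M] [IsScalarTower k A M]
  [Module.Finite k M] [Module.Finite A M] [AddCommGroup N] [Module k N] [Module A N]
  [IsScalarTower k A N] [Module.Finite k N] [Module.Finite A N]

variable (M) in
lemma exists_tensorObj_iso (X : ModuleIn k A C) :
    ∃ e : tensorObj M X ≅ (tens (constMod k A C M) X).obj, ∀ m, tensorMk M X m ≫ e.hom =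
      (λ_ _).inv ≫ constι k A C M m ▷ X.obj ≫ tmk _ X :=
  (isTensor_tensorMk M X).exists_iso <|
    (isConst_constι k A C M).isTensor (isTensorProduct_tmk _ X)
      { toFun := fun m => (λ_ _).inv ≫ constι k A C M m ▷ X.obj ≫ tmk _ X
        map_zero' := by simp [MonoidalPreadditive.zero_whiskerRight]
        map_add' := fun a b => by simp [MonoidalPreadditive.add_whiskerRight] }
      fun _ => rfl

variable (M) in
/-- The objects `M ⊗_A X` and `(M ⊗_k 𝟙) ⊗_A X` are isomorphic. -/
def tensorObjIso (X : ModuleIn k A C) : tensorObj M X ≅ (tens (constMod k A C M) X).obj :=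
  (exists_tensorObj_iso M X).choose

lemma tensorMap_tensorObjIso (f : M →ₗ[A] N) (X : ModuleIn k A C) :
    tensorMap f X ≫ (tensorObjIso (k := k) N X).hom =
      (tensorObjIso (k := k) M X).hom ≫ (tensMap (constMap f) (𝟙 X)).hom :=
  tensor_hom_ext X fun m => by
    rw [← Category.assoc, tensorMk_tensorMap, ← Category.assoc]
    refine ((exists_tensorObj_iso N X).choose_spec _).trans ?_
    refine Eq.trans ?_ (congrArg (· ≫ _) ((exists_tensorObj_iso M X).choose_spec _)).symm
    rw [Category.assoc, Category.assoc, tmk_tensMap, ModuleIn.id_hom, tensorHom_id,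
      ← comp_whiskerRight_assoc, ι_constMap]

end

/-- The content of flatness as defined, moved to the tensor products with `M ⊗_k 𝟙` so that it can
be compared with arbitrary modules in `C`. -/
lemma ModuleIn.IsFlat.mono_tensMap_constMap {X : ModuleIn k A C} (hX : X.IsFlat)
    {M N : Type w} [AddCommGroup M] [Module k M] [Module A M] [IsScalarTower k A M]
    [Module.Finite k M] [Module.Finite A M] [AddCommGroup N] [Module k N] [Module A N]
    [IsScalarTower k A N] [Module.Finite k N] [Module.Finite A N] {f : M →ₗ[A] N}
    (hf : Function.Injective f) : Mono (tensMap (constMap (k := k) (C := C) f) (𝟙 X)).hom := by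
  have := hX.preservesFiniteLimits
  have : Mono (FGModuleCat.ofHom f) := ConcreteCategory.mono_of_injective _ hf
  have : Mono (tensorMap f X) := inferInstanceAs (Mono ((tensorFunctor X).map (FGModuleCat.ofHom f)))
  have h : (tensMap (constMap (k := k) (C := C) f) (𝟙 X)).hom =
      (tensorObjIso (k := k) M X).inv ≫ tensorMap f X ≫ (tensorObjIso (k := k) N X).hom := by
    rw [tensorMap_tensorObjIso, Iso.inv_hom_id_assoc]
  rw [h]
  infer_instance

lemma tensorFunctor_additive (X : ModuleIn k A C) : (tensorFunctor X).Additive where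
  map_add {M N f g} := tensor_hom_ext X fun m => by
    refine (tensorMk_tensorMap _ _ _).trans ?_
    refine Eq.trans ?_ (Preadditive.comp_add _ _ _ _ _ _).symm
    refine Eq.trans ?_ (congrArg₂ (· + ·) (tensorMk_tensorMap f.hom.hom X m)
      (tensorMk_tensorMap g.hom.hom X m)).symm
    exact map_add (tensorMk N X) _ _

variable [SymmetricCategory C]

/-- `M ↦ M ⊗_k 𝟙` is exact, and `- ⊗_A X` is right exact and preserves monomorphisms, so short exact
sequences go to short exact sequences. For an additive functor of abelian categories this is
exactness. -/
lemma ModuleIn.IsMonoFlat.isFlat {X : ModuleIn k A C} (hX : X.IsMonoFlat) : X.IsFlat := by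
  have : IsNoetherianRing A := IsNoetherianRing.of_finite k A
  have := tensorFunctor_additive X
  suffices h : ∀ S : ShortComplex (FGModuleCat.{w} A), S.ShortExact →
      (S.map (tensorFunctor X)).ShortExact by
    have := ((tensorFunctor X).exact_tfae.out 0 3).1 h
    exact ⟨this.1, this.2⟩
  intro S hS
  have hS' := hS.map_of_exact (forget₂ (FGModuleCat.{w} A) (ModuleCat.{w} A))
  have h₁ : Function.Injective S.f.hom.hom := hS'.moduleCat_injective_f
  have h₂ : Function.Surjective S.g.hom.hom := hS'.moduleCat_surjective_g
  have h₃ : Function.Exact S.f.hom.hom S.g.hom.hom := (ShortComplex.ShortExact.moduleCat_exact_iff_function_exact _).1 hS'.exact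
  -- Objects of `FGModuleCat A` carry only an `A`-structure; the `k`-structure needed by `constMod`
  -- is restricted from it.
  let (M : FGModuleCat.{w} A) : Module k M := Module.compHom M (algebraMap k A)
  have (M : FGModuleCat.{w} A) : IsScalarTower k A M := .of_algebraMap_smul fun _ _ => rfl
  have (M : FGModuleCat.{w} A) : Module.Finite k M := .trans A M
  have hR := (rightExact_constMap (k := k) (C := C) h₃ h₂).tensMap_left X
  have hM := hX _ (mono_constMap (k := k) (C := C) h₁)
  have hR' : RightExact (tensorMap S.f.hom.hom X) (tensorMap S.g.hom.hom X) :=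
    hR.of_iso (tensorObjIso (k := k) _ X).symm (tensorObjIso (k := k) _ X).symm
      (tensorObjIso (k := k) _ X).symm
      (by rw [Iso.symm_hom, Iso.symm_hom, Iso.comp_inv_eq, Category.assoc, tensorMap_tensorObjIso,
        Iso.inv_hom_id_assoc])
      (by rw [Iso.symm_hom, Iso.symm_hom, Iso.comp_inv_eq, Category.assoc, tensorMap_tensorObjIso,
        Iso.inv_hom_id_assoc])
  have hM' : Mono (tensorMap S.f.hom.hom X) := by
    have := mono_comp (tensorObjIso (k := k) S.X₁ X).hom (tensMap (constMap S.f.hom.hom) (𝟙 X)).hom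
    rw [← tensorMap_tensorObjIso] at this
    exact mono_of_mono _ (tensorObjIso (k := k) S.X₂ X).hom
  exact { exact := hR'.exact, mono_f := hM', epi_g := hR'.epi }

end Comparison

/-! ### Flat modules over quasi-separable algebras -/

section Separable

/-- Differentiating `p(a) = 0`, for `p` the minimal polynomial of `a`, gives `p'(a) da = 0`, and
separability makes `p'(a)` invertible. So every `da` vanishes, and these generate the differentials.
-/
lemma formallyUnramified_of_isSeparable (k : Type u) [Field k] (A : Type w) [CommRing A]
    [Algebra k A] [Algebra.IsSeparable k A] : Algebra.FormallyUnramified k A := by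
  refine ⟨subsingleton_of_forall_eq 0 fun x => ?_⟩
  have hx : x ∈ Submodule.span A (Set.range (KaehlerDifferential.D k A)) := by
    rw [KaehlerDifferential.span_range_derivation]; trivial
  induction hx using Submodule.span_induction with
  | mem x hx =>
    obtain ⟨a, rfl⟩ := hx
    obtain ⟨p, q, hpq⟩ := Algebra.IsSeparable.isSeparable k a
    have h₁ : Polynomial.aeval a q * Polynomial.aeval a (minpoly k a).derivative = 1 := by
      simpa using congrArg (Polynomial.aeval a) hpq
    have h₂ := (KaehlerDifferential.D k A).map_aeval (minpoly k a) a
    rw [minpoly.aeval, map_zero] at h₂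
    rw [← one_smul A (KaehlerDifferential.D k A a), ← h₁, mul_smul, ← h₂, smul_zero]
  | zero => rfl
  | add x y _ _ hx hy => rw [hx, hy, add_zero]
  | smul a x _ hx => rw [hx, smul_zero]

variable {k : Type u} [Field k] {A : Type w} [CommRing A] [Algebra k A] [Module.Finite k A]
variable {C : Type u₁} [Category.{v₁} C] [Abelian C] [Linear k C]

/-- A property of modules stable under extensions holds for all modules if it holds for those
killed by some finitely many nilpotent elements. -/
lemma ModuleIn.devissage (P : ModuleIn k A C → Prop)
    (hP : ∀ {W' W W'' : ModuleIn k A C} (i : W' ⟶ W) (q : W ⟶ W''), Mono i.hom →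
      RightExact i.hom q.hom → P W' → P W'' → P W)
    (s : Finset A) (hs : ∀ a ∈ s, IsNilpotent a)
    (h : ∀ W : ModuleIn k A C, (∀ a ∈ s, W.smul a = 0) → P W) (W : ModuleIn k A C) : P W := by
  classical
  induction s using Finset.induction_on with
  | empty => exact h W (by simp)
  | insert a s _ ih =>
    refine ih (fun b hb => hs b (Finset.mem_insert_of_mem hb)) fun W hW => ?_
    obtain ⟨n, hn⟩ := hs a (Finset.mem_insert_self a s)
    have hW' : W.smul (a ^ n) = 0 := by rw [hn, W.smul_zero]
    clear hn
    induction n generalizing W with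
    | zero =>
      -- For `n = 0` the identity of `W` is zero, so every element acts by zero.
      refine h W fun b _ => ?_
      rw [pow_zero, W.smul_one] at hW'
      rw [← Category.comp_id (W.smul b), hW', comp_zero]
    | succ n ihn =>
      -- `W` is an extension of `W / aW`, killed by `a`, by the kernel `aW` of `q`, killed by `a ^
      -- n`. Both remain killed by the other elements of `s`.
      let q := cokerπ (smulHom W a)
      refine hP (kerι q) q inferInstance (rightExact_kerι q) (ihn _ (fun b hb => ?_) ?_)
        (h _ fun b hb => ?_)
      · rw [← cancel_mono (kerι q).hom, (kerι q).smul_hom, hW b hb, comp_zero, zero_comp]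
      · obtain ⟨T, π, _, y, hy⟩ := (rightExact_cokerπ (smulHom W a)).exists_lift (kerι q).hom
          (kernel.condition _)
        rw [← cancel_mono (kerι q).hom, (kerι q).smul_hom, ← cancel_epi π, reassoc_of% hy,
          smulHom_hom, ← W.smul_mul, ← pow_succ', hW']
        simp
      · rw [← cancel_epi q.hom, ← q.smul_hom, comp_zero]
        rcases Finset.mem_insert.1 hb with rfl | hb
        · exact (rightExact_cokerπ (smulHom W b)).zero
        · rw [hW b hb, zero_comp]

variable [MonoidalCategory C] [MonoidalPreadditive C] [MonoidalLinear k C] [RigidCategory C]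

/-- A module over an unramified quotient `A ⧸ I` is a direct factor of a multiple of `A ⧸ I`. -/
lemma ModuleIn.exists_retract (I : Ideal A) [Algebra.FormallyUnramified k (A ⧸ I)]
    (W : ModuleIn k A C) (hW : ∀ a ∈ I, W.smul a = 0) :
    ∃ (s : W ⟶ (constMod k A C (A ⧸ I)).whiskerLeft W.obj)
      (r : (constMod k A C (A ⧸ I)).whiskerLeft W.obj ⟶ W), s ≫ r = 𝟙 W := by
  let K := A ⧸ I
  let L := constMod k A C K
  let ι := constι k A C K
  have hι : IsConst L ι := isConst_constι k A C K
  let γ : K →ₐ[k] End W.obj := Ideal.Quotient.liftₐ I W.act hW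
  have hγ : ∀ a : A, (γ (Ideal.Quotient.mk I a) : W.obj ⟶ W.obj) = W.smul a := fun a => rfl
  obtain ⟨r, hr, -⟩ := hι.existsUnique_whiskerLeft W.obj (T := W.obj) γ.toLinearMap
  -- In element notation `Φ (x ⊗ y)` is `w ↦ y w ⊗ x`.
  let Φ : TensorProduct k K K →ₗ[k] (W.obj ⟶ W.obj ⊗ L.obj) := TensorProduct.lift
    (LinearMap.mk₂ k (fun x y => (ρ_ _).inv ≫ W.obj ◁ ι x ≫ (γ y : W.obj ⟶ W.obj) ▷ L.obj)
      (fun x x' y => by simp [MonoidalPreadditive.whiskerLeft_add])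
      (fun c x y => by simp)
      (fun x y y' => by
        rw [map_add]
        simp only [← Preadditive.comp_add]
        exact congrArg (fun t => _ ≫ _ ≫ t) (MonoidalPreadditive.add_whiskerRight ..))
      (fun c x y => by
        rw [map_smul]
        simp only [← Linear.comp_smul]
        exact congrArg (fun t => _ ≫ _ ≫ t) (MonoidalLinear.smul_whiskerRight ..)))
  have hΦ : ∀ x y, Φ (x ⊗ₜ y) = (ρ_ _).inv ≫ W.obj ◁ ι x ≫ (γ y : W.obj ⟶ W.obj) ▷ L.obj :=
    fun x y => rfl
  -- The separability idempotent: `(1 ⊗ a) t = (a ⊗ 1) t` makes `Φ t` linear over `A`, by `h₁` and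
  -- `h₂`, and multiplication sends `t` to `1`, so that `Φ t` is a section of `r` by `h₃`.
  let t := Algebra.FormallyUnramified.elem k K
  have h₁ : ∀ (a : A) z, Φ ((Ideal.Quotient.mk I a ⊗ₜ 1) * z) = Φ z ≫ W.obj ◁ L.smul a := by
    intro a z
    induction z with
    | zero => simp
    | add x y hx hy => rw [mul_add, map_add, map_add, hx, hy, Preadditive.add_comp]
    | tmul x y =>
      rw [Algebra.TensorProduct.tmul_mul_tmul, one_mul, hΦ, hΦ]
      have : ι (Ideal.Quotient.mk I a * x) = ι x ≫ L.smul a := hι.smul a x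
      rw [this, MonoidalCategory.whiskerLeft_comp, Category.assoc, Category.assoc, Category.assoc,
        whisker_exchange]
  have h₂ : ∀ (a : A) z, Φ ((1 ⊗ₜ Ideal.Quotient.mk I a) * z) = W.smul a ≫ Φ z := by
    intro a z
    induction z with
    | zero => simp
    | add x y hx hy => rw [mul_add, map_add, map_add, hx, hy, Preadditive.comp_add]
    | tmul x y =>
      rw [Algebra.TensorProduct.tmul_mul_tmul, one_mul, hΦ, hΦ]
      have : (γ (Ideal.Quotient.mk I a * y) : W.obj ⟶ W.obj) =
          W.smul a ≫ (γ y : W.obj ⟶ W.obj) := by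
        rw [mul_comm, map_mul]; rfl
      rw [this, comp_whiskerRight, rightUnitor_inv_naturality_assoc, whisker_exchange_assoc]
  have h₃ : ∀ z, Φ z ≫ r = γ (Algebra.TensorProduct.lmul' k z) := by
    intro z
    induction z with
    | zero => rw [map_zero, map_zero, map_zero, zero_comp]
    | add x y hx hy => rw [map_add, map_add, map_add, Preadditive.add_comp, hx, hy]
    | tmul x y =>
      rw [hΦ, Category.assoc, Category.assoc, whisker_exchange_assoc, hr, rightUnitor_naturality_assoc,
        Iso.inv_hom_id_assoc, Algebra.TensorProduct.lmul'_apply_tmul, map_mul]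
      rfl
  refine ⟨⟨Φ t, fun a => ?_⟩, ⟨r, fun a => hι.hom_ext_whiskerLeft fun m => ?_⟩,
    ModuleIn.hom_ext ?_⟩
  · rw [← h₂, Algebra.FormallyUnramified.one_tmul_mul_elem, h₁]
    rfl
  · change _ ◁ _ ≫ _ ◁ _ ≫ _ = _
    rw [← whiskerLeft_comp_assoc, ← hι.smul, hr, reassoc_of% hr]
    have : (γ (a • m) : W.obj ⟶ W.obj) = (γ m : W.obj ⟶ W.obj) ≫ W.smul a := by
      rw [Algebra.smul_def, map_mul]; rfl
    exact congrArg _ this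
  · refine (h₃ t).trans ?_
    rw [Algebra.FormallyUnramified.lmul_elem, map_one]
    rfl

lemma tensMap_exchange {X Y W W' : ModuleIn k A C} (f : W ⟶ W') (g : X ⟶ Y) :
    (tensMap f (𝟙 X)).hom ≫ (tensMap (𝟙 W') g).hom =
      (tensMap (𝟙 W) g).hom ≫ (tensMap f (𝟙 Y)).hom := by
  rw [← ModuleIn.comp_hom, ← ModuleIn.comp_hom, tensMap_comp, tensMap_comp]
  simp

/-- The canonical morphism from the free module `A ⊗_k X` to `X`. -/
def freeπ (X : ModuleIn k A C) : (constMod k A C A).whiskerRight X.obj ⟶ X :=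
  ⟨unitAct X, (isTensorProduct_unitAct X).smul_left⟩

instance (X : ModuleIn k A C) : Epi (freeπ X).hom := by
  have : Epi (constι k A C A 1 ▷ X.obj ≫ (freeπ X).hom) := by
    change Epi (constι k A C A 1 ▷ X.obj ≫ unitAct X)
    rw [ι_one_unitAct]; infer_instance
  exact epi_of_epi (constι k A C A 1 ▷ X.obj) _

variable [SymmetricCategory C]

lemma isMonoFlat_free (V : C) : ((constMod k A C A).whiskerRight V).IsMonoFlat :=
  ModuleIn.IsMonoFlat.constMod.whiskerRight V

/-- A vanishing of `Tor_1(W, X)`, computed with the free cover of `X`. It is proved for `A ⧸ I`,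
where flatness of `X` applies, then for `W ⊗ (A ⧸ I)`, then for its direct factor `W`. -/
lemma ModuleIn.IsFlat.mono_of_unramified {X : ModuleIn k A C} (hX : X.IsFlat) (I : Ideal A)
    [Algebra.FormallyUnramified k (A ⧸ I)] (W : ModuleIn k A C) (hW : ∀ a ∈ I, W.smul a = 0) :
    Mono (tensMap (𝟙 W) (kerι (freeπ X))).hom := by
  have : IsNoetherianRing A := IsNoetherianRing.of_finite k A
  let p := freeπ X
  let i := constMap (k := k) (C := C) I.subtype
  let q := constMap (k := k) (C := C) I.mkQ
  have hiq : RightExact i.hom q.hom := rightExact_constMap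
    (LinearMap.exact_subtype_mkQ I) I.mkQ_surjective
  have hi : Mono (tensMap i (𝟙 X)).hom := hX.mono_tensMap_constMap I.subtype_injective
  have hp := rightExact_kerι p
  -- Snake lemma for `I ⟶ A ⟶ A ⧸ I` tensored with the kernel of `p`, the free cover and `X`. The
  -- needed injectivity of `I ⊗_A X ⟶ A ⊗_A X` is `hi`.
  have h : Mono (tensMap (𝟙 (constMod k A C (A ⧸ I))) (kerι p)).hom :=
    mono_of_snake (hp.tensMap _) (hp.tensMap _).zero (hiq.tensMap_left _) (hiq.tensMap_left _).epi
      (hiq.tensMap_left _).zero (IsMonoFlat.constMod.mono_right (kerι p)) hi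
      (tensMap_exchange i (kerι p)).symm (tensMap_exchange i p).symm (tensMap_exchange q (kerι p)).symm
  have h' : Mono (tensMap (𝟙 ((constMod k A C (A ⧸ I)).whiskerLeft W.obj)) (kerι p)).hom := by
    rw [((isTensorProduct_tmk (constMod k A C (A ⧸ I)) (ker p)).whiskerLeft W.obj).mono_tensMap_iff
      ((isTensorProduct_tmk _ _).whiskerLeft W.obj) _ _ (W.obj ◁ (tensMap (𝟙 _) (kerι p)).hom)]
    · infer_instance
    · rw [Category.assoc, ← MonoidalCategory.whiskerLeft_comp, tmk_tensMap]
      simp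
  obtain ⟨s, r, hsr⟩ := W.exists_retract I hW
  have hs : Mono (tensMap s (𝟙 (ker p))).hom := by
    have : (tensMap s (𝟙 (ker p))).hom ≫ (tensMap r (𝟙 (ker p))).hom = 𝟙 _ := by
      rw [← comp_hom, tensMap_comp, hsr]
      simp
    have : Mono ((tensMap s (𝟙 (ker p))).hom ≫ (tensMap r (𝟙 (ker p))).hom) := by
      rw [this]; infer_instance
    exact mono_of_mono _ (tensMap r (𝟙 (ker p))).hom
  have := mono_comp (tensMap s (𝟙 (ker p))).hom (tensMap (𝟙 _) (kerι p)).hom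
  rw [tensMap_exchange] at this
  exact mono_of_mono _ (tensMap s (𝟙 _)).hom

/-- A flat module over a quasi-separable algebra is flat with respect to all modules in `C`. -/
lemma ModuleIn.IsFlat.isMonoFlat [IsQuasiSeparable k A] {X : ModuleIn k A C} (hX : X.IsFlat) :
    X.IsMonoFlat := by
  have : IsNoetherianRing A := IsNoetherianRing.of_finite k A
  have : Algebra.IsSeparable k (A ⧸ nilradical A) := IsQuasiSeparable.separable_reduced
  have := formallyUnramified_of_isSeparable k (A ⧸ nilradical A)
  -- Finitely many nilpotent generators, for use in the dévissage.
  obtain ⟨s, hs⟩ := (nilradical A).fg_of_isNoetherianRing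
  have hF : ((Prolong.constMod k A C A).whiskerRight X.obj).IsMonoFlat := isMonoFlat_free X.obj
  have hW (W : ModuleIn k A C) : Mono (tensMap (𝟙 W) (kerι (freeπ X))).hom := by
    refine devissage (fun W => Mono (tensMap (𝟙 W) (kerι (freeπ X))).hom)
      (fun i q hi hiq h' h'' => ?_) s (fun a ha => ?_) (fun W h => ?_) W
    -- Stability under extensions rests on the free cover being flat with respect to all modules in
    -- `C`.
    · exact mono_of_mono_of_mono (hiq.tensMap_left _) (hF i hi) h' h''
        (tensMap_exchange i (kerι (freeπ X))) (tensMap_exchange q (kerι (freeπ X)))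
    · rw [← mem_nilradical, ← hs]
      exact Ideal.subset_span ha
    · refine hX.mono_of_unramified (nilradical A) W fun a ha => ?_
      rw [← hs] at ha
      induction ha using Submodule.span_induction with
      | mem a ha => exact h a ha
      | zero => exact W.smul_zero
      | add a b _ _ ha hb => rw [W.smul_add, ha, hb, add_zero]
      | smul a b _ hb => rw [smul_eq_mul, W.smul_mul, hb, comp_zero]
  intro W W' f hf
  have hf' : RightExact f.hom (cokerπ f).hom := rightExact_cokerπ f
  have hp := rightExact_kerι (freeπ X)
  -- Snake lemma for `W ⟶ W' ⟶ coker f` tensored with the kernel, the free cover and `X`; the input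
  -- on the right is `hW` for the cokernel of `f`.
  exact mono_of_snake (hf'.tensMap_left _) (hf'.tensMap_left _).zero (hp.tensMap _)
    (hp.tensMap _).epi (hp.tensMap _).zero (hF f hf) (hW _) (tensMap_exchange f _)
    (tensMap_exchange _ _) (tensMap_exchange f _)

end Separable

end Prolong

namespace Prolong

/-! ### Pairings -/

section Pairing

variable {C : Type u₁} [Category.{v₁} C] [MonoidalCategory C]

lemma tensorLeftHomEquiv_symm_comp_rightUnitor_inv {T Y Y' : C} [ExactPairing Y Y'] (f : T ⟶ Y) :
    (tensorLeftHomEquiv T Y Y' (𝟙_ C)).symm (f ≫ (ρ_ Y).inv) = Y' ◁ f ≫ ε_ Y Y' := by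
  rw [tensorLeftHomEquiv_symm_naturality]
  congr 1
  simp [tensorLeftHomEquiv, unitors_equal]

/-- Morphisms to `Y` are pairings with a dual of `Y`. -/
def pairEquiv (T Y Y' : C) [ExactPairing Y Y'] : (T ⟶ Y) ≃ (Y' ⊗ T ⟶ 𝟙_ C) where
  toFun f := Y' ◁ f ≫ ε_ Y Y'
  invFun h := tensorLeftHomEquiv T Y Y' (𝟙_ C) h ≫ (ρ_ Y).hom
  left_inv f := by
    dsimp only
    rw [← tensorLeftHomEquiv_symm_comp_rightUnitor_inv]; simp
  right_inv h := by
    dsimp only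
    rw [← tensorLeftHomEquiv_symm_comp_rightUnitor_inv]; simp

lemma pairEquiv_apply {T Y Y' : C} [ExactPairing Y Y'] (f : T ⟶ Y) :
    pairEquiv T Y Y' f = Y' ◁ f ≫ ε_ Y Y' := rfl

lemma copairing_injective {Y Y' S : C} [ExactPairing Y Y'] {f g : Y ⟶ S}
    (h : η_ Y Y' ≫ f ▷ Y' = η_ Y Y' ≫ g ▷ Y') : f = g := by
  have key : ∀ f : Y ⟶ S, tensorRightHomEquiv (𝟙_ C) Y Y' S ((λ_ Y).hom ≫ f) =
      η_ Y Y' ≫ f ▷ Y' := fun f => by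
    rw [tensorRightHomEquiv_naturality]
    congr 1
    simp [tensorRightHomEquiv, unitors_equal]
  have := (key f).trans (h.trans (key g).symm)
  simpa using (tensorRightHomEquiv (𝟙_ C) Y Y' S).injective this

/-- A morphism into a dual is determined by the pairing it defines. Composing with the transpose of
`f` amounts to inserting `f` in the other variable, and that can be cancelled. -/
lemma mono_rightAdjointMate {X Y : C} [HasRightDual X] [HasRightDual Y] (f : X ⟶ Y)
    [∀ T : C, Epi (T ◁ f)] : Mono (fᘁ : Yᘁ ⟶ Xᘁ) where
  right_cancellation {T} g h hgh := pairing_injective_right (Y := Y) <| by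
    rw [← cancel_epi (T ◁ f), whisker_exchange_assoc, whisker_exchange_assoc,
      ← rightAdjointMate_comp_evaluation, ← comp_whiskerRight_assoc, hgh, comp_whiskerRight_assoc]

lemma epi_leftAdjointMate {X Y : C} [HasLeftDual X] [HasLeftDual Y] (f : X ⟶ Y)
    [∀ T : C, Mono (T ◁ f)] : Epi (ᘁf : (ᘁY) ⟶ ᘁX) where
  left_cancellation {T} g h hgh := copairing_injective (Y' := X) <| by
    rw [← cancel_mono (T ◁ f), Category.assoc, Category.assoc, ← whisker_exchange,
      ← whisker_exchange, ← coevaluation_comp_leftAdjointMate_assoc,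
      ← coevaluation_comp_leftAdjointMate_assoc, ← comp_whiskerRight, hgh, comp_whiskerRight]

end Pairing

/-! ### Internal homs -/

section InternalHom

variable {k : Type u} [Field k] {A : Type w} [CommRing A] [Algebra k A]
variable {C : Type u₁} [Category.{v₁} C] [Preadditive C] [Linear k C] [MonoidalCategory C]

/-- `H`, with the evaluation `e : X ⊗ H ⟶ Y`, is the internal hom of `A`-modules from `X` to
`Y`. -/
structure IsInternalHom (X Y H : ModuleIn k A C) (e : X.obj ⊗ H.obj ⟶ Y.obj) : Prop where
  smul_left : ∀ a, X.smul a ▷ H.obj ≫ e = e ≫ Y.smul a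
  smul_right : ∀ a, X.obj ◁ H.smul a ≫ e = e ≫ Y.smul a
  existsUnique : ∀ {T : C} (φ : X.obj ⊗ T ⟶ Y.obj), (∀ a, X.smul a ▷ T ≫ φ = φ ≫ Y.smul a) →
    ∃! g : T ⟶ H.obj, X.obj ◁ g ≫ e = φ

namespace IsInternalHom

variable {X Y H : ModuleIn k A C} {e : X.obj ⊗ H.obj ⟶ Y.obj}

lemma hom_ext (h : IsInternalHom X Y H e) {T : C} {f g : T ⟶ H.obj}
    (hfg : X.obj ◁ f ≫ e = X.obj ◁ g ≫ e) : f = g :=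
  (h.existsUnique (X.obj ◁ g ≫ e) fun a => by
    rw [← whisker_exchange_assoc, h.smul_left, Category.assoc]).unique hfg rfl

variable [MonoidalPreadditive C] [MonoidalLinear k C]

/-- The action of `A` on an internal hom is determined by its universal property. -/
lemma exists_of_obj {H : C} (e : X.obj ⊗ H ⟶ Y.obj)
    (he : ∀ a, X.smul a ▷ H ≫ e = e ≫ Y.smul a)
    (h : ∀ {T : C} (φ : X.obj ⊗ T ⟶ Y.obj), (∀ a, X.smul a ▷ T ≫ φ = φ ≫ Y.smul a) →
      ∃! g : T ⟶ H, X.obj ◁ g ≫ e = φ) :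
    ∃ act : A →ₐ[k] End H, IsInternalHom X Y ⟨H, act⟩ e := by
  have hext {T : C} {f g : T ⟶ H} (hfg : X.obj ◁ f ≫ e = X.obj ◁ g ≫ e) : f = g :=
    (h (X.obj ◁ g ≫ e) fun a => by
      rw [← whisker_exchange_assoc, he, Category.assoc]).unique hfg rfl
  choose s hs using fun a : A => (h (e ≫ Y.smul a) fun b => by
    rw [reassoc_of% he, Y.smul_comm, Category.assoc]).exists
  let M : ModuleIn k A C := .ofSmul H s
    (fun a b => hext <| by
      rw [hs, Y.smul_add, Preadditive.comp_add, MonoidalPreadditive.whiskerLeft_add,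
        Preadditive.add_comp, hs, hs])
    (fun r a => hext <| by
      rw [hs, Y.smul_smul, Linear.comp_smul, MonoidalLinear.whiskerLeft_smul, Linear.smul_comp, hs])
    (hext <| by rw [hs, Y.smul_one, MonoidalCategory.whiskerLeft_id, Category.comp_id,
      Category.id_comp])
    (fun a b => hext <| by
      rw [hs, Y.smul_mul, MonoidalCategory.whiskerLeft_comp, Category.assoc, hs, ← Category.assoc,
        ← Category.assoc, hs])
  exact ⟨M.act, he, hs, h⟩

variable [RigidCategory C]

/-- The internal hom is the dual of a tensor product. -/
lemma existsUnique_of_isTensorProduct {W Z : ModuleIn k A C} [ExactPairing Y.obj W.obj]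
    (hW : ∀ a, W.smul a ▷ Y.obj ≫ ε_ Y.obj W.obj = W.obj ◁ Y.smul a ≫ ε_ Y.obj W.obj)
    {μ : W.obj ⊗ X.obj ⟶ Z.obj} (hμ : IsTensorProduct W X Z μ)
    (e : X.obj ⊗ (ᘁ(Z.obj) : C) ⟶ Y.obj)
    (he : W.obj ◁ e ≫ ε_ Y.obj W.obj = (α_ _ _ _).inv ≫ μ ▷ _ ≫ ε_ _ _) :
    (∀ a, X.smul a ▷ _ ≫ e = e ≫ Y.smul a) ∧
    ∀ {T : C} (φ : X.obj ⊗ T ⟶ Y.obj), (∀ a, X.smul a ▷ T ≫ φ = φ ≫ Y.smul a) →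
      ∃! g : T ⟶ (ᘁ(Z.obj) : C), X.obj ◁ g ≫ e = φ := by
  refine ⟨fun a => (pairEquiv _ Y.obj W.obj).injective ?_, fun {T} φ hφ => ?_⟩
  · rw [pairEquiv_apply, pairEquiv_apply, MonoidalCategory.whiskerLeft_comp, Category.assoc, he,
      MonoidalCategory.whiskerLeft_comp, Category.assoc, ← hW, whisker_exchange_assoc, he,
      associator_inv_naturality_left_assoc, associator_inv_naturality_middle_assoc,
      ← comp_whiskerRight_assoc, ← comp_whiskerRight_assoc, hμ.condition]
  -- Morphisms `X ⊗ T ⟶ Y` are pairings on `W ⊗ X ⊗ T`. Linearity over `A` means that the pairing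
  -- factors through `Z ⊗ T`, and pairings on `Z ⊗ T` are morphisms from `T` to the left dual of
  -- `Z`.
  · refine existsUnique_congr_equiv (pairEquiv T _ Z.obj) (fun g => ?_)
      (hμ.existsUnique_whiskerRight T ((α_ _ _ _).hom ≫ W.obj ◁ φ ≫ ε_ Y.obj W.obj) fun a => ?_)
    · rw [← (pairEquiv _ Y.obj W.obj).injective.eq_iff, pairEquiv_apply, pairEquiv_apply,
        pairEquiv_apply, MonoidalCategory.whiskerLeft_comp, Category.assoc, he,
        ← cancel_epi (α_ _ _ _).hom, associator_inv_naturality_right_assoc,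
        Iso.hom_inv_id_assoc, whisker_exchange_assoc]
    · rw [associator_naturality_left_assoc, associator_naturality_middle_assoc,
        ← whisker_exchange_assoc, hW, ← MonoidalCategory.whiskerLeft_comp_assoc,
        ← MonoidalCategory.whiskerLeft_comp_assoc, hφ]

end IsInternalHom

end InternalHom

/-! ### Construction and exactness of the internal hom -/

section Ihom

variable {k : Type u} [Field k] {A : Type w} [CommRing A] [Algebra k A]
variable {C : Type u₁} [Category.{v₁} C] [Abelian C] [Linear k C] [MonoidalCategory C]
  [MonoidalPreadditive C] [MonoidalLinear k C] [RigidCategory C]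

namespace ModuleIn

instance (Y : ModuleIn k A C) : ExactPairing Y.obj Y.dual.obj :=
  inferInstanceAs (ExactPairing Y.obj (Y.obj)ᘁ)

lemma dual_smul_evaluation (Y : ModuleIn k A C) (a : A) :
    Y.dual.smul a ▷ Y.obj ≫ ε_ Y.obj Y.dual.obj = Y.dual.obj ◁ Y.smul a ≫ ε_ Y.obj Y.dual.obj :=
  rightAdjointMate_comp_evaluation (Y.smul a)

/-- The transpose of a morphism of modules. -/
def dualMap {X Y : ModuleIn k A C} (f : X ⟶ Y) : Y.dual ⟶ X.dual where
  hom := (f.homᘁ : (Y.obj)ᘁ ⟶ (X.obj)ᘁ)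
  smul_hom a := comp_rightAdjointMate.symm.trans
    ((congrArg rightAdjointMate (f.smul_hom a).symm).trans comp_rightAdjointMate)

lemma dualMap_evaluation {X Y : ModuleIn k A C} (f : X ⟶ Y) :
    (dualMap f).hom ▷ X.obj ≫ ε_ X.obj X.dual.obj = Y.dual.obj ◁ f.hom ≫ ε_ Y.obj Y.dual.obj :=
  rightAdjointMate_comp_evaluation f.hom

lemma mono_dualMap {X Y : ModuleIn k A C} (f : X ⟶ Y) [Epi f.hom] : Mono (dualMap f).hom :=
  mono_rightAdjointMate f.hom

end ModuleIn

variable [Module.Finite k A]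

/-- The evaluation of the internal hom. -/
def ihomEv (X Y : ModuleIn k A C) : X.obj ⊗ (ᘁ((tens Y.dual X).obj) : C) ⟶ Y.obj :=
  (pairEquiv _ Y.obj Y.dual.obj).symm ((α_ _ _ _).inv ≫ tmk Y.dual X ▷ _ ≫ ε_ _ _)

lemma ihomEv_comp_evaluation (X Y : ModuleIn k A C) :
    Y.dual.obj ◁ ihomEv X Y ≫ ε_ Y.obj Y.dual.obj =
      (α_ _ _ _).inv ≫ tmk Y.dual X ▷ _ ≫ ε_ _ _ :=
  (pairEquiv _ Y.obj Y.dual.obj).apply_symm_apply _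

lemma exists_ihom (X Y : ModuleIn k A C) : ∃ act : A →ₐ[k] End (ᘁ((tens Y.dual X).obj) : C),
    IsInternalHom X Y ⟨_, act⟩ (ihomEv X Y) :=
  have h := IsInternalHom.existsUnique_of_isTensorProduct Y.dual_smul_evaluation
    (isTensorProduct_tmk Y.dual X) _ (ihomEv_comp_evaluation X Y)
  IsInternalHom.exists_of_obj _ h.1 h.2

/-- The internal hom of two modules. -/
def ihom (X Y : ModuleIn k A C) : ModuleIn k A C :=
  ⟨(ᘁ((tens Y.dual X).obj) : C), (exists_ihom X Y).choose⟩

/-- The evaluation of the internal hom. -/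
def ihomEval (X Y : ModuleIn k A C) : X.obj ⊗ (ihom X Y).obj ⟶ Y.obj := ihomEv X Y

lemma isInternalHom_ihomEval (X Y : ModuleIn k A C) :
    IsInternalHom X Y (ihom X Y) (ihomEval X Y) :=
  (exists_ihom X Y).choose_spec

/-- The functoriality of the internal hom. -/
def ihomMap (X : ModuleIn k A C) {Y Y' : ModuleIn k A C} (f : Y ⟶ Y') :
    (ihom X Y).obj ⟶ (ihom X Y').obj := ᘁ((tensMap (ModuleIn.dualMap f) (𝟙 X)).hom)

lemma ihomEv_naturality (X : ModuleIn k A C) {Y Y' : ModuleIn k A C} (f : Y ⟶ Y') :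
    X.obj ◁ (ᘁ((tensMap (ModuleIn.dualMap f) (𝟙 X)).hom)) ≫ ihomEv X Y' =
      ihomEv X Y ≫ f.hom := by
  refine (pairEquiv _ Y'.obj Y'.dual.obj).injective ?_
  have h : (ModuleIn.dualMap f).hom ▷ X.obj ≫ tmk Y.dual X =
      tmk Y'.dual X ≫ (tensMap (ModuleIn.dualMap f) (𝟙 X)).hom := by
    rw [tmk_tensMap, ModuleIn.id_hom, tensorHom_id]
  rw [pairEquiv_apply, pairEquiv_apply, MonoidalCategory.whiskerLeft_comp, Category.assoc,
    MonoidalCategory.whiskerLeft_comp, Category.assoc,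
    ← ModuleIn.dualMap_evaluation, whisker_exchange_assoc, ihomEv_comp_evaluation,
    ihomEv_comp_evaluation, associator_inv_naturality_left_assoc, ← comp_whiskerRight_assoc, h,
    comp_whiskerRight_assoc, associator_inv_naturality_right_assoc, whisker_exchange_assoc,
    leftAdjointMate_comp_evaluation]

lemma ihomEval_naturality (X : ModuleIn k A C) {Y Y' : ModuleIn k A C} (f : Y ⟶ Y') :
    X.obj ◁ ihomMap X f ≫ ihomEval X Y' = ihomEval X Y ≫ f.hom :=
  ihomEv_naturality X f

/-- The internal hom out of `X` is exact if `X` is flat. -/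
lemma ModuleIn.IsMonoFlat.rightExact_ihom [SymmetricCategory C] {X : ModuleIn k A C}
    (hX : X.IsMonoFlat) {Y' Y Y'' : ModuleIn k A C} {f : Y' ⟶ Y} {g : Y ⟶ Y''} (hf : Mono f.hom)
    (hfg : RightExact f.hom g.hom) :
    RightExact (ihomMap X f) (ihomMap X g) := by
  have := hfg.epi
  have hH := isInternalHom_ihomEval X
  refine .of_exists_lift ((hH Y'').hom_ext ?_) ?_ fun {T} x hx => ?_
  · rw [MonoidalCategory.whiskerLeft_comp, Category.assoc, ihomEval_naturality,
      reassoc_of% (ihomEval_naturality X f), hfg.zero, MonoidalPreadditive.whiskerLeft_zero, zero_comp,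
      comp_zero]
  -- Flatness of `X` enters only for surjectivity: the transpose of `g` is mono, remains mono after
  -- tensoring with `X` over `A`, and its left dual is then epi.
  · have := hX (dualMap g) (mono_dualMap g)
    exact epi_leftAdjointMate (tensMap (dualMap g) (𝟙 X)).hom
  -- Exactness in the middle is formal: the morphism `X ⊗ T ⟶ Y` named by `x` is killed by `g`,
  -- hence factors through `f`, and the factor is linear because `f` is mono.
  · have h₁ : (X.obj ◁ x ≫ ihomEval X Y) ≫ g.hom = 0 := by
      rw [Category.assoc, ← ihomEval_naturality, ← MonoidalCategory.whiskerLeft_comp_assoc, hx,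
        MonoidalPreadditive.whiskerLeft_zero, zero_comp]
    have h₂ := hfg.exact
    let φ := h₂.lift (X.obj ◁ x ≫ ihomEval X Y) h₁
    have hφ : φ ≫ f.hom = X.obj ◁ x ≫ ihomEval X Y := h₂.lift_f _ h₁
    obtain ⟨y, hy, -⟩ := (hH Y').existsUnique φ fun a => by
      rw [← cancel_mono f.hom, Category.assoc, hφ, Category.assoc, f.smul_hom, reassoc_of% hφ,
        ← whisker_exchange_assoc]
      exact congrArg _ ((hH Y).smul_left a)
    refine ⟨y, (hH Y).hom_ext ?_⟩
    rw [MonoidalCategory.whiskerLeft_comp, Category.assoc, ihomEval_naturality, reassoc_of% hy, hφ]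

end Ihom

end Prolong

namespace Prolong

/-! ### Duals of flat modules -/

section ModuleDual

variable {k : Type u} [Field k] {A : Type w} [CommRing A] [Algebra k A]
variable {C : Type u₁} [Category.{v₁} C] [Abelian C] [Linear k C] [MonoidalCategory C]
  [MonoidalPreadditive C] [MonoidalLinear k C]

namespace IsInternalHom

variable {X Y H H' : ModuleIn k A C} {e : X.obj ⊗ H.obj ⟶ Y.obj} {e' : X.obj ⊗ H'.obj ⟶ Y.obj}

lemma of_iso (h : IsInternalHom X Y H e) (m : H' ≅ H) (hm : X.obj ◁ m.hom.hom ≫ e = e') :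
    IsInternalHom X Y H' e' where
  smul_left a := by rw [← hm, ← whisker_exchange_assoc, h.smul_left, Category.assoc]
  smul_right a := by
    rw [← hm, ← whiskerLeft_comp_assoc, m.hom.smul_hom, whiskerLeft_comp_assoc, h.smul_right,
      Category.assoc]
  existsUnique φ hφ := by
    obtain ⟨g, hg, hu⟩ := h.existsUnique φ hφ
    refine ⟨g ≫ m.inv.hom, ?_, fun g' hg' => ?_⟩
    · dsimp only
      rw [← hm, ← whiskerLeft_comp_assoc, Category.assoc, ModuleIn.inv_hom_id_hom,
        Category.comp_id, hg]
    · rw [← hu (g' ≫ m.hom.hom) (by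
          dsimp only; rw [MonoidalCategory.whiskerLeft_comp, Category.assoc, hm, hg']),
        Category.assoc, ModuleIn.hom_inv_id_hom, Category.comp_id]

/-- Two internal homs are isomorphic. -/
lemma exists_iso (h : IsInternalHom X Y H e) (h' : IsInternalHom X Y H' e') :
    ∃ m : H ≅ H', X.obj ◁ m.hom.hom ≫ e' = e := by
  obtain ⟨f, hf, -⟩ := h'.existsUnique e h.smul_left
  obtain ⟨g, hg, -⟩ := h.existsUnique e' h'.smul_left
  have h₁ : f ≫ g = 𝟙 _ := h.hom_ext <| by
    rw [MonoidalCategory.whiskerLeft_comp, Category.assoc, hg, hf]; simp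
  have h₂ : g ≫ f = 𝟙 _ := h'.hom_ext <| by
    rw [MonoidalCategory.whiskerLeft_comp, Category.assoc, hf, hg]; simp
  refine ⟨ModuleIn.isoMk ⟨f, g, h₁, h₂⟩ fun a => h'.hom_ext ?_, hf⟩
  dsimp only
  rw [MonoidalCategory.whiskerLeft_comp, Category.assoc, hf, h.smul_right,
    MonoidalCategory.whiskerLeft_comp, Category.assoc, h'.smul_right, reassoc_of% hf]

variable [RigidCategory C]

/-- A left dual of `V` moves `V` to the source: morphisms `T ⟶ H ⊗ V` are morphisms `T ⊗ ᘁV ⟶ H`,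
and `key` says that this is compatible with evaluation. -/
lemma whiskerRight (h : IsInternalHom X Y H e) (V : C) :
    IsInternalHom X (Y.whiskerRight V) (H.whiskerRight V) ((α_ _ _ _).inv ≫ e ▷ V) where
  smul_left a := by
    rw [associator_inv_naturality_left_assoc, ← comp_whiskerRight, h.smul_left, comp_whiskerRight,
      Category.assoc]; rfl
  smul_right a := by
    change _ ◁ _ ▷ _ ≫ _ = _
    rw [associator_inv_naturality_middle_assoc, ← comp_whiskerRight, h.smul_right,
      comp_whiskerRight, Category.assoc]; rfl
  existsUnique {T} φ hφ := by
    let E (T Z : C) := tensorRightHomEquiv T (ᘁV : C) V Z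
    have key : ∀ g : T ⟶ H.obj ⊗ V, (E _ _).symm (X.obj ◁ g ≫ (α_ _ _ _).inv ≫ e ▷ V) =
        (α_ _ _ _).hom ≫ X.obj ◁ (E _ _).symm g ≫ e := fun g => by
      simp only [E, tensorRightHomEquiv, Equiv.coe_fn_symm_mk, comp_whiskerRight, Category.assoc]
      rw [associator_naturality_left_assoc, ← whisker_exchange_assoc, rightUnitor_naturality]
      simp only [← Category.assoc]
      congr 1
      monoidal
    refine existsUnique_congr_equiv (E T H.obj).symm (fun g => ?_)
      (h.existsUnique ((α_ _ _ _).inv ≫ (E _ _).symm φ) fun a => ?_)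
    · rw [← (E _ _).symm.injective.eq_iff, key, Iso.eq_inv_comp]
    · rw [associator_inv_naturality_left_assoc, Category.assoc]
      congr 1
      rw [← tensorRightHomEquiv_symm_naturality, hφ, Equiv.symm_apply_eq,
        tensorRightHomEquiv_naturality, Equiv.apply_symm_apply]
      rfl

end IsInternalHom

variable [RigidCategory C] [Module.Finite k A]

lemma unitAct_naturality {X Y : ModuleIn k A C} (f : X ⟶ Y) :
    (constMod k A C A).obj ◁ f.hom ≫ unitAct Y = unitAct X ≫ f.hom :=
  (isConst_constι k A C A).hom_ext_whiskerRight fun m => by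
    rw [← whisker_exchange_assoc, ι_unitAct, ι_unitAct_assoc, f.smul_hom,
      leftUnitor_naturality_assoc]

lemma unitAct_whiskerRight (X : ModuleIn k A C) (V : C) :
    unitAct (X.whiskerRight V) = (α_ _ _ _).inv ≫ unitAct X ▷ V :=
  (isConst_constι k A C A).hom_ext_whiskerRight fun m => by
    rw [ι_unitAct, associator_inv_naturality_left_assoc, ← comp_whiskerRight, ι_unitAct]
    simp

lemma whiskerLeft_constι_unitAct (m : A) : (constMod k A C A).obj ◁ constι k A C A m ≫
    unitAct (constMod k A C A) = (ρ_ _).hom ≫ (constMod k A C A).smul m :=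
  (isConst_constι k A C A).hom_ext_whiskerRight fun m' => by
    rw [← whisker_exchange_assoc, ι_unitAct, leftUnitor_naturality_assoc,
      ← (isConst_constι k A C A).smul, rightUnitor_naturality_assoc,
      ← (isConst_constι k A C A).smul, unitors_equal, smul_eq_mul, smul_eq_mul, mul_comm]

/-- The canonical morphism `X ⊗ (D ⊗_A Y) ⟶ Y`, for a morphism `e : X ⊗ D ⟶ A`. -/
lemma exists_tensEv {X D : ModuleIn k A C} {e : X.obj ⊗ D.obj ⟶ (constMod k A C A).obj}
    (he : ∀ a, X.obj ◁ D.smul a ≫ e = e ≫ (constMod k A C A).smul a) (Y : ModuleIn k A C) :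
    ∃ t : X.obj ⊗ (tens D Y).obj ⟶ Y.obj,
      X.obj ◁ tmk D Y ≫ t = (α_ _ _ _).inv ≫ e ▷ Y.obj ≫ unitAct Y :=
  ((isTensorProduct_tmk D Y).existsUnique_whiskerLeft X.obj _ fun a => by
    rw [associator_inv_naturality_middle_assoc, associator_inv_naturality_right_assoc,
      ← comp_whiskerRight_assoc, he, comp_whiskerRight_assoc, whisker_exchange_assoc,
      (isTensorProduct_unitAct Y).condition]).exists

namespace IsInternalHom

variable {X D : ModuleIn k A C} {e : X.obj ⊗ D.obj ⟶ (constMod k A C A).obj}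
  (h : IsInternalHom X (constMod k A C A) D e)

/-- The canonical morphism `X ⊗ (D ⊗_A Y) ⟶ Y`. -/
def tensEv (Y : ModuleIn k A C) : X.obj ⊗ (tens D Y).obj ⟶ Y.obj :=
  (exists_tensEv h.smul_right Y).choose

lemma whiskerLeft_tmk_tensEv (Y : ModuleIn k A C) :
    X.obj ◁ tmk D Y ≫ h.tensEv Y = (α_ _ _ _).inv ≫ e ▷ Y.obj ≫ unitAct Y :=
  (exists_tensEv h.smul_right Y).choose_spec

lemma tensEv_smul_left (Y : ModuleIn k A C) (a : A) :
    X.smul a ▷ (tens D Y).obj ≫ h.tensEv Y = h.tensEv Y ≫ Y.smul a := by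
  rw [← cancel_epi (X.obj ◁ tmk D Y), whisker_exchange_assoc, h.whiskerLeft_tmk_tensEv,
    associator_inv_naturality_left_assoc, ← comp_whiskerRight_assoc, h.smul_left,
    reassoc_of% h.whiskerLeft_tmk_tensEv, comp_whiskerRight_assoc,
    (isTensorProduct_unitAct Y).smul_left]

lemma tensEv_naturality {Y Y' : ModuleIn k A C} (f : Y ⟶ Y') :
    X.obj ◁ (tensMap (𝟙 D) f).hom ≫ h.tensEv Y' = h.tensEv Y ≫ f.hom := by
  rw [← cancel_epi (X.obj ◁ tmk D Y), ← whiskerLeft_comp_assoc, tmk_tensMap, ModuleIn.id_hom,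
    id_tensorHom, whiskerLeft_comp_assoc, h.whiskerLeft_tmk_tensEv,
    associator_inv_naturality_right_assoc, whisker_exchange_assoc, unitAct_naturality,
    reassoc_of% h.whiskerLeft_tmk_tensEv]

/-- For a free module both sides are `D ⊗ V`: the tensor product by the unit law, the internal hom
because `V` can be taken out. The computation `key` checks that the two evaluations agree. -/
lemma isInternalHom_free [SymmetricCategory C] (V : C) :
    IsInternalHom X ((constMod k A C A).whiskerRight V)
      (tens D ((constMod k A C A).whiskerRight V)) (h.tensEv _) := by
  let t : D.obj ⊗ (constMod k A C A).obj ⟶ D.obj := (β_ _ _).hom ≫ unitAct D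
  have ht : IsTensorProduct D (constMod k A C A) D t := (isTensorProduct_unitAct D).symm
  refine (h.whiskerRight V).of_iso ((isTensorProduct_tmk _ _).iso (ht.whiskerRight V))
    ((cancel_epi (X.obj ◁ tmk D _)).1 ?_)
  rw [IsTensorProduct.iso_hom, ← whiskerLeft_comp_assoc, IsTensorProduct.lift_fac,
    h.whiskerLeft_tmk_tensEv, unitAct_whiskerRight]
  have key : X.obj ◁ t ≫ e = (α_ _ _ _).inv ≫ e ▷ _ ≫ unitAct (constMod k A C A) := by
    rw [← cancel_epi (α_ _ _ _).hom, Iso.hom_inv_id_assoc]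
    refine (isConst_constι k A C A).hom_ext_whiskerLeft fun m => ?_
    have : D.obj ◁ constι k A C A m ≫ t = (ρ_ _).hom ≫ D.smul m := by
      rw [BraidedCategory.braiding_naturality_right_assoc, ι_unitAct, braiding_leftUnitor_assoc]
    rw [associator_naturality_right_assoc, ← MonoidalCategory.whiskerLeft_comp_assoc, this,
      MonoidalCategory.whiskerLeft_comp_assoc, h.smul_right, whisker_exchange_assoc,
      whiskerLeft_constι_unitAct, rightUnitor_naturality_assoc]
    simp
  rw [MonoidalCategory.whiskerLeft_comp_assoc, associator_inv_naturality_middle_assoc,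
    ← comp_whiskerRight, key]
  simp only [comp_whiskerRight, pentagon_inv_assoc]
  rw [associator_inv_naturality_left_assoc]

/-- The comparison of `D ⊗_A Y` with the internal hom from `X` to `Y`. -/
lemma exists_comparison (Y : ModuleIn k A C) :
    ∃ c : (tens D Y).obj ⟶ (ihom X Y).obj, X.obj ◁ c ≫ ihomEval X Y = h.tensEv Y :=
  ((isInternalHom_ihomEval X Y).existsUnique _ (h.tensEv_smul_left Y)).exists

variable [SymmetricCategory C]

/-- If `X` is flat then `D ⊗_A Y`, where `D` is the dual of `X`, is the internal hom from `X` to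
`Y`. -/
lemma isInternalHom_tensEv (hX : X.IsMonoFlat) (Y : ModuleIn k A C) :
    IsInternalHom X Y (tens D Y) (h.tensEv Y) := by
  choose c hc using h.exists_comparison
  have nat {Y Y' : ModuleIn k A C} (f : Y ⟶ Y') :
      (tensMap (𝟙 D) f).hom ≫ c Y' = c Y ≫ ihomMap X f :=
    (isInternalHom_ihomEval X Y').hom_ext <| by
      rw [MonoidalCategory.whiskerLeft_comp, Category.assoc, hc, h.tensEv_naturality,
        MonoidalCategory.whiskerLeft_comp, Category.assoc, ihomEval_naturality, reassoc_of% hc]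
  have free (V : C) : IsIso (c ((constMod k A C A).whiskerRight V)) := by
    obtain ⟨m, hm⟩ := (h.isInternalHom_free V).exists_iso (isInternalHom_ihomEval X _)
    have : c ((constMod k A C A).whiskerRight V) = m.hom.hom :=
      (isInternalHom_ihomEval X _).hom_ext ((hc _).trans hm.symm)
    rw [this]; infer_instance
  have exact (Y : ModuleIn k A C) : RightExact (ihomMap X (ModuleIn.kerι (freeπ Y)))
      (ihomMap X (freeπ Y)) :=
    hX.rightExact_ihom inferInstance (ModuleIn.rightExact_kerι _)
  -- By naturality `c Y` precomposed with a morphism is `c` at the free cover, an isomorphism,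
  -- followed by an epimorphism. This holds for every `Y`, in particular for the kernel of a free
  -- cover.
  have epi (Y : ModuleIn k A C) : Epi (c Y) := by
    have := (exact Y).epi
    have : Epi ((tensMap (𝟙 D) (freeπ Y)).hom ≫ c Y) := by
      rw [nat]; infer_instance
    exact epi_of_epi (tensMap (𝟙 D) (freeπ Y)).hom _
  -- In the presentation of `Y` by its free cover, `c` is epi at the kernel and an isomorphism at
  -- the cover.
  have iso : IsIso (c Y) := isIso_of_epi_of_isIso
    ((ModuleIn.rightExact_kerι (freeπ Y)).tensMap D) (exact Y) (epi _) (free _) (nat _) (nat _)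
  refine (isInternalHom_ihomEval X Y).of_iso (ModuleIn.isoMk (asIso (c Y)) fun a => ?_) (hc Y)
  refine (isInternalHom_ihomEval X Y).hom_ext ?_
  have := h.tensEv_naturality (ModuleIn.smulHom Y a)
  have hs : (tensMap (𝟙 D) (ModuleIn.smulHom Y a)).hom = (tens D Y).smul a := tens_hom_ext <| by
    rw [tmk_tensMap, ← tmk_smul_right]; simp
  rw [hs] at this
  rw [asIso_hom, MonoidalCategory.whiskerLeft_comp, Category.assoc, hc, this,
    MonoidalCategory.whiskerLeft_comp, Category.assoc, (isInternalHom_ihomEval X Y).smul_right,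
    reassoc_of% hc]
  rfl

include h in
/-- The dual of a flat module is flat. -/
lemma isMonoFlat (hX : X.IsMonoFlat) : D.IsMonoFlat := fun {W W'} f hf => by
  -- Tensoring with `D` is now an internal hom, and internal homs preserve monomorphisms.
  have : Mono (tensMap (𝟙 D) f).hom := ⟨fun s t hst =>
    (h.isInternalHom_tensEv hX W).hom_ext <| by
      rw [← cancel_mono f.hom, Category.assoc, Category.assoc, ← h.tensEv_naturality,
        ← MonoidalCategory.whiskerLeft_comp_assoc, hst,
        MonoidalCategory.whiskerLeft_comp_assoc]⟩
  have := congrArg ModuleIn.Hom.hom (tensBraid_naturality f (𝟙 D))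
  have : Mono ((tensMap f (𝟙 D)).hom ≫ (tensBraid W' D).hom.hom) := by
    rw [← ModuleIn.comp_hom, tensBraid_naturality, ModuleIn.comp_hom]; infer_instance
  exact mono_of_mono _ (tensBraid W' D).hom.hom

end IsInternalHom

end ModuleDual

end Prolong

namespace Prolong

/-! ### Base change -/

section BaseChange

variable {k : Type u} [Field k] {A B : Type w} [CommRing A] [Algebra k A] [CommRing B] [Algebra k B]
variable {C : Type u₁} [Category.{v₁} C]

section

variable [Preadditive C] [Linear k C]

/-- The map `b ↦ b • m` from `B` to the morphisms into a `B`-module. -/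
@[simps]
def ModuleIn.extMap (X : ModuleIn k B C) {T : C} (m : T ⟶ X.obj) : B →+ (T ⟶ X.obj) where
  toFun b := m ≫ X.smul b
  map_zero' := by rw [ModuleIn.smul_zero, comp_zero]
  map_add' a b := by rw [ModuleIn.smul_add, Preadditive.comp_add]

variable [Algebra A B]

section

variable (A) [IsScalarTower k A B]

/-- The restriction of scalars. -/
abbrev ModuleIn.restrict (X : ModuleIn k B C) : ModuleIn k A C :=
  ⟨X.obj, X.act.comp (IsScalarTower.toAlgHom k A B)⟩

lemma ModuleIn.restrict_smul (X : ModuleIn k B C) (a : A) :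
    (X.restrict A).smul a = X.smul (algebraMap A B a) := rfl

end

variable {X : ModuleIn k A C} {X' : ModuleIn k B C} {m : X.obj ⟶ X'.obj}

namespace IsTensor

lemma smul_comp (h : IsTensor X (X'.extMap m)) (a : A) :
    X.smul a ≫ m = m ≫ X'.smul (algebraMap A B a) := by
  have := h.balanced a 1
  simpa [Algebra.smul_def, ModuleIn.smul_one] using this.symm

lemma hom_ext_extMap (h : IsTensor X (X'.extMap m)) {T : C} {f g : X'.obj ⟶ T}
    (hfg : ∀ b, m ≫ X'.smul b ≫ f = m ≫ X'.smul b ≫ g) : f = g :=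
  (h.existsUnique T
    { toFun := fun b => m ≫ X'.smul b ≫ g
      map_zero' := by rw [ModuleIn.smul_zero, zero_comp, comp_zero]
      map_add' := fun a b => by rw [ModuleIn.smul_add, Preadditive.add_comp, Preadditive.comp_add] }
    fun a b => by
      change m ≫ X'.smul (a • b) ≫ g = X.smul a ≫ m ≫ X'.smul b ≫ g
      rw [← Category.assoc (X.smul a), h.smul_comp, Algebra.smul_def, ModuleIn.smul_mul]
      simp).unique (fun b => by simpa using hfg b) fun b => by simp

/-- Semilinear morphisms extend uniquely along a base change. -/
lemma existsUnique_linear (h : IsTensor X (X'.extMap m)) (S : ModuleIn k B C) (φ : X.obj ⟶ S.obj)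
    (hφ : ∀ a, X.smul a ≫ φ = φ ≫ S.smul (algebraMap A B a)) :
    ∃! ψ : X'.obj ⟶ S.obj, m ≫ ψ = φ ∧ ∀ b, X'.smul b ≫ ψ = ψ ≫ S.smul b := by
  obtain ⟨ψ, hψ, hu⟩ := h.existsUnique S.obj (S.extMap φ) fun a b => by
    rw [ModuleIn.extMap_apply, ModuleIn.extMap_apply, ← Category.assoc, hφ, Category.assoc,
      ← ModuleIn.smul_mul, Algebra.smul_def]
  simp only [ModuleIn.extMap_apply, Category.assoc] at hψ hu
  refine ⟨ψ, ⟨by simpa [ModuleIn.smul_one] using hψ 1, fun b => h.hom_ext_extMap fun b' => ?_⟩,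
    fun ψ' hψ' => hu _ fun b => ?_⟩
  · rw [reassoc_of% hψ, ← ModuleIn.smul_mul, ← Category.assoc (X'.smul b'), ← ModuleIn.smul_mul,
      hψ]
  · rw [hψ'.2, reassoc_of% hψ'.1]

end IsTensor

end

variable [Algebra A B]

namespace IsTensor

variable [Preadditive C] [Linear k C] [MonoidalCategory C] [MonoidalPreadditive C]
  [MonoidalLinear k C] [RigidCategory C] {X : ModuleIn k A C} {X' : ModuleIn k B C}
  {m : X.obj ⟶ X'.obj}

lemma extMap_whiskerRight (h : IsTensor X (X'.extMap m)) (V : C) :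
    IsTensor (X.whiskerRight V) ((X'.whiskerRight V).extMap (m ▷ V)) :=
  h.whiskerRight V _ fun _ => (MonoidalCategory.comp_whiskerRight _ _ _).symm

lemma extMap_whiskerLeft (h : IsTensor X (X'.extMap m)) (V : C) :
    IsTensor (X.whiskerLeft V) ((X'.whiskerLeft V).extMap (V ◁ m)) :=
  h.whiskerLeft V _ fun _ => (MonoidalCategory.whiskerLeft_comp _ _ _).symm

variable [IsScalarTower k A B]

/-- Internal homs into modules over an extension `B` of `A`. -/
lemma isInternalHom_restrict (h : IsTensor X (X'.extMap m)) {S H : ModuleIn k B C}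
    {e : X'.obj ⊗ H.obj ⟶ S.obj} (he : IsInternalHom X' S H e) :
    IsInternalHom X (S.restrict A) (H.restrict A) (m ▷ H.obj ≫ e) where
  smul_left a := by
    rw [ModuleIn.restrict_smul, Category.assoc, ← he.smul_left, ← comp_whiskerRight_assoc,
      h.smul_comp, comp_whiskerRight_assoc]
  smul_right a := by
    rw [ModuleIn.restrict_smul, ModuleIn.restrict_smul, Category.assoc, ← he.smul_right,
      whisker_exchange_assoc]
  existsUnique {T} φ hφ := by
    -- An `A`-linear morphism from `X ⊗ T` to a `B`-module extends uniquely to a `B`-linear one from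
    -- the base change `X' ⊗ T`.
    obtain ⟨ψ, ⟨hψ, hl⟩, hu⟩ := (h.extMap_whiskerRight T).existsUnique_linear S φ hφ
    obtain ⟨t, ht, htu⟩ := he.existsUnique ψ hl
    refine ⟨t, ?_, fun t' ht' => htu t' (hu _ ⟨?_, fun b => ?_⟩)⟩
    · change X.obj ◁ t ≫ m ▷ H.obj ≫ e = φ
      rw [whisker_exchange_assoc]
      exact (congrArg _ ht).trans hψ
    · rw [← ht']
      exact (whisker_exchange_assoc _ _ _).symm
    · change X'.smul b ▷ T ≫ X'.obj ◁ t' ≫ e = _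
      rw [← whisker_exchange_assoc, he.smul_left, Category.assoc]

end IsTensor

variable [Abelian C] [Linear k C] [MonoidalCategory C] [MonoidalPreadditive C]
  [MonoidalLinear k C] [RigidCategory C] [Module.Finite k A] [Module.Finite k B]

/-- A balanced map out of `A ⊗_k 𝟙` is determined by its values at `1 ∈ A`, which form a `k`-linear
map out of `B`. -/
lemma isTensor_extMap_const [IsScalarTower k A B]
    (u : (constMod k A C A).obj ⟶ (constMod k B C B).obj)
    (hu : ∀ a, constι k A C A a ≫ u = constι k B C B (algebraMap A B a)) :
    IsTensor (constMod k A C A) ((constMod k B C B).extMap u) where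
  balanced a b := (isConst_constι k A C A).hom_ext fun x => by
    rw [← Category.assoc (constι k A C A x), ← (isConst_constι k A C A).smul]
    simp only [ModuleIn.extMap_apply]
    rw [reassoc_of% hu, reassoc_of% hu, ← (isConst_constι k B C B).smul,
      ← (isConst_constι k B C B).smul]
    simp [Algebra.smul_def, mul_comm, mul_left_comm]
  existsUnique T γ hγ := by
    have hu' (b : B) (x : A) : constι k A C A x ≫ u ≫ (constMod k B C B).smul b =
        constι k B C B (x • b) := by
      rw [reassoc_of% hu, ← (isConst_constι k B C B).smul, Algebra.smul_def x,
        smul_eq_mul, mul_comm]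
    obtain ⟨g, hg, hgu⟩ := (isConst_constι k B C B).existsUnique T
      { toFun := fun b => constι k A C A 1 ≫ γ b
        map_add' := fun x y => by rw [map_add, Preadditive.comp_add]
        map_smul' := fun r x => by
          rw [← algebraMap_smul A r x, hγ, Algebra.algebraMap_eq_smul_one, ModuleIn.smul_smul,
            ModuleIn.smul_one]
          simp }
    refine ⟨g, fun b => (isConst_constι k A C A).hom_ext fun x => ?_, fun g' hg' => hgu _ fun b => ?_⟩
    · rw [ModuleIn.extMap_apply, Category.assoc, reassoc_of% hu' b x, hg]
      change _ ≫ γ (x • b) = _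
      rw [hγ, ← Category.assoc, ← (isConst_constι k A C A).smul]
      simp
    · change _ = _ ≫ γ b
      rw [← hg' b, ModuleIn.extMap_apply, Category.assoc, reassoc_of% hu' b 1, one_smul]

/-- The base change of a tensor product. -/
lemma IsTensor.extMap_tens {X Y Z : ModuleIn k A C} {X' Y' Z' : ModuleIn k B C}
    {m : X.obj ⟶ X'.obj} {n : Y.obj ⟶ Y'.obj} {l : Z.obj ⟶ Z'.obj}
    (hm : IsTensor X (X'.extMap m)) (hn : IsTensor Y (Y'.extMap n))
    {μ : X.obj ⊗ Y.obj ⟶ Z.obj} {μ' : X'.obj ⊗ Y'.obj ⟶ Z'.obj} (hμ : IsTensorProduct X Y Z μ)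
    (hμ' : IsTensorProduct X' Y' Z' μ') (hl : μ ≫ l = (m ⊗ₘ n) ≫ μ') :
    IsTensor Z (Z'.extMap l) where
  balanced a b := hμ.hom_ext <| by
    rw [ModuleIn.extMap_apply, ModuleIn.extMap_apply, reassoc_of% hl, ← hμ.smul_left_assoc,
      reassoc_of% hl, ← hμ'.smul_left, ← hμ'.smul_left, ← tensorHom_id, ← tensorHom_id,
      ← tensorHom_id, tensorHom_comp_tensorHom_assoc, tensorHom_comp_tensorHom_assoc,
      tensorHom_comp_tensorHom_assoc, hm.smul_comp, Algebra.smul_def, ModuleIn.smul_mul]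
    simp
  existsUnique T γ hγ := by
    -- The extension is made one variable at a time, from `X ⊗ Y` to `X' ⊗ Y` and then to `X' ⊗ Y'`.
    obtain ⟨g, hg, -⟩ := (hm.extMap_whiskerRight Y.obj).existsUnique T
      { toFun := fun b => μ ≫ γ b
        map_zero' := by simp
        map_add' := fun x y => by simp } fun a b => by
          change μ ≫ γ (a • b) = X.smul a ▷ Y.obj ≫ μ ≫ γ b
          rw [hγ, hμ.smul_left_assoc]
    change (X'.obj ⊗ Y.obj) ⟶ T at g
    replace hg (b : B) : m ▷ Y.obj ≫ X'.smul b ▷ Y.obj ≫ g = μ ≫ γ b :=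
      (Category.assoc _ _ _).symm.trans (hg b)
    have hga (a : A) : X'.obj ◁ Y.smul a ≫ g = X'.smul (algebraMap A B a) ▷ Y.obj ≫ g :=
      (hm.extMap_whiskerRight Y.obj).hom_ext_extMap fun b => by
        change m ▷ Y.obj ≫ X'.smul b ▷ Y.obj ≫ _ = m ▷ Y.obj ≫ X'.smul b ▷ Y.obj ≫ _
        rw [← whisker_exchange_assoc, ← whisker_exchange_assoc, hg, ← comp_whiskerRight_assoc
          (X'.smul b), ← ModuleIn.smul_mul, hg, mul_comm, ← Algebra.smul_def, hγ,
          ← reassoc_of% hμ.smul_right]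
    obtain ⟨g', hg', -⟩ := (hn.extMap_whiskerLeft X'.obj).existsUnique T
      { toFun := fun b => X'.smul b ▷ Y.obj ≫ g
        map_zero' := by rw [ModuleIn.smul_zero, MonoidalPreadditive.zero_whiskerRight, zero_comp]
        map_add' := fun x y => by
          rw [ModuleIn.smul_add, MonoidalPreadditive.add_whiskerRight, Preadditive.add_comp] }
      fun a b => by
        change X'.smul (a • b) ▷ Y.obj ≫ g = X'.obj ◁ Y.smul a ≫ X'.smul b ▷ Y.obj ≫ g
        rw [whisker_exchange_assoc, hga, Algebra.smul_def, mul_comm, ModuleIn.smul_mul,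
          comp_whiskerRight_assoc]
    change (X'.obj ⊗ Y'.obj) ⟶ T at g'
    replace hg' (b : B) : X'.obj ◁ n ≫ X'.obj ◁ Y'.smul b ≫ g' = X'.smul b ▷ Y.obj ≫ g :=
      (Category.assoc _ _ _).symm.trans (hg' b)
    have hg'₁ : X'.obj ◁ n ≫ g' = g := by simpa [ModuleIn.smul_one] using hg' 1
    -- It is enough to compare on the image of `X' ⊗ Y` under multiplication by `B` in the second
    -- variable, where `g'` is the extension of `g`.
    have hbal (b : B) : X'.smul b ▷ Y'.obj ≫ g' = X'.obj ◁ Y'.smul b ≫ g' :=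
      (hn.extMap_whiskerLeft X'.obj).hom_ext_extMap fun b' => by
        change X'.obj ◁ n ≫ X'.obj ◁ Y'.smul b' ≫ _ = X'.obj ◁ n ≫ X'.obj ◁ Y'.smul b' ≫ _
        rw [whisker_exchange_assoc, whisker_exchange_assoc, hg', ← whiskerLeft_comp_assoc
          X'.obj (Y'.smul b'), ← ModuleIn.smul_mul, hg', mul_comm, ModuleIn.smul_mul,
          comp_whiskerRight_assoc]
    have key (f : Z'.obj ⟶ T) (b : B) : μ ≫ l ≫ Z'.smul b ≫ f =
        m ▷ Y.obj ≫ X'.smul b ▷ Y.obj ≫ X'.obj ◁ n ≫ μ' ≫ f := by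
      rw [reassoc_of% hl, ← hμ'.smul_left_assoc, MonoidalCategory.tensorHom_def, Category.assoc,
        whisker_exchange_assoc]
    refine ⟨hμ'.desc g' hbal, fun b => hμ.hom_ext ?_, fun f hf => hμ'.hom_ext ?_⟩
    · rw [ModuleIn.extMap_apply, Category.assoc, key, hμ'.fac, hg'₁, hg]
    · rw [hμ'.fac]
      refine (hn.extMap_whiskerLeft X'.obj).hom_ext_extMap fun b' => ?_
      change X'.obj ◁ n ≫ X'.obj ◁ Y'.smul b' ≫ _ = X'.obj ◁ n ≫ X'.obj ◁ Y'.smul b' ≫ _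
      rw [reassoc_of% hμ'.smul_right, ← hμ'.smul_left_assoc, hg', whisker_exchange_assoc]
      congr 1
      refine (hm.extMap_whiskerRight Y.obj).hom_ext_extMap fun b => ?_
      change m ▷ Y.obj ≫ X'.smul b ▷ Y.obj ≫ _ = m ▷ Y.obj ≫ X'.smul b ▷ Y.obj ≫ _
      rw [hg, ← key, ← hf, ModuleIn.extMap_apply, Category.assoc]

lemma IsTensorProduct.of_iso {X Y Z Z' : ModuleIn k A C} {μ : X.obj ⊗ Y.obj ⟶ Z.obj}
    (h : IsTensorProduct X Y Z μ) (c : Z ≅ Z') : IsTensorProduct X Y Z' (μ ≫ c.hom.hom) where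
  smul_left a := by rw [h.smul_left_assoc, c.hom.smul_hom, Category.assoc]
  smul_right a := by
    rw [reassoc_of% h.smul_right, c.hom.smul_hom, Category.assoc]
  existsUnique T g hg := by
    obtain ⟨t, ht, hu⟩ := h.existsUnique T g hg
    refine ⟨c.inv.hom ≫ t, by simpa using ht, fun t' ht' => ?_⟩
    rw [← hu (c.hom.hom ≫ t') (by simpa using ht'), ModuleIn.inv_hom_id_hom_assoc]

variable [SymmetricCategory C] [IsScalarTower k A B]

/-- The dual of a base change is a base change. -/
lemma IsTensor.extMap_dual {X D : ModuleIn k A C} {X' D' : ModuleIn k B C}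
    {m : X.obj ⟶ X'.obj} {d : D.obj ⟶ D'.obj} (hX : X.IsMonoFlat) (hm : IsTensor X (X'.extMap m))
    {e : X.obj ⊗ D.obj ⟶ (constMod k A C A).obj} {e' : X'.obj ⊗ D'.obj ⟶ (constMod k B C B).obj}
    (he : IsInternalHom X _ D e) (he' : IsInternalHom X' _ D' e')
    {u : (constMod k A C A).obj ⟶ (constMod k B C B).obj}
    (hu : ∀ a, constι k A C A a ≫ u = constι k B C B (algebraMap A B a))
    (hd : (m ⊗ₘ d) ≫ e' = e ≫ u) :
    IsTensor D (D'.extMap d) := by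
  -- The unit over `B`, seen over `A`. Since `X` is flat, `D ⊗_A S` is the internal hom from `X` to
  -- `S` over `A`, hence that from `X'` to the unit over `B`, which is `D'`.
  let S := (constMod k B C B).restrict A
  have hS : IsConst S (constι k B C B) :=
    ⟨fun a b => by
      rw [Algebra.smul_def, ← smul_eq_mul, (isConst_constι k B C B).smul]; rfl,
      (isConst_constι k B C B).existsUnique⟩
  obtain ⟨c, hc⟩ := (he.isInternalHom_tensEv hX S).exists_iso (hm.isInternalHom_restrict he')
  have hT : IsTensorProduct D S (D'.restrict A) (tmk D S ≫ c.hom.hom) :=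
    (isTensorProduct_tmk D S).of_iso c
  -- It remains to see that the abstract isomorphism induces the given `d`. After evaluation on `X`
  -- both sides become `e ≫ u` followed by multiplication by `b`.
  refine hS.isTensor hT.symm _ fun b => (hm.isInternalHom_restrict he').hom_ext ?_
  have hι (a : A) : constι k A C A a ▷ (constMod k B C B).obj ≫ unitAct S =
      (λ_ _).hom ≫ (constMod k B C B).smul (algebraMap A B a) := ι_unitAct S a
  have hu' (a : A) : constι k A C A a ≫ (ρ_ _).inv ≫ (constMod k A C A).obj ◁ constι k B C B b ≫
      unitAct S = constι k A C A a ≫ u ≫ (constMod k B C B).smul b := by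
    rw [rightUnitor_inv_naturality_assoc, ← whisker_exchange_assoc, hι,
      leftUnitor_naturality_assoc, reassoc_of% hu, ← (isConst_constι k B C B).smul, ← (isConst_constι k B C B).smul, smul_eq_mul, smul_eq_mul, mul_comm]
    simp [unitors_equal]
  have h₁ : X.obj ◁ D'.extMap d b ≫ m ▷ D'.obj ≫ e' = e ≫ u ≫ (constMod k B C B).smul b := by
    rw [whisker_exchange_assoc, ModuleIn.extMap_apply, MonoidalCategory.whiskerLeft_comp,
      Category.assoc, he'.smul_right, ← reassoc_of% hd, MonoidalCategory.tensorHom_def,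
      Category.assoc]
  have h₂ : X.obj ◁ ((λ_ D.obj).inv ≫ constι k B C B b ▷ D.obj ≫ (β_ _ _).hom ≫ tmk D S ≫
      c.hom.hom) ≫ m ▷ D'.obj ≫ e' = e ≫ u ≫ (constMod k B C B).smul b := by
    have : (λ_ D.obj).inv ≫ constι k B C B b ▷ D.obj ≫ (β_ _ _).hom = (ρ_ _).inv ≫
        D.obj ◁ constι k B C B b := by
      rw [BraidedCategory.braiding_naturality_left, leftUnitor_inv_braiding_assoc]
    rw [reassoc_of% this, MonoidalCategory.whiskerLeft_comp, MonoidalCategory.whiskerLeft_comp,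
      MonoidalCategory.whiskerLeft_comp, Category.assoc, Category.assoc, Category.assoc, hc,
      he.whiskerLeft_tmk_tensEv, associator_inv_naturality_right_assoc, whisker_exchange_assoc,
      ← (isConst_constι k A C A).hom_ext hu']
    simp
  exact h₁.trans h₂.symm

end BaseChange

end Prolong

namespace Prolong

/-! ### Duals of Cartesian systems -/

section ExactPairing

variable {C : Type*} [Category* C] [MonoidalCategory C]

/-- An exact pairing, from one of the two triangle identities and the nondegeneracy of the
evaluation. -/
abbrev exactPairingOfCancel (D X : C) (η : 𝟙_ C ⟶ D ⊗ X) (ε : X ⊗ D ⟶ 𝟙_ C)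
    (h : X ◁ η ≫ (α_ X D X).inv ≫ ε ▷ X ≫ (λ_ X).hom = (ρ_ X).hom)
    (hε : ∀ s t : D ⟶ D, X ◁ s ≫ ε = X ◁ t ≫ ε → s = t) : ExactPairing D X where
  coevaluation' := η
  evaluation' := ε
  coevaluation_evaluation' := by rw [← h]; simp
  evaluation_coevaluation' := by
    -- The other triangle composite is an endomorphism of `D`. Paired with `X` it gives `ε` again,
    -- by the known identity, so it is the identity by nondegeneracy.
    have key : (λ_ D).inv ≫ η ▷ D ≫ (α_ D X D).hom ≫ D ◁ ε ≫ (ρ_ D).hom = 𝟙 D := by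
      refine hε _ _ ?_
      have h₁ : X ◁ D ◁ ε ≫ X ◁ (ρ_ D).hom ≫ ε = (α_ _ _ _).inv ≫ ε ▷ (X ⊗ D) ≫
          (λ_ _).hom ≫ ε := by
        rw [← leftUnitor_naturality, ← whisker_exchange_assoc, unitors_equal,
          rightUnitor_naturality]
        simp
      have h₂ : X ◁ η ▷ D ≫ X ◁ (α_ D X D).hom ≫ (α_ _ _ _).inv ≫ ε ▷ (X ⊗ D) ≫ (λ_ _).hom =
          (α_ _ _ _).inv ≫ (X ◁ η ≫ (α_ X D X).inv ≫ ε ▷ X ≫ (λ_ X).hom) ▷ D := by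
        simp
      simp only [MonoidalCategory.whiskerLeft_comp, Category.assoc]
      rw [h₁, reassoc_of% h₂, h]
      simp
    rw [← cancel_epi (λ_ D).inv, ← cancel_mono (ρ_ D).hom]
    simpa using key

end ExactPairing

/-! ### The dual of a Cartesian system and its pairing -/

section Systems

variable {k : Type u} [Field k] {J : Type u₂} [Category.{v₂} J] {E : J ⥤ CommAlgCat.{w} k}
  {C : Type u₁} [Category.{v₁} C]

namespace ModuleSystem

/-- The algebra structure given by a transition morphism. -/
abbrev algebra {i j : J} (f : i ⟶ j) : Algebra (E.obj i) (E.obj j) :=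
  (E.map f).hom.toRingHom.toAlgebra

lemma isScalarTower {i j : J} (f : i ⟶ j) :
    letI := algebra (E := E) f
    IsScalarTower k (E.obj i) (E.obj j) :=
  letI := algebra (E := E) f
  .of_algebraMap_eq fun r => ((E.map f).hom.commutes r).symm

section

variable [Preadditive C] [Linear k C]

lemma isCartesian_iff {X : ModuleSystem E C} : X.IsCartesian ↔ ∀ {i j : J} (f : i ⟶ j),
    letI := algebra (E := E) f
    IsTensor (X.module i) ((X.module j).extMap (X.map f)) :=
  Iff.rfl

end

variable [Abelian C] [Linear k C] [MonoidalCategory C] [MonoidalPreadditive C]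
  [MonoidalLinear k C] [RigidCategory C]

namespace IsCartesian

variable {X : ModuleSystem E C} (hX : X.IsCartesian) {i j : J} (f : i ⟶ j)
  {S H : ModuleIn k (E.obj j) C} {e : (X.module j).obj ⊗ H.obj ⟶ S.obj}
  (he : IsInternalHom (X.module j) S H e)

include hX he

/-- Since `X_j` is a base change of `X_i`, the module `H` is also an internal hom out of `X_i`, so
morphisms into it are tested along `X.map f`. With `exists_lift` this constructs semilinear
morphisms into duals. -/
lemma hom_ext {T : C} {s t : T ⟶ H.obj}
    (hst : (X.map f ⊗ₘ s) ≫ e = (X.map f ⊗ₘ t) ≫ e) : s = t := by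
  let := algebra (E := E) f
  have := isScalarTower (E := E) f
  refine ((isCartesian_iff.1 hX f).isInternalHom_restrict he).hom_ext ?_
  simpa [MonoidalCategory.tensorHom_def'] using hst

lemma exists_lift {T : C} (φ : (X.module i).obj ⊗ T ⟶ S.obj)
    (hφ : ∀ a, (X.module i).smul a ▷ T ≫ φ = φ ≫ S.smul ((E.map f).hom a)) :
    ∃ t : T ⟶ H.obj, (X.map f ⊗ₘ t) ≫ e = φ := by
  let := algebra (E := E) f
  have := isScalarTower (E := E) f
  obtain ⟨t, ht, -⟩ := ((isCartesian_iff.1 hX f).isInternalHom_restrict he).existsUnique φ hφ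
  exact ⟨t, by simpa [MonoidalCategory.tensorHom_def'] using ht⟩

end IsCartesian

variable [∀ j, Module.Finite k (E.obj j)]

/-- The members of the dual of a system. -/
abbrev dualModule (X : ModuleSystem E C) (j : J) : ModuleIn k (E.obj j) C :=
  ihom (X.module j) ((unit E C).module j)

/-- The evaluation of the dual of a system. -/
abbrev dualEval (X : ModuleSystem E C) (j : J) :
    (X.module j).obj ⊗ (X.dualModule j).obj ⟶ ((unit E C).module j).obj :=
  ihomEval (X.module j) ((unit E C).module j)

lemma isInternalHom_dualEval (X : ModuleSystem E C) (j : J) :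
    IsInternalHom (X.module j) ((unit E C).module j) (X.dualModule j) (X.dualEval j) :=
  isInternalHom_ihomEval _ _

lemma IsCartesian.exists_dualMap {X : ModuleSystem E C} (hX : X.IsCartesian) {i j : J}
    (f : i ⟶ j) : ∃ d : (X.dualModule i).obj ⟶ (X.dualModule j).obj,
      (X.map f ⊗ₘ d) ≫ X.dualEval j = X.dualEval i ≫ (unit E C).map f :=
  hX.exists_lift f (X.isInternalHom_dualEval j) _ fun a => by
    rw [← Category.assoc, (X.isInternalHom_dualEval i).smul_left, Category.assoc, Category.assoc,
      (unit E C).smul_map]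

/-- The transition morphisms of the dual of a system. -/
def dualMap (X : ModuleSystem E C) (hX : X.IsCartesian) {i j : J} (f : i ⟶ j) :
    (X.dualModule i).obj ⟶ (X.dualModule j).obj :=
  (hX.exists_dualMap f).choose

lemma dualMap_dualEval (X : ModuleSystem E C) (hX : X.IsCartesian) {i j : J} (f : i ⟶ j) :
    (X.map f ⊗ₘ X.dualMap hX f) ≫ X.dualEval j = X.dualEval i ≫ (unit E C).map f :=
  (hX.exists_dualMap f).choose_spec

lemma dualMap_dualEval_assoc (X : ModuleSystem E C) (hX : X.IsCartesian) {i j : J} (f : i ⟶ j)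
    {T : C} (t : ((unit E C).module j).obj ⟶ T) :
    (X.map f ⊗ₘ X.dualMap hX f) ≫ X.dualEval j ≫ t = X.dualEval i ≫ (unit E C).map f ≫ t := by
  rw [← Category.assoc, dualMap_dualEval, Category.assoc]

/-- The dual of a system. -/
abbrev dualSystem (X : ModuleSystem E C) (hX : X.IsCartesian) : ModuleSystem E C where
  module := X.dualModule
  map := X.dualMap hX
  map_id j := hX.hom_ext (𝟙 j) (X.isInternalHom_dualEval j) <| by
    rw [dualMap_dualEval, (unit E C).map_id, X.map_id]; simp
  map_comp {i j l} f g := hX.hom_ext (f ≫ g) (X.isInternalHom_dualEval l) <| by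
    rw [dualMap_dualEval, X.map_comp, ← tensorHom_comp_tensorHom, Category.assoc,
      dualMap_dualEval, dualMap_dualEval_assoc, (unit E C).map_comp]
  smul_map {i j} f a := hX.hom_ext f (X.isInternalHom_dualEval j) <| by
    have h₁ : (X.map f ⊗ₘ (X.dualModule i).smul a ≫ X.dualMap hX f) =
        (X.module i).obj ◁ (X.dualModule i).smul a ≫ (X.map f ⊗ₘ X.dualMap hX f) := by
      rw [← id_tensorHom, tensorHom_comp_tensorHom, Category.id_comp]
    have h₂ : (X.map f ⊗ₘ X.dualMap hX f ≫ (X.dualModule j).smul ((E.map f).hom a)) =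
        (X.map f ⊗ₘ X.dualMap hX f) ≫ (X.module j).obj ◁ (X.dualModule j).smul ((E.map f).hom a) := by
      rw [← id_tensorHom, tensorHom_comp_tensorHom, Category.comp_id]
    rw [h₁, h₂, Category.assoc, Category.assoc, dualMap_dualEval,
      (X.isInternalHom_dualEval j).smul_right, dualMap_dualEval_assoc, ← (unit E C).smul_map,
      reassoc_of% (X.isInternalHom_dualEval i).smul_right]

variable [SymmetricCategory C]

lemma isCartesian_dualSystem {X : ModuleSystem E C} (hX : X.IsCartesian)
    (hX' : ∀ j, (X.module j).IsMonoFlat) : (X.dualSystem hX).IsCartesian :=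
  isCartesian_iff.2 fun {i j} f => by
    let := algebra (E := E) f
    have := isScalarTower (E := E) f
    exact (isCartesian_iff.1 hX f).extMap_dual (hX' i) (X.isInternalHom_dualEval i)
      (X.isInternalHom_dualEval j) (ι_unitTransition f) (X.dualMap_dualEval hX f)

lemma isCartesian_unit : (unit E C).IsCartesian :=
  isCartesian_iff.2 fun {i j} f => by
    let := algebra (E := E) f
    have := isScalarTower (E := E) f
    exact isTensor_extMap_const _ (ι_unitTransition f)

lemma IsCartesian.tensor {X Y : ModuleSystem E C} (hX : X.IsCartesian) (hY : Y.IsCartesian) :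
    (tensorSystem X Y).IsCartesian :=
  isCartesian_iff.2 fun {i j} f => by
    let := algebra (E := E) f
    exact (isCartesian_iff.1 hX f).extMap_tens (isCartesian_iff.1 hY f) (isTensorProduct_tmk _ _)
      (isTensorProduct_tmk _ _) (tmk_tensorMap X Y f)

section Pairing

variable (X : ModuleSystem E C) (hX : X.IsCartesian)

/-- The evaluation pairing of a system with its dual. -/
def evaluation : X ⊗ X.dualSystem hX ⟶ 𝟙_ (ModuleSystem E C) where
  app j := ((isTensorProduct_tmk _ _).lift (X.dualEval j) (X.isInternalHom_dualEval j).smul_left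
    (X.isInternalHom_dualEval j).smul_right).hom
  smul_app j := ((isTensorProduct_tmk _ _).lift (X.dualEval j)
    (X.isInternalHom_dualEval j).smul_left (X.isInternalHom_dualEval j).smul_right).smul_hom
  naturality {i j} f := tens_hom_ext <| by
    refine (tmk_tensorMap_assoc X (X.dualSystem hX) f _).trans ?_
    rw [IsTensorProduct.lift_fac, IsTensorProduct.lift_fac_assoc]
    exact X.dualMap_dualEval hX f

lemma μ_evaluation (j : J) :
    (laxInduced E C).μ j X (X.dualSystem hX) ≫ (X.evaluation hX).app j = X.dualEval j :=
  (isTensorProduct_tmk (X.module j) (X.dualModule j)).lift_fac _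
    (X.isInternalHom_dualEval j).smul_left (X.isInternalHom_dualEval j).smul_right

/-- The evaluation of `D ⊗ Y` at `X`, where `D` is the dual of `X`. -/
abbrev tensEval (Y : ModuleSystem E C) (j : J) :
    (X.module j).obj ⊗ (tens (X.dualModule j) (Y.module j)).obj ⟶ (Y.module j).obj :=
  (X.isInternalHom_dualEval j).tensEv (Y.module j)

/-- Identifies the evaluation built from modules with the composite occurring in the triangle
identity, so that the defining equation of the coevaluation becomes that identity. -/
lemma tensEval_eq (Y : ModuleSystem E C) (j : J) :
    X.tensEval Y j = (laxInduced E C).μ j X (X.dualSystem hX ⊗ Y) ≫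
      (eval j).map ((α_ X (X.dualSystem hX) Y).inv ≫ X.evaluation hX ▷ Y ≫ (λ_ Y).hom) := by
  have h := (laxInduced E C).associator_assoc j X (X.dualSystem hX) Y
    ((eval j).map ((α_ X (X.dualSystem hX) Y).inv ≫ X.evaluation hX ▷ Y ≫ (λ_ Y).hom))
  rw [← Functor.map_comp, Iso.hom_inv_id_assoc, Functor.map_comp,
    (laxInduced E C).whiskerRight_assoc] at h
  have h' := (X.isInternalHom_dualEval j).whiskerLeft_tmk_tensEv (Y.module j)
  refine (cancel_epi ((X.module j).obj ◁ tmk (X.dualModule j) (Y.module j))).1 ?_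
  rw [h', Iso.inv_comp_eq]
  refine Eq.trans ?_ h
  rw [← comp_whiskerRight_assoc]
  exact congr_arg₂ _ (congrArg (· ▷ _) (X.μ_evaluation hX j).symm)
    (tmk_tensUnit_hom (Y.module j)).symm

lemma tensorMap_tensEval (Y : ModuleSystem E C) {i j : J} (f : i ⟶ j) :
    (X.map f ⊗ₘ (X.dualSystem hX).tensorMap Y f) ≫ X.tensEval Y j = X.tensEval Y i ≫ Y.map f := by
  refine (cancel_epi ((X.module i).obj ◁ tmk (X.dualModule i) (Y.module i))).1 ?_
  have h₁ : (X.module i).obj ◁ tmk (X.dualModule i) (Y.module i) ≫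
      (X.map f ⊗ₘ (X.dualSystem hX).tensorMap Y f) =
      (X.map f ⊗ₘ X.dualMap hX f ⊗ₘ Y.map f) ≫
        (X.module j).obj ◁ tmk (X.dualModule j) (Y.module j) := by
    rw [← id_tensorHom, ← id_tensorHom, tensorHom_comp_tensorHom, tensorHom_comp_tensorHom,
      tmk_tensorMap (X.dualSystem hX) Y f, Category.id_comp, Category.comp_id]
  have h₂ : ((X.map f ⊗ₘ X.dualMap hX f) ⊗ₘ Y.map f) ≫ X.dualEval j ▷ (Y.module j).obj =
      X.dualEval i ▷ (Y.module i).obj ≫ (unitTransition f ⊗ₘ Y.map f) := by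
    rw [← tensorHom_id, ← tensorHom_id, tensorHom_comp_tensorHom, tensorHom_comp_tensorHom,
      dualMap_dualEval, Category.id_comp, Category.comp_id]
  rw [reassoc_of% h₁, (X.isInternalHom_dualEval j).whiskerLeft_tmk_tensEv,
    reassoc_of% (X.isInternalHom_dualEval i).whiskerLeft_tmk_tensEv,
    associator_inv_naturality_assoc, reassoc_of% h₂, unit_map_unitAct]

variable (hX' : ∀ j, (X.module j).IsMonoFlat)

include hX' in
-- By flatness `D ⊗ X` is the internal hom from `X` to itself. The coevaluation is the morphism that
-- names the action `X ⊗ E_j ⟶ X`; it sends `1` to the identity of `X`.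
lemma exists_coevaluation (j : J) :
    ∃ η : constMod k (E.obj j) C (E.obj j) ⟶ tens (X.dualModule j) (X.module j),
      (X.module j).obj ◁ η.hom ≫ X.tensEval X j = (β_ _ _).hom ≫ unitAct (X.module j) := by
  have h := (X.isInternalHom_dualEval j).isInternalHom_tensEv (hX' j) (X.module j)
  have h' := (isTensorProduct_unitAct (X.module j)).symm
  obtain ⟨η, hη, -⟩ := h.existsUnique _ h'.smul_left
  refine ⟨⟨η, fun a => h.hom_ext ?_⟩, hη⟩
  rw [MonoidalCategory.whiskerLeft_comp, MonoidalCategory.whiskerLeft_comp, Category.assoc,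
    Category.assoc, h.smul_right, hη, reassoc_of% hη, h'.smul_right, Category.assoc]

/-- The coevaluation of a system and its dual. -/
def coevaluation : 𝟙_ (ModuleSystem E C) ⟶ X.dualSystem hX ⊗ X where
  app j := (X.exists_coevaluation hX' j).choose.hom
  smul_app j := (X.exists_coevaluation hX' j).choose.smul_hom
  naturality {i j} f := by
    refine hX.hom_ext f ((X.isInternalHom_dualEval j).isInternalHom_tensEv (hX' j) (X.module j)) ?_
    have h₁ := (X.exists_coevaluation hX' i).choose_spec
    have h₂ := (X.exists_coevaluation hX' j).choose_spec
    generalize (X.exists_coevaluation hX' i).choose = η₁ at h₁ ⊢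
    generalize (X.exists_coevaluation hX' j).choose = η₂ at h₂ ⊢
    have e₁ : (X.map f ⊗ₘ unitTransition f ≫ η₂.hom) = (X.map f ⊗ₘ unitTransition f) ≫
        (X.module j).obj ◁ η₂.hom := by
      rw [← id_tensorHom, tensorHom_comp_tensorHom, Category.comp_id]
    have e₂ : (X.map f ⊗ₘ η₁.hom ≫ (X.dualSystem hX).tensorMap X f) =
        (X.module i).obj ◁ η₁.hom ≫ (X.map f ⊗ₘ (X.dualSystem hX).tensorMap X f) := by
      rw [← id_tensorHom, tensorHom_comp_tensorHom, Category.id_comp]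
    refine (congrArg (· ≫ _) e₁).trans (Eq.trans ?_ (congrArg (· ≫ _) e₂).symm)
    rw [Category.assoc, Category.assoc, h₂, tensorMap_tensEval, reassoc_of% h₁,
      BraidedCategory.braiding_naturality_assoc, unit_map_unitAct]

/-- A Cartesian system of flat modules is dual to its dual. -/
abbrev exactPairing : ExactPairing (X.dualSystem hX) X :=
  exactPairingOfCancel _ _ (X.coevaluation hX hX') (X.evaluation hX)
    -- This triangle identity is the equation that defines the coevaluation; the nondegeneracy
    -- required next is uniqueness in the universal property of the internal hom.
    ((laxInduced E C).hom_ext fun j => by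
      rw [Functor.map_comp, (laxInduced E C).whiskerLeft_assoc, ← tensEval_eq]
      refine (X.exists_coevaluation hX' j).choose_spec.trans ?_
      exact (tmk_tensUnit_right (X.module j)).symm)
    fun s t hst => ModuleSystem.hom_ext fun j => (X.isInternalHom_dualEval j).hom_ext <| by
      have := (laxInduced E C).μ j X (X.dualSystem hX) ≫= congrArg (eval j).map hst
      rw [Functor.map_comp, Functor.map_comp, (laxInduced E C).whiskerLeft_assoc,
        (laxInduced E C).whiskerLeft_assoc] at this
      have h := X.μ_evaluation hX j
      refine (congrArg _ h).symm.trans (this.trans (congrArg _ h))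

end Pairing

end ModuleSystem

end Systems

end Prolong

namespace Prolong

/-! ### Direct sums -/

section Sums

variable {k : Type u} [Field k] {A B : Type w} [CommRing A] [Algebra k A] [CommRing B] [Algebra k B]
variable {C : Type u₁} [Category.{v₁} C] {ι : Type*} [Fintype ι]

/-- Only the decompositions of the identities are used, not the orthogonality of projections and
inclusions. A single summand therefore also gives transport along isomorphisms. -/
lemma IsTensor.extMap_sum [Preadditive C] [Linear k C] [Algebra A B] {X : ModuleIn k A C}
    {X' : ModuleIn k B C} {m : X.obj ⟶ X'.obj} {Y : ι → ModuleIn k A C} {Y' : ι → ModuleIn k B C}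
    {n : ∀ a, (Y a).obj ⟶ (Y' a).obj} (hn : ∀ a, IsTensor (Y a) ((Y' a).extMap (n a)))
    (p : ∀ a, X ⟶ Y a) (i : ∀ a, Y a ⟶ X) (p' : ∀ a, X' ⟶ Y' a) (i' : ∀ a, Y' a ⟶ X')
    (hp : ∀ a, m ≫ (p' a).hom = (p a).hom ≫ n a) (hi : ∀ a, n a ≫ (i' a).hom = (i a).hom ≫ m)
    (h : ∑ a, (p a).hom ≫ (i a).hom = 𝟙 X.obj) (h' : ∑ a, (p' a).hom ≫ (i' a).hom = 𝟙 X'.obj) :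
    IsTensor X (X'.extMap m) where
  balanced a b := by
    rw [ModuleIn.extMap_apply, ← Category.comp_id (X'.smul (a • b)), ModuleIn.extMap_apply,
      ← Category.comp_id (X'.smul b), ← h']
    simp only [Preadditive.comp_sum]
    refine Finset.sum_congr rfl fun c _ => ?_
    rw [(p' c).smul_hom_assoc, reassoc_of% hp, (p' c).smul_hom_assoc, reassoc_of% hp,
      (p c).smul_hom_assoc]
    congr 1
    simpa using (hn c).balanced a b =≫ (i' c).hom
  existsUnique T γ hγ := by
    choose g hg hu using fun c => (hn c).existsUnique T
      { toFun := fun b => (i c).hom ≫ γ b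
        map_zero' := by rw [map_zero, comp_zero]
        map_add' := fun x y => by rw [map_add, Preadditive.comp_add] } fun a b => by
          change (i c).hom ≫ γ (a • b) = (Y c).smul a ≫ (i c).hom ≫ γ b
          rw [hγ, (i c).smul_hom_assoc]
    refine ⟨∑ c, (p' c).hom ≫ g c, fun b => ?_, fun g' hg' => ?_⟩
    · rw [← Category.id_comp (γ b), ← h, ModuleIn.extMap_apply, Category.assoc,
        Preadditive.comp_sum, Preadditive.comp_sum, Preadditive.sum_comp]
      refine Finset.sum_congr rfl fun c _ => ?_
      rw [(p' c).smul_hom_assoc, reassoc_of% hp, Category.assoc]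
      congr 1
      simpa using hg c b
    · rw [← Category.id_comp g', ← h', Preadditive.sum_comp]
      refine Finset.sum_congr rfl fun c _ => ?_
      rw [Category.assoc]
      congr 1
      refine hu c _ fun b => ?_
      change _ = _ ≫ γ b
      rw [← hg' b, ModuleIn.extMap_apply, ModuleIn.extMap_apply, Category.assoc, Category.assoc,
        (i' c).smul_hom_assoc, reassoc_of% hi]

/-- A morphism killed by `f ⊗ X` has all its components killed by the monomorphisms `f ⊗ Y a`, and
it is the sum of what these components contribute. -/
lemma ModuleIn.IsMonoFlat.sum [Abelian C] [Linear k C] [MonoidalCategory C]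
    [MonoidalPreadditive C] [MonoidalLinear k C] [Module.Finite k A] {X : ModuleIn k A C}
    {Y : ι → ModuleIn k A C} (hY : ∀ a, (Y a).IsMonoFlat) (p : ∀ a, X ⟶ Y a) (i : ∀ a, Y a ⟶ X)
    (h : ∑ a, (p a).hom ≫ (i a).hom = 𝟙 X.obj) : X.IsMonoFlat := fun {W W'} f hf => by
  have hs : ∑ a, (tensMap (𝟙 W) (p a ≫ i a)).hom = 𝟙 _ := tens_hom_ext <| by
    rw [Preadditive.comp_sum, Category.comp_id]
    simp only [tmk_tensMap, ModuleIn.id_hom, id_tensorHom, ModuleIn.comp_hom]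
    rw [← Preadditive.sum_comp, ← whiskerLeft_sum, h]
    simp
  refine Preadditive.mono_of_cancel_zero _ fun s hs' => ?_
  rw [← Category.comp_id s, ← hs, Preadditive.comp_sum]
  refine Finset.sum_eq_zero fun a _ => ?_
  have : s ≫ (tensMap (𝟙 W) (p a)).hom = 0 := by
    have := hY a f hf
    rw [← cancel_mono (tensMap f (𝟙 (Y a))).hom, zero_comp, Category.assoc, ← ModuleIn.comp_hom,
      tensMap_comp, Category.id_comp, Category.comp_id, ← Category.comp_id f,
      ← Category.id_comp (p a), ← tensMap_comp, ModuleIn.comp_hom, reassoc_of% hs', zero_comp]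
  rw [← Category.comp_id (𝟙 W), ← tensMap_comp, ModuleIn.comp_hom, reassoc_of% this, zero_comp]

end Sums

/-! ### Direct sums of systems -/

section Systems

variable {k : Type u} [Field k] {J : Type u₂} [Category.{v₂} J] {E : J ⥤ CommAlgCat.{w} k}
  {C : Type u₁} [Category.{v₁} C] [Abelian C] [Linear k C]

namespace ModuleSystem

instance (j : J) : (eval (E := E) (C := C) j).Additive where
  map_add := rfl

variable {n : ℕ} (F : Fin n → ModuleSystem E C)

/-- The direct sum of finitely many systems. -/
abbrev sum : ModuleSystem E C :=
  haveI : HasFiniteBiproducts C := Abelian.hasFiniteBiproducts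
  { module := fun j => .ofSmul (⨁ fun a => ((F a).module j).obj)
      (fun e => biproduct.map fun a => ((F a).module j).smul e)
      (fun a b => by ext; simp [ModuleIn.smul_add])
      (fun r a => by ext; simp [ModuleIn.smul_smul])
      (by ext; simp [ModuleIn.smul_one])
      (fun a b => by ext; simp [ModuleIn.smul_mul])
    map := fun f => biproduct.map fun a => (F a).map f
    map_id := fun j => by ext; simp [ModuleSystem.map_id]
    map_comp := fun f g => by ext; simp [ModuleSystem.map_comp]
    smul_map := fun f e => by
      change biproduct.map (fun a => ((F a).module _).smul e) ≫
        biproduct.map (fun a => (F a).map f) = biproduct.map (fun a => (F a).map f) ≫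
          biproduct.map fun a => ((F a).module _).smul ((E.map f).hom e)
      ext; simp [ModuleSystem.smul_map] }

/-- The direct sum, as a bicone. -/
abbrev sumBicone : Bicone F :=
  haveI : HasFiniteBiproducts C := Abelian.hasFiniteBiproducts
  { pt := sum F
    π := fun a =>
      ⟨fun j => biproduct.π (fun a => ((F a).module j).obj) a,
        fun j e => biproduct.map_π (fun a => ((F a).module j).smul e) a,
        fun f => biproduct.map_π (fun a => (F a).map f) a⟩
    ι := fun a =>
      ⟨fun j => biproduct.ι (fun a => ((F a).module j).obj) a,
        fun j e => (biproduct.ι_map (fun a => ((F a).module j).smul e) a).symm,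
        fun f => (biproduct.ι_map (fun a => (F a).map f) a).symm⟩
    ι_π := fun a b => ModuleSystem.hom_ext fun j => by
      refine (biproduct.ι_π (fun a => ((F a).module j).obj) a b).trans ?_
      split_ifs with h
      · subst h; rfl
      · rfl }

lemma sumBicone_total : ∑ a, (sumBicone F).π a ≫ (sumBicone F).ι a = 𝟙 _ :=
  ModuleSystem.hom_ext fun j => by
    have : HasFiniteBiproducts C := Abelian.hasFiniteBiproducts
    refine ((eval j).map_sum _ _).trans ?_
    exact biproduct.total (f := fun a => ((F a).module j).obj)

variable {F}

lemma IsCartesian.sum (h : ∀ a, (F a).IsCartesian) : (sum F).IsCartesian :=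
  isCartesian_iff.2 fun {i j} f => by
    let := algebra (E := E) f
    have total (j : J) := congrArg (eval j).map (sumBicone_total F)
    refine IsTensor.extMap_sum (fun a => isCartesian_iff.1 (h a) f)
      (fun a => appHom ((sumBicone F).π a) i) (fun a => appHom ((sumBicone F).ι a) i)
      (fun a => appHom ((sumBicone F).π a) j) (fun a => appHom ((sumBicone F).ι a) j)
      (fun a => naturality ((sumBicone F).π a) f) (fun a => naturality ((sumBicone F).ι a) f) ?_ ?_
    · exact ((eval i).map_sum _ _).symm.trans (total i)
    · exact ((eval j).map_sum _ _).symm.trans (total j)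

end ModuleSystem

end Systems

/-! ### The category of flat modules -/

section Flat

variable {k : Type u} [Field k] {J : Type u₂} [Category.{v₂} J] (E : J ⥤ CommAlgCat.{w} k)
  [∀ j, IsQuasiSeparable k (E.obj j)] (C : Type u₁) [Category.{v₁} C] [Abelian C] [Linear k C]
  [MonoidalCategory C] [SymmetricCategory C] [MonoidalPreadditive C] [MonoidalLinear k C]
  [RigidCategory C]

open ModuleSystem

variable {E C} in
-- Here quasi-separability is used. Flatness with respect to all modules in `C` is the version
-- visibly stable under tensor products, sums and duals.
lemma isFlatSystem_iff {X : ModuleSystem E C} :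
    isFlatSystem E C X ↔ (∀ j, (X.module j).IsMonoFlat) ∧ X.IsCartesian :=
  and_congr_left fun _ => forall_congr' fun _ => ⟨fun h => h.isMonoFlat, fun h => h.isFlat⟩

instance : (isFlatSystem E C).IsMonoidal where
  prop_unit := isFlatSystem_iff.2 ⟨fun _ => ModuleIn.IsMonoFlat.constMod, isCartesian_unit⟩
  prop_tensor _ _ hX hY :=
    have hX := isFlatSystem_iff.1 hX
    have hY := isFlatSystem_iff.1 hY
    isFlatSystem_iff.2 ⟨fun j => ModuleIn.IsMonoFlat.tens (hX.1 j) (hY.1 j), IsCartesian.tensor hX.2 hY.2⟩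

namespace FlatCat

instance hasFiniteBiproducts : HasFiniteBiproducts (FlatCat E C) where
  out n :=
    { has_biproduct := fun F => by
        let G (a : Fin n) := (F a).obj
        have hG (a : Fin n) := isFlatSystem_iff.1 (F a).property
        have hS : isFlatSystem E C (sum G) := isFlatSystem_iff.2
          ⟨fun j => ModuleIn.IsMonoFlat.sum (fun a => (hG a).1 j) (fun a => appHom ((sumBicone G).π a) j)
            (fun a => appHom ((sumBicone G).ι a) j)
            (((ModuleSystem.eval j).map_sum _ _).symm.trans
              (congrArg (ModuleSystem.eval j).map (sumBicone_total G))),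
            IsCartesian.sum fun a => (hG a).2⟩
        let b : Bicone F :=
          { pt := ⟨sum G, hS⟩
            π := fun a => ObjectProperty.homMk ((sumBicone G).π a)
            ι := fun a => ObjectProperty.homMk ((sumBicone G).ι a)
            ι_π := fun a b => ObjectProperty.hom_ext _ <| by
              refine ((sumBicone G).ι_π a b).trans ?_
              split_ifs with h
              · subst h; rfl
              · rfl }
        refine .mk ⟨b, isBilimitOfTotal b (ObjectProperty.hom_ext _ ?_)⟩
        refine ((isFlatSystem E C).ι.map_sum _ _).trans ?_
        exact sumBicone_total G }

instance (j : J) : (FlatCat.eval E C j).LaxBraided :=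
  inferInstanceAs ((isFlatSystem E C).ι ⋙ ModuleSystem.eval j).LaxBraided

open Functor.LaxMonoidal

lemma μ_eval (j : J) (X Y : FlatCat E C) :
    μ (FlatCat.eval E C j) X Y = tmk (X.obj.module j) (Y.obj.module j) :=
  (Category.comp_id _)

lemma ε_eval (j : J) :
    ε (FlatCat.eval E C j) = constι k (E.obj j) C (E.obj j) 1 :=
  (Category.comp_id _)

lemma isLevelwiseTensor : FlatCat.IsLevelwiseTensor E C where
  isTensorProduct j X Y := by
    rw [μ_eval]; exact isTensorProduct_tmk _ _
  isTensorUnit j := by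
    rw [ε_eval]
    refine (congrArg (IsTensor _) (AddMonoidHom.ext fun a => ?_)).mp
      (isConst_constι k (E.obj j) C (E.obj j)).trivial_isTensor
    refine Eq.trans ?_ ((isConst_constι k (E.obj j) C (E.obj j)).smul a 1)
    simp; rfl
  map_tensor f X Y := by
    rw [μ_eval, μ_eval]; exact tmk_tensorMap _ _ _
  map_unit f := by
    rw [ε_eval, ε_eval]
    exact (ι_unitTransition f 1).trans (by rw [map_one])

/-- A flat module is dual to its dual. -/
instance leftRigidCategory : LeftRigidCategory (FlatCat E C) where
  leftDual X :=
    have hX := isFlatSystem_iff.1 X.property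
    let D : FlatCat E C := ⟨X.obj.dualSystem hX.2, isFlatSystem_iff.2
      ⟨fun j => (X.obj.isInternalHom_dualEval j).isMonoFlat (hX.1 j),
        isCartesian_dualSystem hX.2 hX.1⟩⟩
    -- The pairing exists among all systems and restricts to the full subcategory, because both
    -- members lie in it.
    letI : ExactPairing ((isFlatSystem E C).ι.obj D) ((isFlatSystem E C).ι.obj X) :=
      X.obj.exactPairing hX.2 hX.1
    { leftDual := D
      exact := .ofFullyFaithful (isFlatSystem E C).ι D X }

/-- The category of flat modules is rigid. -/
instance rigidCategory : RigidCategory (FlatCat E C) :=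
  BraidedCategory.rigidCategoryOfLeftRigidCategory

end FlatCat

end Flat

end Prolong

namespace Prolong

/-! ### Duality is an equivalence -/

section LeftMates

variable {C : Type u₁} [Category.{v₁} C] [MonoidalCategory C] [RigidCategory C]

lemma leftMate_add [Preadditive C] [MonoidalPreadditive C] {X Y : C} (f g : X ⟶ Y) :
    (ᘁ(f + g)) = (ᘁf : (ᘁY : C) ⟶ ᘁX) + ᘁg := by
  simp [leftAdjointMate, MonoidalPreadditive.add_whiskerRight, MonoidalPreadditive.whiskerLeft_add]

lemma leftMate_smul {k : Type u} [Field k] [Preadditive C] [MonoidalPreadditive C] [Linear k C]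
    [MonoidalLinear k C] {X Y : C} (r : k) (f : X ⟶ Y) :
    (ᘁ(r • f)) = r • (ᘁf : (ᘁY : C) ⟶ ᘁX) := by
  simp [leftAdjointMate]

/-- The second member of an exact pairing is isomorphic to the right dual of the first. -/
def pairingIso (X W : C) [ExactPairing X W] [HasRightDual X] : W ≅ (Xᘁ : C) :=
  rightDualIso (inferInstanceAs (ExactPairing X W)) HasRightDual.exact

lemma pairingIso_evaluation (X W : C) [ExactPairing X W] [HasRightDual X] :
    (pairingIso X W).hom ▷ X ≫ ε_ X Xᘁ = ε_ X W :=
  (@rightAdjointMate_comp_evaluation C _ _ X X _ ⟨W⟩ (𝟙 _)).trans (by simp)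

lemma pairingIso_naturality {X W X' W' : C} [ExactPairing X W] {_ : HasRightDual X}
    [ExactPairing X' W'] {_ : HasRightDual X'} (f : W ⟶ W') (g : X' ⟶ X)
    (h : f ▷ X' ≫ ε_ X' W' = W ◁ g ≫ ε_ X W) :
    f ≫ (pairingIso X' W').hom = (pairingIso X W).hom ≫ gᘁ :=
  pairing_injective_right (Y := X') <| by
    rw [comp_whiskerRight_assoc, comp_whiskerRight_assoc, pairingIso_evaluation,
      rightAdjointMate_comp_evaluation, ← whisker_exchange_assoc, pairingIso_evaluation, h]

end LeftMates

/-! ### Duality is fully faithful and essentially surjective -/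

section Equivalence

variable {k : Type u} [Field k] {C : Type u₁} [Category.{v₁} C] [Abelian C] [Linear k C]
  [MonoidalCategory C] [MonoidalPreadditive C] [MonoidalLinear k C] [RigidCategory C]

/-- A converse of `IsHom.dual`: transposition is bijective on morphisms, so the universal property
of the dual tested on targets of the form `Yᘁ` is the one wanted. -/
lemma isHom_of_isTensor_dual {E : Type w} [CommRing E] [Algebra k E] {M : Type*} [AddCommGroup M]
    [Module E M] {X : ModuleIn k E C} {T : C} {β : M →+ (T ⟶ X.obj)} {δ : M →+ (X.dual.obj ⟶ Tᘁ)}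
    (hδ : ∀ m, δ m = (β m)ᘁ) (h : IsTensor X.dual δ) : IsHom X β where
  cobalanced e m := (mateEquiv T X.obj).injective <| by
    change (β (e • m))ᘁ = (β m ≫ X.smul e)ᘁ
    rw [← hδ, h.balanced, hδ, comp_rightAdjointMate]
    rfl
  existsUnique Y γ hγ := by
    refine existsUnique_congr_equiv (mateEquiv Y T).toEquiv (fun g => forall_congr' fun m => ?_)
      (h.existsUnique (Yᘁ : C) ((mateEquiv Y X.obj).toAddMonoidHom.comp γ) fun e m => ?_)
    · rw [← (mateEquiv Y X.obj).injective.eq_iff, hδ]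
      change (g ≫ β m)ᘁ = _ ↔ _
      rw [comp_rightAdjointMate]
      rfl
    · change (γ (e • m))ᘁ = (X.smul e)ᘁ ≫ (γ m)ᘁ
      rw [hγ, comp_rightAdjointMate]

variable {J : Type u₂} [Category.{v₂} J] {E : J ⥤ CommAlgCat.{w} k}

/-- The left dual of a system, formed member by member. -/
abbrev ModuleSystem.leftDual (W : ModuleSystem E C) : DualModuleSystem E C where
  module j := .ofSmul (ᘁ((W.module j).obj) : C) (fun e => ᘁ((W.module j).smul e))
    (fun a b => by rw [ModuleIn.smul_add, leftMate_add])
    (fun r a => by rw [ModuleIn.smul_smul, leftMate_smul])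
    ((congrArg leftAdjointMate (W.module j).smul_one).trans leftAdjointMate_id)
    (fun a b => by rw [mul_comm, ModuleIn.smul_mul, comp_leftAdjointMate])
  map f := ᘁ(W.map f)
  map_id j := (congrArg leftAdjointMate (W.map_id j)).trans leftAdjointMate_id
  map_comp f g := by rw [W.map_comp, comp_leftAdjointMate]
  map_smul f e := comp_leftAdjointMate.symm.trans
    ((congrArg leftAdjointMate (W.smul_map f e)).trans comp_leftAdjointMate)

/-- A system is isomorphic to the dual of its left dual. -/
def ModuleSystem.leftDualDualIso (W : ModuleSystem E C) : W ≅ W.leftDual.dual :=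
  isoMk (fun j => ModuleIn.isoMk (@pairingIso C _ _ (ᘁ((W.module j).obj) : C) (W.module j).obj _
      (RightRigidCategory.rightDual _))
      fun _ => pairingIso_naturality _ _ (leftAdjointMate_comp_evaluation _).symm)
    fun _ => pairingIso_naturality _ _ (leftAdjointMate_comp_evaluation _).symm

lemma ModuleSystem.IsCartesian.of_iso {X Y : ModuleSystem E C} (hX : X.IsCartesian) (c : X ≅ Y) :
    Y.IsCartesian :=
  isCartesian_iff.2 fun {i j} f => by
    let := algebra (E := E) f
    refine IsTensor.extMap_sum (ι := Unit) (fun _ => isCartesian_iff.1 hX f)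
      (fun _ => appHom c.inv i) (fun _ => appHom c.hom i) (fun _ => appHom c.inv j)
      (fun _ => appHom c.hom j) (fun _ => naturality c.inv f) (fun _ => naturality c.hom f) ?_ ?_
    · exact (Fintype.sum_unique _).trans (congrArg (eval i).map c.inv_hom_id)
    · exact (Fintype.sum_unique _).trans (congrArg (eval j).map c.inv_hom_id)

lemma DualModuleSystem.isCartesian_of_dual {X : DualModuleSystem E C} (h : X.dual.IsCartesian) :
    X.IsCartesian := fun {i j} f => by
  let : Module (E.obj i) (E.obj j) := Module.compHom _ (E.map f).hom.toRingHom
  exact isHom_of_isTensor_dual (fun _ => comp_rightAdjointMate.symm) (h f)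

variable [SymmetricCategory C] [∀ j, IsQuasiSeparable k (E.obj j)]

lemma isFlatSystem_of_iso {X Y : ModuleSystem E C} (hX : isFlatSystem E C X) (c : X ≅ Y) :
    isFlatSystem E C Y :=
  have hX := isFlatSystem_iff.1 hX
  isFlatSystem_iff.2 ⟨fun j => ModuleIn.IsMonoFlat.of_iso (hX.1 j)
    ⟨ModuleSystem.appHom c.hom j, ModuleSystem.appHom c.inv j,
      ModuleIn.hom_ext (congrArg (ModuleSystem.eval j).map c.hom_inv_id),
      ModuleIn.hom_ext (congrArg (ModuleSystem.eval j).map c.inv_hom_id)⟩,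
    ModuleSystem.IsCartesian.of_iso hX.2 c⟩

instance : (dualFunctor E C).Faithful where
  map_injective h := ObjectProperty.hom_ext _ <| DualModuleSystem.hom_ext fun j =>
    (mateEquiv _ _).injective (congrArg (fun t => t.unop.hom.app j) h)

instance : (dualFunctor E C).Full where
  map_surjective {X Y} f := by
    let g (j : J) := (mateEquiv (X.obj.module j).obj (Y.obj.module j).obj).symm (f.unop.hom.app j)
    have hg (j : J) : (g j)ᘁ = f.unop.hom.app j :=
      (mateEquiv (X.obj.module j).obj (Y.obj.module j).obj).apply_symm_apply _
    refine ⟨ObjectProperty.homMk ⟨g, fun j e => (mateEquiv _ _).injective ?_,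
      fun {i j} a => (mateEquiv _ _).injective ?_⟩, Quiver.Hom.unop_inj <|
        ObjectProperty.hom_ext _ <| ModuleSystem.hom_ext hg⟩
    · change rightAdjointMate (_ ≫ _) = rightAdjointMate (_ ≫ _)
      rw [comp_rightAdjointMate, comp_rightAdjointMate, hg]
      exact (f.unop.hom.smul_app j e).symm
    · change rightAdjointMate (_ ≫ _) = rightAdjointMate (_ ≫ _)
      rw [comp_rightAdjointMate, comp_rightAdjointMate, hg, hg]
      exact (f.unop.hom.naturality a).symm

/-- A flat system is isomorphic to the dual of its left dual. Flatness and the Cartesian property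
pass to that double dual, which says that the left dual is injective and Cartesian. -/
instance : (dualFunctor E C).EssSurj where
  mem_essImage W := by
    have h := isFlatSystem_of_iso W.unop.property W.unop.obj.leftDualDualIso
    exact ⟨⟨W.unop.obj.leftDual, h.1, DualModuleSystem.isCartesian_of_dual h.2⟩,
      ⟨((isFlatSystem E C).isoMk (X := W.unop) W.unop.obj.leftDualDualIso).op⟩⟩

instance : (dualFunctor E C).IsEquivalence where

end Equivalence

end Prolong

namespace Prolong

/-! ### Tensor products of pairings -/

section TensorPairing

variable {C : Type u₁} [Category.{v₁} C] [MonoidalCategory C]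

section Braided

variable [BraidedCategory C] {x x' y y' z z' : C}

/-- The tensor product of two pairings. -/
def tensorPairing (p : x' ⊗ x ⟶ 𝟙_ C) (q : y' ⊗ y ⟶ 𝟙_ C) : (x' ⊗ y') ⊗ (x ⊗ y) ⟶ 𝟙_ C :=
  tensorμ x' y' x y ≫ (p ⊗ₘ q) ≫ (λ_ (𝟙_ C)).hom

lemma tensorHom_whiskerRight_tensorPairing {u u' : C} (p : x' ⊗ x ⟶ 𝟙_ C) (q : y' ⊗ y ⟶ 𝟙_ C)
    (a : u ⟶ x') (b : u' ⟶ y') :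
    (a ⊗ₘ b) ▷ (x ⊗ y) ≫ tensorPairing p q = tensorPairing (a ▷ x ≫ p) (b ▷ y ≫ q) := by
  rw [tensorPairing, tensorPairing, tensorμ_natural_left_assoc, tensorHom_comp_tensorHom_assoc]

lemma whiskerLeft_tensorHom_tensorPairing {u u' : C} (p : x' ⊗ x ⟶ 𝟙_ C) (q : y' ⊗ y ⟶ 𝟙_ C)
    (a : u ⟶ x) (b : u' ⟶ y) :
    (x' ⊗ y') ◁ (a ⊗ₘ b) ≫ tensorPairing p q = tensorPairing (x' ◁ a ≫ p) (y' ◁ b ≫ q) := by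
  rw [tensorPairing, tensorPairing, tensorμ_natural_right_assoc, tensorHom_comp_tensorHom_assoc]

lemma associator_tensorPairing (p : x' ⊗ x ⟶ 𝟙_ C) (q : y' ⊗ y ⟶ 𝟙_ C) (r : z' ⊗ z ⟶ 𝟙_ C) :
    ((α_ x' y' z').hom ⊗ₘ (α_ x y z).hom) ≫ tensorPairing p (tensorPairing q r) =
      tensorPairing (tensorPairing p q) r := by
  have h₁ : (p ⊗ₘ tensorPairing q r) = _ ◁ tensorμ y' z' y z ≫ (p ⊗ₘ (q ⊗ₘ r)) ≫
      _ ◁ (λ_ (𝟙_ C)).hom := by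
    rw [tensorPairing, tensorHom_def', tensorHom_def' p (q ⊗ₘ r)]
    simp only [MonoidalCategory.whiskerLeft_comp, Category.assoc, ← whisker_exchange]
  have h₂ : (tensorPairing p q ⊗ₘ r) = tensorμ x' y' x y ▷ _ ≫ ((p ⊗ₘ q) ⊗ₘ r) ≫
      (λ_ (𝟙_ C)).hom ▷ _ := by
    rw [tensorPairing, MonoidalCategory.tensorHom_def, MonoidalCategory.tensorHom_def (p ⊗ₘ q)]
    simp only [comp_whiskerRight, Category.assoc, whisker_exchange]
  rw [tensorPairing, h₁, tensorPairing, h₂]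
  simp only [Category.assoc]
  rw [← associator_monoidal_assoc, ← associator_naturality_assoc]
  congr 3
  monoidal

lemma tensorPairing_leftUnitor (q : y' ⊗ y ⟶ 𝟙_ C) :
    tensorPairing (λ_ (𝟙_ C)).hom q = ((λ_ y').hom ⊗ₘ (λ_ y).hom) ≫ q := by
  rw [tensorPairing, leftUnitor_monoidal, MonoidalCategory.tensorHom_def]
  simp

lemma tensorPairing_rightUnitor (p : x' ⊗ x ⟶ 𝟙_ C) :
    tensorPairing p (λ_ (𝟙_ C)).hom = ((ρ_ x').hom ⊗ₘ (ρ_ x).hom) ≫ p := by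
  rw [tensorPairing, rightUnitor_monoidal, MonoidalCategory.tensorHom_def', unitors_equal]
  simp

end Braided

section Symmetric

variable [SymmetricCategory C] {x x' y y' : C}

lemma tensorμ_braiding (x' y' x y : C) :
    ((β_ x' y').hom ⊗ₘ (β_ x y).hom) ≫ tensorμ y' x' y x =
      tensorμ x' y' x y ≫ (β_ (x' ⊗ x) (y' ⊗ y)).hom := by
  simp [tensorμ, SymmetricCategory.braiding_swap_eq_inv_braiding x y', MonoidalCategory.tensorHom_def]

lemma braiding_tensorPairing (p : x' ⊗ x ⟶ 𝟙_ C) (q : y' ⊗ y ⟶ 𝟙_ C) :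
    ((β_ x' y').hom ⊗ₘ (β_ x y).hom) ≫ tensorPairing q p = tensorPairing p q := by
  rw [tensorPairing, ← Category.assoc, tensorμ_braiding, Category.assoc,
    ← BraidedCategory.braiding_naturality_assoc, braiding_leftUnitor, tensorPairing, unitors_equal]

/-- Naturality of the braiding in `p` lets `y'` pass across the pair `x' ⊗ x`; symmetry replaces one
of the two crossings by its inverse. -/
lemma braiding_whiskerRight_pairing (p : x' ⊗ x ⟶ 𝟙_ C) (y' : C) :
    (β_ x' y').hom ▷ x ≫ (α_ y' x' x).hom ≫ y' ◁ p ≫ (ρ_ y').hom =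
      (α_ x' y' x).hom ≫ x' ◁ (β_ y' x).hom ≫ (α_ x' x y').inv ≫ p ▷ y' ≫ (λ_ y').hom := by
  have h := BraidedCategory.braiding_naturality_left p y'
  rw [BraidedCategory.braiding_tensor_left_hom] at h
  rw [← cancel_epi ((α_ x' x y').hom ≫ x' ◁ (β_ x y').hom ≫ (α_ x' y' x).inv)]
  simp only [Category.assoc] at h ⊢
  rw [← braiding_rightUnitor, reassoc_of% h, Iso.inv_hom_id_assoc,
    ← MonoidalCategory.whiskerLeft_comp_assoc, SymmetricCategory.symmetry,
    MonoidalCategory.whiskerLeft_id, Category.id_comp, Iso.hom_inv_id_assoc]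

/-- The tensor product of two exact pairings. -/
abbrev tensorExactPairing (x x' y y' : C) [ExactPairing x x'] [ExactPairing y y'] :
    ExactPairing (x ⊗ y) (x' ⊗ y') := exactPairingCongrRight (β_ x' y')

/-- The standard dual of `x ⊗ y` is `y' ⊗ x'`. After swapping its factors the evaluation is the
product of the two evaluations, the form in which the canonical duality is stated. -/
lemma tensorExactPairing_evaluation (x x' y y' : C) [ExactPairing x x'] [ExactPairing y y'] :
    (tensorExactPairing x x' y y').evaluation' = tensorPairing (ε_ x x') (ε_ y y') := by
  change (β_ x' y').hom ▷ (x ⊗ y) ≫ ε_ (x ⊗ y) (y' ⊗ x') = _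
  rw [ExactPairing.tensor_evaluation]
  calc
    _ = 𝟙 _ ⊗≫ ((β_ x' y').hom ▷ x ≫ (α_ y' x' x).hom ≫ y' ◁ ε_ x x' ≫ (ρ_ y').hom) ▷ y ⊗≫
        ε_ y y' := by monoidal
    _ = _ := by
      rw [braiding_whiskerRight_pairing, tensorPairing, MonoidalCategory.tensorHom_def, tensorμ]
      monoidal

/-- Morphisms to a tensor product are pairings with the tensor product of the duals. -/
def tensorPairEquiv (T x x' y y' : C) [ExactPairing x x'] [ExactPairing y y'] :
    (T ⟶ x ⊗ y) ≃ ((x' ⊗ y') ⊗ T ⟶ 𝟙_ C) :=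
  letI := tensorExactPairing x x' y y'
  pairEquiv T (x ⊗ y) (x' ⊗ y')

lemma tensorPairEquiv_apply {T : C} [ExactPairing x x'] [ExactPairing y y'] (f : T ⟶ x ⊗ y) :
    tensorPairEquiv T x x' y y' f = (x' ⊗ y') ◁ f ≫ tensorPairing (ε_ x x') (ε_ y y') :=
  congrArg _ (tensorExactPairing_evaluation x x' y y')

/-- Pairing with `x' ⊗ y'` is injective and turns the square into its transpose. It yields
naturality and compatibility with transitions for dual tensor products from those for tensor
products. -/
lemma transpose_comm {z z' x₁ x₁' y₁ y₁' z₁ z₁' : C} [ExactPairing x x'] [ExactPairing y y']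
    [ExactPairing z z'] [ExactPairing x₁ x₁'] [ExactPairing y₁ y₁'] [ExactPairing z₁ z₁']
    {d : z ⟶ x ⊗ y} {p : x' ⊗ y' ⟶ z'} {d₁ : z₁ ⟶ x₁ ⊗ y₁} {p₁ : x₁' ⊗ y₁' ⟶ z₁'}
    (hd : (x' ⊗ y') ◁ d ≫ tensorPairing (ε_ x x') (ε_ y y') = p ▷ z ≫ ε_ z z')
    (hd₁ : (x₁' ⊗ y₁') ◁ d₁ ≫ tensorPairing (ε_ x₁ x₁') (ε_ y₁ y₁') = p₁ ▷ z₁ ≫ ε_ z₁ z₁')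
    {a : x₁ ⟶ x} {a' : x' ⟶ x₁'} (ha : a' ▷ x₁ ≫ ε_ x₁ x₁' = x' ◁ a ≫ ε_ x x')
    {b : y₁ ⟶ y} {b' : y' ⟶ y₁'} (hb : b' ▷ y₁ ≫ ε_ y₁ y₁' = y' ◁ b ≫ ε_ y y')
    {c : z₁ ⟶ z} {c' : z' ⟶ z₁'} (hc : c' ▷ z₁ ≫ ε_ z₁ z₁' = z' ◁ c ≫ ε_ z z')
    (h : p ≫ c' = (a' ⊗ₘ b') ≫ p₁) : c ≫ d = d₁ ≫ (a ⊗ₘ b) := by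
  apply (tensorPairEquiv z₁ x x' y y').injective
  rw [tensorPairEquiv_apply, tensorPairEquiv_apply, MonoidalCategory.whiskerLeft_comp_assoc, hd,
    whisker_exchange_assoc, ← hc, ← comp_whiskerRight_assoc, h, comp_whiskerRight_assoc, ← hd₁,
    ← whisker_exchange_assoc, tensorHom_whiskerRight_tensorPairing, ha, hb,
    MonoidalCategory.whiskerLeft_comp_assoc, whiskerLeft_tensorHom_tensorPairing]

lemma transpose_unit_comm {z z' z₁ z₁' : C} [ExactPairing z z'] [ExactPairing z₁ z₁']
    {d : z ⟶ 𝟙_ C} {e : 𝟙_ C ⟶ z'} {d₁ : z₁ ⟶ 𝟙_ C} {e₁ : 𝟙_ C ⟶ z₁'}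
    (hd : 𝟙_ C ◁ d ≫ (λ_ (𝟙_ C)).hom = e ▷ z ≫ ε_ z z')
    (hd₁ : 𝟙_ C ◁ d₁ ≫ (λ_ (𝟙_ C)).hom = e₁ ▷ z₁ ≫ ε_ z₁ z₁')
    {c : z₁ ⟶ z} {c' : z' ⟶ z₁'} (hc : c' ▷ z₁ ≫ ε_ z₁ z₁' = z' ◁ c ≫ ε_ z z')
    (h : e ≫ c' = e₁) : c ≫ d = d₁ := by
  rw [← cancel_epi (λ_ z₁).hom, ← leftUnitor_naturality, ← leftUnitor_naturality, hd₁,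
    MonoidalCategory.whiskerLeft_comp_assoc, hd, whisker_exchange_assoc, ← hc,
    ← comp_whiskerRight_assoc, h]

end Symmetric

end TensorPairing

end Prolong

namespace Prolong

open Functor.LaxMonoidal Functor.OplaxMonoidal

/-! ### Oplax structures from pairings with lax functors -/

section LeftOp

universe v₃ u₃

variable {P : Type u₂} [Category.{v₂} P] {Q : Type u₃} [Category.{v₃} Q] [MonoidalCategory P]
  [MonoidalCategory Q]

/-- The structure morphisms of an oplax functor to an opposite category, read backwards, are those
of a lax functor. -/
instance laxMonoidalLeftOp (F : P ⥤ Qᵒᵖ) [F.OplaxMonoidal] : F.leftOp.LaxMonoidal where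
  ε := (η F).unop
  μ X Y := (δ F X.unop Y.unop).unop
  μ_natural_left f X := Quiver.Hom.op_inj (by simp)
  μ_natural_right X f := Quiver.Hom.op_inj (by simp)
  associativity X Y Z := Quiver.Hom.op_inj (by simp)
  left_unitality X := Quiver.Hom.op_inj (by simp)
  right_unitality X := Quiver.Hom.op_inj (by simp)

instance laxBraidedLeftOp [BraidedCategory P] [BraidedCategory Q] (F : P ⥤ Qᵒᵖ) [F.Braided] :
    F.leftOp.LaxBraided where
  braided X Y := Quiver.Hom.op_inj <| by
    have h : δ F Y.unop X.unop ≫ (β_ _ _).hom =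
        F.map (β_ Y.unop X.unop).hom ≫ δ F X.unop Y.unop := by simp
    exact h.symm

end LeftOp

section

variable {P : Type u₂} [Category.{v₂} P] [MonoidalCategory P] {C : Type u₁} [Category.{v₁} C]
  [MonoidalCategory C] [SymmetricCategory C] {U : P ⥤ C} {V : Pᵒᵖ ⥤ C} [V.LaxMonoidal]
  [∀ X : P, ExactPairing (U.obj X) (V.obj (op X))]

/-- The tensorator of a lax functor on the opposite category. -/
def opμ (V : Pᵒᵖ ⥤ C) [V.LaxMonoidal] (X Y : P) :
    V.obj (op X) ⊗ V.obj (op Y) ⟶ V.obj (op (X ⊗ Y)) := μ V (op X) (op Y)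

/-- The unit of a lax functor on the opposite category. -/
def opε (V : Pᵒᵖ ⥤ C) [V.LaxMonoidal] : 𝟙_ C ⟶ V.obj (op (𝟙_ P)) := ε V

lemma opμ_natural (V : Pᵒᵖ ⥤ C) [V.LaxMonoidal] {X X' Y Y' : P} (f : X ⟶ Y) (g : X' ⟶ Y') :
    (V.map f.op ⊗ₘ V.map g.op) ≫ opμ V X X' = opμ V Y Y' ≫ V.map (f ⊗ₘ g).op :=
  μ_natural V f.op g.op

lemma opμ_associativity (V : Pᵒᵖ ⥤ C) [V.LaxMonoidal] (X Y Z : P) :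
    opμ V X Y ▷ V.obj (op Z) ≫ opμ V (X ⊗ Y) Z =
      (α_ _ _ _).hom ≫ V.obj (op X) ◁ opμ V Y Z ≫ opμ V X (Y ⊗ Z) ≫ V.map (α_ X Y Z).hom.op := by
  have h := associativity V (op X) (op Y) (op Z)
  have h' : V.map (α_ X Y Z).inv.op ≫ V.map (α_ X Y Z).hom.op = 𝟙 _ := by
    rw [← V.map_comp, ← op_comp, Iso.hom_inv_id, op_id, V.map_id]
  have h'' := congrArg (fun t => t ≫ V.map (α_ X Y Z).hom.op) h
  simp only [Category.assoc] at h''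
  refine Eq.trans ?_ h''
  refine (Category.comp_id _).symm.trans ?_
  rw [← h']
  exact Category.assoc _ _ _

lemma op_left_unitality (V : Pᵒᵖ ⥤ C) [V.LaxMonoidal] (X : P) :
    opε V ▷ V.obj (op X) ≫ opμ V (𝟙_ P) X ≫ V.map (λ_ X).inv.op = (λ_ _).hom :=
  (left_unitality V (op X)).symm

lemma op_right_unitality (V : Pᵒᵖ ⥤ C) [V.LaxMonoidal] (X : P) :
    V.obj (op X) ◁ opε V ≫ opμ V X (𝟙_ P) ≫ V.map (ρ_ X).inv.op = (ρ_ _).hom :=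
  (right_unitality V (op X)).symm

lemma opμ_braiding (V : Pᵒᵖ ⥤ C) [BraidedCategory P] [V.LaxBraided] (X Y : P) :
    opμ V Y X ≫ V.map (β_ X Y).hom.op = (β_ _ _).hom ≫ opμ V X Y :=
  Functor.LaxBraided.braided (F := V) (op Y) (op X)

/-- The transpose `U (X ⊗ Y) ⟶ U X ⊗ U Y` of the tensorator of `V`. -/
def transposeμ (U : P ⥤ C) (V : Pᵒᵖ ⥤ C) [V.LaxMonoidal]
    [∀ X : P, ExactPairing (U.obj X) (V.obj (op X))] (X Y : P) :
    U.obj (X ⊗ Y) ⟶ U.obj X ⊗ U.obj Y :=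
  (tensorPairEquiv _ (U.obj X) (V.obj (op X)) (U.obj Y) (V.obj (op Y))).symm
    (opμ V X Y ▷ U.obj (X ⊗ Y) ≫ ε_ (U.obj (X ⊗ Y)) (V.obj (op (X ⊗ Y))))

lemma transposeμ_pairing (X Y : P) :
    (V.obj (op X) ⊗ V.obj (op Y)) ◁ transposeμ U V X Y ≫
      tensorPairing (ε_ (U.obj X) (V.obj (op X))) (ε_ (U.obj Y) (V.obj (op Y))) =
    opμ V X Y ▷ U.obj (X ⊗ Y) ≫ ε_ (U.obj (X ⊗ Y)) (V.obj (op (X ⊗ Y))) :=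
  (tensorPairEquiv_apply _).symm.trans (Equiv.apply_symm_apply _ _)

/-- The transpose `U 𝟙 ⟶ 𝟙` of the unit of `V`. -/
def transposeε (U : P ⥤ C) (V : Pᵒᵖ ⥤ C) [V.LaxMonoidal]
    [∀ X : P, ExactPairing (U.obj X) (V.obj (op X))] : U.obj (𝟙_ P) ⟶ 𝟙_ C :=
  (λ_ _).inv ≫ opε V ▷ U.obj (𝟙_ P) ≫ ε_ (U.obj (𝟙_ P)) (V.obj (op (𝟙_ P)))

lemma transposeε_pairing :
    𝟙_ C ◁ transposeε U V ≫ (λ_ (𝟙_ C)).hom =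
      opε V ▷ U.obj (𝟙_ P) ≫ ε_ (U.obj (𝟙_ P)) (V.obj (op (𝟙_ P))) := by
  rw [leftUnitor_naturality, transposeε, Iso.hom_inv_id_assoc]

variable (h : ∀ {X Y : P} (f : X ⟶ Y),
  V.map f.op ▷ U.obj X ≫ ε_ (U.obj X) (V.obj (op X)) =
    V.obj (op Y) ◁ U.map f ≫ ε_ (U.obj Y) (V.obj (op Y)))

include h

lemma transposeμ_natural {X X' Y Y' : P} (f : X ⟶ Y) (g : X' ⟶ Y') :
    transposeμ U V X X' ≫ (U.map f ⊗ₘ U.map g) = U.map (f ⊗ₘ g) ≫ transposeμ U V Y Y' :=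
  (transpose_comm (transposeμ_pairing Y Y') (transposeμ_pairing X X') (h f) (h g) (h (f ⊗ₘ g))
    (opμ_natural V f g).symm).symm

/-- Paired with the triple product of the values of `V`, the two sides become the two iterated
tensorators of `V` followed by evaluation; these agree by associativity of `V`. The hypothesis `h`
says that `V.map f.op` is the transpose of `U.map f`. -/
lemma transposeμ_associativity (X Y Z : P) :
    transposeμ U V (X ⊗ Y) Z ≫ transposeμ U V X Y ▷ U.obj Z ≫
      (α_ (U.obj X) (U.obj Y) (U.obj Z)).hom =
    U.map (α_ X Y Z).hom ≫ transposeμ U V X (Y ⊗ Z) ≫ U.obj X ◁ transposeμ U V Y Z := by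
  -- Treats `U Y ⊗ U Z` as one factor, so that pairings with a twofold product suffice for the
  -- threefold one.
  let := tensorExactPairing (U.obj Y) (V.obj (op Y)) (U.obj Z) (V.obj (op Z))
  have hε : ε_ (U.obj Y ⊗ U.obj Z) (V.obj (op Y) ⊗ V.obj (op Z)) = tensorPairing _ _ :=
    tensorExactPairing_evaluation _ _ _ _
  apply (tensorPairEquiv _ (U.obj X) (V.obj (op X)) (U.obj Y ⊗ U.obj Z)
    (V.obj (op Y) ⊗ V.obj (op Z))).injective
  rw [tensorPairEquiv_apply, tensorPairEquiv_apply, hε,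
    ← cancel_epi ((α_ (V.obj (op X)) (V.obj (op Y)) (V.obj (op Z))).hom ▷ _)]
  calc
    _ = _ ◁ transposeμ U V (X ⊗ Y) Z ≫ _ ◁ (transposeμ U V X Y ⊗ₘ 𝟙 (U.obj Z)) ≫
        ((α_ _ _ _).hom ⊗ₘ (α_ _ _ _).hom) ≫ tensorPairing (ε_ (U.obj X) (V.obj (op X)))
          (tensorPairing (ε_ (U.obj Y) (V.obj (op Y))) (ε_ (U.obj Z) (V.obj (op Z)))) := by
      simp only [← whisker_exchange_assoc, MonoidalCategory.whiskerLeft_comp, Category.assoc,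
        MonoidalCategory.tensorHom_def, MonoidalCategory.whiskerLeft_id, Category.comp_id]
    _ = (opμ V X Y ▷ V.obj (op Z) ≫ opμ V (X ⊗ Y) Z) ▷ _ ≫ ε_ _ _ := by
      rw [associator_tensorPairing, whiskerLeft_tensorHom_tensorPairing, transposeμ_pairing,
        MonoidalCategory.whiskerLeft_id, Category.id_comp]
      have := tensorHom_whiskerRight_tensorPairing (ε_ (U.obj (X ⊗ Y)) (V.obj (op (X ⊗ Y))))
        (ε_ (U.obj Z) (V.obj (op Z))) (opμ V X Y) (𝟙 _)
      rw [id_whiskerRight, Category.id_comp] at this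
      rw [← this, whisker_exchange_assoc, transposeμ_pairing, tensorHom_id,
        comp_whiskerRight_assoc]
    _ = _ := by
      have := tensorHom_whiskerRight_tensorPairing (ε_ (U.obj X) (V.obj (op X)))
        (ε_ (U.obj (Y ⊗ Z)) (V.obj (op (Y ⊗ Z)))) (𝟙 _) (opμ V Y Z)
      rw [id_whiskerRight, Category.id_comp] at this
      rw [MonoidalCategory.whiskerLeft_comp_assoc, MonoidalCategory.whiskerLeft_comp_assoc,
        ← id_tensorHom (U.obj X), whiskerLeft_tensorHom_tensorPairing, transposeμ_pairing,
        MonoidalCategory.whiskerLeft_id, Category.id_comp, ← this, whisker_exchange_assoc,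
        transposeμ_pairing, opμ_associativity, whisker_exchange_assoc, whisker_exchange_assoc, ← h, id_tensorHom]
      simp only [comp_whiskerRight, Category.assoc]

lemma transpose_left_unitality (X : P) :
    (λ_ (U.obj X)).inv = U.map (λ_ X).inv ≫ transposeμ U V (𝟙_ P) X ≫
      transposeε U V ▷ U.obj X := by
  rw [← cancel_mono (λ_ _).hom, Iso.inv_hom_id]
  apply (pairEquiv _ (U.obj X) (V.obj (op X))).injective
  rw [pairEquiv_apply, pairEquiv_apply, ← cancel_epi ((λ_ (V.obj (op X))).hom ▷ _),
    MonoidalCategory.whiskerLeft_id, Category.id_comp, ← op_left_unitality]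
  symm
  calc
    _ = _ ◁ U.map (λ_ X).inv ≫ _ ◁ transposeμ U V (𝟙_ P) X ≫
        _ ◁ (transposeε U V ⊗ₘ 𝟙 (U.obj X)) ≫ ((λ_ _).hom ⊗ₘ (λ_ _).hom) ≫
          ε_ (U.obj X) (V.obj (op X)) := by
      simp only [op_left_unitality, ← whisker_exchange_assoc, MonoidalCategory.whiskerLeft_comp, Category.assoc,
        MonoidalCategory.tensorHom_def, MonoidalCategory.whiskerLeft_id, Category.comp_id]
    _ = _ := by
      have := tensorHom_whiskerRight_tensorPairing (ε_ (U.obj (𝟙_ P)) (V.obj (op (𝟙_ P))))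
        (ε_ (U.obj X) (V.obj (op X))) (opε V) (𝟙 _)
      rw [id_whiskerRight, Category.id_comp] at this
      rw [← tensorPairing_leftUnitor, whiskerLeft_tensorHom_tensorPairing, transposeε_pairing,
        MonoidalCategory.whiskerLeft_id, Category.id_comp, ← this, whisker_exchange_assoc,
        transposeμ_pairing, whisker_exchange_assoc, whisker_exchange_assoc, ← h, tensorHom_id]
      simp only [comp_whiskerRight, Category.assoc]

lemma transpose_right_unitality (X : P) :
    (ρ_ (U.obj X)).inv = U.map (ρ_ X).inv ≫ transposeμ U V X (𝟙_ P) ≫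
      U.obj X ◁ transposeε U V := by
  rw [← cancel_mono (ρ_ _).hom, Iso.inv_hom_id]
  apply (pairEquiv _ (U.obj X) (V.obj (op X))).injective
  rw [pairEquiv_apply, pairEquiv_apply, ← cancel_epi ((ρ_ (V.obj (op X))).hom ▷ _),
    MonoidalCategory.whiskerLeft_id, Category.id_comp, ← op_right_unitality]
  symm
  calc
    _ = _ ◁ U.map (ρ_ X).inv ≫ _ ◁ transposeμ U V X (𝟙_ P) ≫
        _ ◁ (𝟙 (U.obj X) ⊗ₘ transposeε U V) ≫ ((ρ_ _).hom ⊗ₘ (ρ_ _).hom) ≫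
          ε_ (U.obj X) (V.obj (op X)) := by
      simp only [op_right_unitality, ← whisker_exchange_assoc, MonoidalCategory.whiskerLeft_comp, Category.assoc,
        MonoidalCategory.tensorHom_def, id_whiskerRight, Category.id_comp]
    _ = _ := by
      have := tensorHom_whiskerRight_tensorPairing (ε_ (U.obj X) (V.obj (op X)))
        (ε_ (U.obj (𝟙_ P)) (V.obj (op (𝟙_ P)))) (𝟙 _) (opε V)
      rw [id_whiskerRight, Category.id_comp] at this
      rw [← tensorPairing_rightUnitor, whiskerLeft_tensorHom_tensorPairing, transposeε_pairing,
        MonoidalCategory.whiskerLeft_id, Category.id_comp, ← this, whisker_exchange_assoc,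
        transposeμ_pairing, whisker_exchange_assoc, whisker_exchange_assoc, ← h, id_tensorHom]
      simp only [comp_whiskerRight, Category.assoc]

/-- The oplax structure on a functor whose values are paired with those of a lax functor. -/
abbrev oplaxOfPairing : U.OplaxMonoidal where
  η := transposeε U V
  δ := transposeμ U V
  δ_natural_left f X := by
    have := transposeμ_natural h f (𝟙 X)
    rwa [U.map_id, tensorHom_id, tensorHom_id] at this
  δ_natural_right X f := by
    have := transposeμ_natural h (𝟙 X) f
    rwa [U.map_id, id_tensorHom, id_tensorHom] at this
  oplax_associativity := transposeμ_associativity h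
  oplax_left_unitality := transpose_left_unitality h
  oplax_right_unitality := transpose_right_unitality h

end

lemma transposeμ_braiding {P : Type u₂} [Category.{v₂} P] [MonoidalCategory P] [BraidedCategory P]
    {C : Type u₁} [Category.{v₁} C] [MonoidalCategory C] [SymmetricCategory C] {U : P ⥤ C}
    {V : Pᵒᵖ ⥤ C} [V.LaxBraided] [∀ X : P, ExactPairing (U.obj X) (V.obj (op X))]
    (h : ∀ {X Y : P} (f : X ⟶ Y),
      V.map f.op ▷ U.obj X ≫ ε_ (U.obj X) (V.obj (op X)) =
        V.obj (op Y) ◁ U.map f ≫ ε_ (U.obj Y) (V.obj (op Y))) (X Y : P) :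
    transposeμ U V X Y ≫ (β_ (U.obj X) (U.obj Y)).hom =
      U.map (β_ X Y).hom ≫ transposeμ U V Y X := by
  apply (tensorPairEquiv _ (U.obj Y) (V.obj (op Y)) (U.obj X) (V.obj (op X))).injective
  rw [tensorPairEquiv_apply, tensorPairEquiv_apply,
    ← cancel_epi ((β_ (V.obj (op X)) (V.obj (op Y))).hom ▷ _)]
  have h₁ := braiding_tensorPairing (ε_ (U.obj X) (V.obj (op X))) (ε_ (U.obj Y) (V.obj (op Y)))
  rw [MonoidalCategory.tensorHom_def, Category.assoc] at h₁
  rw [MonoidalCategory.whiskerLeft_comp_assoc, ← whisker_exchange_assoc, h₁, transposeμ_pairing,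
    MonoidalCategory.whiskerLeft_comp_assoc, transposeμ_pairing, whisker_exchange_assoc,
    ← h, ← comp_whiskerRight_assoc, ← comp_whiskerRight_assoc, Category.assoc, opμ_braiding,
    SymmetricCategory.symmetry_assoc]

end Prolong

namespace Prolong

open Functor.LaxMonoidal Functor.OplaxMonoidal

/-! ### Opposites of symmetric and rigid categories -/

section Opposite

variable {P : Type u₂} [Category.{v₂} P] [MonoidalCategory P]

instance [SymmetricCategory P] : SymmetricCategory Pᵒᵖ where
  symmetry X Y := Quiver.Hom.unop_inj (SymmetricCategory.symmetry (unop X) (unop Y))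

/-- The opposite of an exact pairing. -/
abbrev opExactPairing (X Y : P) [ExactPairing X Y] : ExactPairing (op Y) (op X) where
  coevaluation' := (ε_ X Y).op
  evaluation' := (η_ X Y).op
  coevaluation_evaluation' := Quiver.Hom.unop_inj <| by simp
  evaluation_coevaluation' := Quiver.Hom.unop_inj <| by simp

/-- Passing to the opposite exchanges evaluation and coevaluation, hence left and right duals. -/
instance [RigidCategory P] : RigidCategory Pᵒᵖ where
  leftDual X := { leftDual := op (X.unopᘁ), exact := opExactPairing _ _ }
  rightDual X := { rightDual := op (ᘁX.unop), exact := opExactPairing _ _ }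

end Opposite

/-! ### Dual tensor products from tensor products of duals -/

section Finite

variable {k : Type u} [Field k] {A : Type w} [CommRing A] [Algebra k A]
  {C : Type u₁} [Category.{v₁} C] [Abelian C] [Linear k C] [MonoidalCategory C]
  [SymmetricCategory C] [MonoidalPreadditive C] [MonoidalLinear k C] [RigidCategory C]

/-- Morphisms `T ⟶ Z` are pairings of `T` with `Z^∨`, that is, balanced pairings with `X^∨ ⊗ Y^∨`.
By `hX` and `hY` these are the morphisms `T ⟶ X ⊗ Y` on which the two actions agree. -/
lemma isDualTensorProduct_of_dual {X Y Z : ModuleIn k A C}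
    {p : X.dual.obj ⊗ Y.dual.obj ⟶ Z.dual.obj} (hp : IsTensorProduct X.dual Y.dual Z.dual p)
    {d : Z.obj ⟶ X.obj ⊗ Y.obj}
    (hd : (X.dual.obj ⊗ Y.dual.obj) ◁ d ≫
      tensorPairing (ε_ X.obj X.dual.obj) (ε_ Y.obj Y.dual.obj) =
        p ▷ Z.obj ≫ ε_ Z.obj Z.dual.obj) : IsDualTensorProduct X Y Z d := by
  have hX (a : A) : (X.dual.obj ⊗ Y.dual.obj) ◁ (X.smul a ▷ Y.obj) ≫
      tensorPairing (ε_ X.obj X.dual.obj) (ε_ Y.obj Y.dual.obj) =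
      (X.dual.smul a ▷ Y.dual.obj) ▷ _ ≫
        tensorPairing (ε_ X.obj X.dual.obj) (ε_ Y.obj Y.dual.obj) := by
    rw [← tensorHom_id (X.smul a), ← tensorHom_id (X.dual.smul a),
      whiskerLeft_tensorHom_tensorPairing, tensorHom_whiskerRight_tensorPairing, X.dual_smul_evaluation,
      MonoidalCategory.whiskerLeft_id, id_whiskerRight]
  have hY (a : A) : (X.dual.obj ⊗ Y.dual.obj) ◁ (X.obj ◁ Y.smul a) ≫
      tensorPairing (ε_ X.obj X.dual.obj) (ε_ Y.obj Y.dual.obj) =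
      (X.dual.obj ◁ Y.dual.smul a) ▷ _ ≫
        tensorPairing (ε_ X.obj X.dual.obj) (ε_ Y.obj Y.dual.obj) := by
    rw [← id_tensorHom X.obj, ← id_tensorHom X.dual.obj,
      whiskerLeft_tensorHom_tensorPairing, tensorHom_whiskerRight_tensorPairing, Y.dual_smul_evaluation,
      MonoidalCategory.whiskerLeft_id, id_whiskerRight]
  have inj (T : C) := (tensorPairEquiv T X.obj X.dual.obj Y.obj Y.dual.obj).injective
  refine ⟨fun a => inj _ ?_, fun a => inj _ ?_, fun T g hg => ?_⟩
  · rw [tensorPairEquiv_apply, tensorPairEquiv_apply, MonoidalCategory.whiskerLeft_comp_assoc, hX,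
      whisker_exchange_assoc, hd, ← comp_whiskerRight_assoc, hp.smul_left,
      comp_whiskerRight_assoc, Z.dual_smul_evaluation, ← whisker_exchange_assoc,
      MonoidalCategory.whiskerLeft_comp_assoc, hd]
  · rw [tensorPairEquiv_apply, tensorPairEquiv_apply, MonoidalCategory.whiskerLeft_comp_assoc, hY,
      whisker_exchange_assoc, hd, ← comp_whiskerRight_assoc, hp.smul_right,
      comp_whiskerRight_assoc, Z.dual_smul_evaluation, ← whisker_exchange_assoc,
      MonoidalCategory.whiskerLeft_comp_assoc, hd]
  · refine existsUnique_congr_equiv (pairEquiv T Z.obj Z.dual.obj) (fun t => ?_)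
      (hp.existsUnique_whiskerRight T
        (tensorPairEquiv T X.obj X.dual.obj Y.obj Y.dual.obj g) fun a => ?_)
    · rw [← (inj T).eq_iff, tensorPairEquiv_apply, MonoidalCategory.whiskerLeft_comp_assoc, hd,
        pairEquiv_apply, whisker_exchange_assoc]
    · rw [tensorPairEquiv_apply, ← whisker_exchange_assoc, ← hX, ← whisker_exchange_assoc, ← hY,
        ← MonoidalCategory.whiskerLeft_comp_assoc, hg, MonoidalCategory.whiskerLeft_comp_assoc]

/-- Morphisms `Y ⟶ Z` are pairings on `Z^∨ ⊗ Y`, which is `A ⊗_k Y`, hence `k`-linear maps from `A`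
to `Hom(Y, 𝟙)`. -/
lemma isDualTensorUnit_of_dual {Z : ModuleIn k A C} {e : 𝟙_ C ⟶ Z.dual.obj}
    (he : IsTensorUnit Z.dual e) {d : Z.obj ⟶ 𝟙_ C}
    (hd : 𝟙_ C ◁ d ≫ (λ_ (𝟙_ C)).hom = e ▷ Z.obj ≫ ε_ Z.obj Z.dual.obj) :
    IsDualTensorUnit Z d := by
  have hk (r : k) {T : C} (f : T ⟶ 𝟙_ C) : f ≫ (ModuleIn.trivial k (𝟙_ C)).smul r = r • f := by
    change f ≫ (r • 𝟙 (𝟙_ C)) = r • f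
    simp
  have hZ (r : k) (a : A) : Z.smul (r • a) = r • Z.smul a := map_smul Z.act r a
  refine ⟨fun r a => ?_, fun Y γ hγ => ?_⟩
  · change Z.smul (r • a) ≫ d = (Z.smul a ≫ d) ≫ (ModuleIn.trivial k (𝟙_ C)).smul r
    rw [hk, hZ, Linear.smul_comp]
  · let γ' : A →+ (𝟙_ C ⊗ Y ⟶ 𝟙_ C) := (Preadditive.leftComp (𝟙_ C) (λ_ Y).hom).comp γ
    let β : A →+ (𝟙_ C ⊗ Y ⟶ Z.dual.obj ⊗ Y) :=
      (Functor.mapAddHom (tensorRight Y)).comp (unitMap Z.dual e)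
    refine existsUnique_congr_equiv (pairEquiv Y Z.obj Z.dual.obj) (fun t => ?_)
      ((IsTensor.whiskerRight he Y β fun _ => rfl).existsUnique (𝟙_ C) γ' fun r a => ?_)
    · refine forall_congr' fun a => ?_
      change t ≫ Z.smul a ≫ d = γ a ↔
        (e ≫ Z.dual.smul a) ▷ Y ≫ Z.dual.obj ◁ t ≫ ε_ _ _ = (λ_ Y).hom ≫ γ a
      rw [comp_whiskerRight_assoc, ← whisker_exchange_assoc, Z.dual_smul_evaluation,
        ← whisker_exchange_assoc, ← whisker_exchange_assoc, ← hd, leftUnitor_naturality,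
        leftUnitor_naturality_assoc, leftUnitor_naturality_assoc]
      exact (cancel_epi (λ_ Y).hom).symm
    · have h (g : Y ⟶ 𝟙_ C) : (λ_ Y).hom ≫ (r • g) = (r • 𝟙 (𝟙_ C)) ▷ Y ≫ (λ_ Y).hom ≫ g := by
        simp
      exact (congrArg _ ((hγ r a).trans (hk r (γ a)))).trans (h (γ a))

lemma IsTensor.of_iso {M : Type*} [AddCommGroup M] [Module A M] {X : ModuleIn k A C} {T T' : C}
    {β : M →+ (X.obj ⟶ T)} (h : IsTensor X β) (c : T ≅ T') {β' : M →+ (X.obj ⟶ T')}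
    (hβ' : ∀ m, β' m = β m ≫ c.hom) : IsTensor X β' where
  balanced a m := by rw [hβ', hβ', h.balanced, Category.assoc]
  existsUnique Y γ hγ := existsUnique_congr_equiv (c.homCongr (Iso.refl Y)).symm
    (fun t => forall_congr' fun m => by
      rw [hβ', Category.assoc]
      simp) (h.existsUnique Y γ hγ)

lemma IsTensorUnit.of_iso {Z Z' : ModuleIn k A C} {e : 𝟙_ C ⟶ Z.obj} (h : IsTensorUnit Z e)
    (c : Z ≅ Z') : IsTensorUnit Z' (e ≫ c.hom.hom) :=
  IsTensor.of_iso h ⟨c.hom.hom, c.inv.hom, congrArg ModuleIn.Hom.hom c.hom_inv_id,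
    congrArg ModuleIn.Hom.hom c.inv_hom_id⟩ fun a => by
      change (e ≫ c.hom.hom) ≫ Z'.smul a = (e ≫ Z.smul a) ≫ c.hom.hom
      rw [Category.assoc, Category.assoc, c.hom.smul_hom]

lemma IsDualTensorProduct.hom_ext {X Y Z : ModuleIn k A C} {d : Z.obj ⟶ X.obj ⊗ Y.obj}
    (h : IsDualTensorProduct X Y Z d) {T : C} {f g : T ⟶ Z.obj} (hfg : f ≫ d = g ≫ d) : f = g :=
  (h.existsUnique T (g ≫ d) fun a => by
    rw [Category.assoc, Category.assoc, h.smul_left, h.smul_right]).unique hfg rfl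

end Finite

/-! ### Linearity of the tensor product of systems -/

namespace ModuleSystem

variable {k : Type u} [Field k] {J : Type u₂} [Category.{v₂} J] {E : J ⥤ CommAlgCat.{w} k}
  [∀ j, Module.Finite k (E.obj j)] {C : Type u₁} [Category.{v₁} C] [Abelian C] [Linear k C]
  [MonoidalCategory C] [SymmetricCategory C] [MonoidalPreadditive C] [MonoidalLinear k C]
  [RigidCategory C]

instance (j : J) : (eval (E := E) (C := C) j).Linear k where
  map_smul _ _ := rfl

lemma hom_ext_μ {X Y Z : ModuleSystem E C} {f g : X ⊗ Y ⟶ Z}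
    (h : ∀ j, μ (eval j) X Y ≫ (eval j).map f = μ (eval j) X Y ≫ (eval j).map g) : f = g :=
  hom_ext fun j => (cancel_epi (tmk (X.module j) (Y.module j))).1 (h j)

/-- Additivity is checked after the tensorators, which are epi, where it becomes additivity in `C`.
-/
instance monoidalPreadditive : MonoidalPreadditive (ModuleSystem E C) where
  whiskerLeft_zero := hom_ext_μ fun j => by simp [← μ_natural_right]
  zero_whiskerRight := hom_ext_μ fun j => by simp [← μ_natural_left]
  whiskerLeft_add _ _ := hom_ext_μ fun j => by
    simp [← μ_natural_right, Preadditive.comp_add, MonoidalPreadditive.whiskerLeft_add]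
  add_whiskerRight _ _ := hom_ext_μ fun j => by
    simp [← μ_natural_left, Preadditive.comp_add, MonoidalPreadditive.add_whiskerRight]

instance monoidalLinear : MonoidalLinear k (ModuleSystem E C) where
  whiskerLeft_smul _ _ _ _ _ := hom_ext_μ fun j => by
    simp [← μ_natural_right, Functor.map_smul]
  smul_whiskerRight _ _ _ _ _ := hom_ext_μ fun j => by
    simp [← μ_natural_left, Functor.map_smul]

end ModuleSystem

/-! ### The category of injective modules -/

section

variable {k : Type u} [Field k] {J : Type u₂} [Category.{v₂} J] {E : J ⥤ CommAlgCat.{w} k}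
  [∀ j, Module.Finite k (E.obj j)] {C : Type u₁} [Category.{v₁} C] [Abelian C] [Linear k C]
  {W W' : FlatCat E C}

/-- The isomorphism of members given by an isomorphism of systems. -/
def FlatCat.moduleIso (j : J) (t : W ≅ W') : W.obj.module j ≅ W'.obj.module j :=
  ⟨ModuleSystem.appHom t.hom.hom j, ModuleSystem.appHom t.inv.hom j,
    ModuleIn.hom_ext (congrArg (FlatCat.eval E C j).map t.hom_inv_id),
    ModuleIn.hom_ext (congrArg (FlatCat.eval E C j).map t.inv_hom_id)⟩

lemma FlatCat.map_comp_eval {i j : J} (f : i ⟶ j) (t : W ⟶ W') {S T : C}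
    {a : S ⟶ (FlatCat.eval E C i).obj W} {b : T ⟶ (FlatCat.eval E C j).obj W} {s : S ⟶ T}
    (h : a ≫ W.obj.map f = s ≫ b) :
    (a ≫ (FlatCat.eval E C i).map t) ≫ W'.obj.map f = s ≫ b ≫ (FlatCat.eval E C j).map t := by
  have ht : (FlatCat.eval E C i).map t ≫ W'.obj.map f = W.obj.map f ≫ (FlatCat.eval E C j).map t :=
    (t.hom.naturality f).symm
  exact (Category.assoc _ _ _).trans <| (congrArg (a ≫ ·) ht).trans <|
    (Category.assoc _ _ _).symm.trans <|
      (congrArg (· ≫ (FlatCat.eval E C j).map t) h).trans (Category.assoc _ _ _)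

end

namespace ProlongCat

variable {k : Type u} [Field k] {J : Type u₂} [Category.{v₂} J] (E : J ⥤ CommAlgCat.{w} k)
  [∀ j, IsQuasiSeparable k (E.obj j)] (C : Type u₁) [Category.{v₁} C] [Abelian C] [Linear k C]
  [MonoidalCategory C] [SymmetricCategory C] [MonoidalPreadditive C] [MonoidalLinear k C]
  [RigidCategory C]

/-- Duality is an equivalence with the opposite of the flat category, which has finite products; in
a preadditive category these are biproducts. -/
instance hasFiniteBiproducts : HasFiniteBiproducts (ProlongCat E C) :=
  have : HasFiniteProducts (ProlongCat E C) :=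
    ⟨fun _ => Adjunction.hasLimitsOfShape_of_equivalence (dualFunctor E C)⟩
  HasFiniteBiproducts.of_hasFiniteProducts

/-- The monoidal structure transported from the category of flat modules along duality. -/
instance monoidalCategory : MonoidalCategory (ProlongCat E C) :=
  inferInstanceAs (MonoidalCategory (Monoidal.Transported (dualFunctor E C).asEquivalence.symm))

instance symmetricCategory : SymmetricCategory (ProlongCat E C) :=
  inferInstanceAs (SymmetricCategory (Monoidal.Transported (dualFunctor E C).asEquivalence.symm))

instance braidedDualFunctor : (dualFunctor E C).Braided :=
  inferInstanceAs
    (Monoidal.equivalenceTransported (dualFunctor E C).asEquivalence.symm).inverse.Braided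

/-- The category of injective modules is rigid. -/
instance rigidCategory : RigidCategory (ProlongCat E C) :=
  rigidCategoryOfEquivalence (F := dualFunctor E C) (dualFunctor E C).asEquivalence.toAdjunction

/-- The functor sending a system to the dual of its member at `j`. -/
abbrev dualEval (j : J) : (ProlongCat E C)ᵒᵖ ⥤ C := (dualFunctor E C).leftOp ⋙ FlatCat.eval E C j

instance (j : J) (X : ProlongCat E C) :
    ExactPairing ((eval E C j).obj X) ((dualEval E C j).obj (op X)) :=
  inferInstanceAs (ExactPairing (X.obj.module j).obj ((X.obj.module j).obj)ᘁ)

lemma dualEval_evaluation (j : J) {X Y : ProlongCat E C} (f : X ⟶ Y) :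
    (dualEval E C j).map f.op ▷ (eval E C j).obj X ≫
      ε_ ((eval E C j).obj X) ((dualEval E C j).obj (op X)) =
    (dualEval E C j).obj (op Y) ◁ (eval E C j).map f ≫
      ε_ ((eval E C j).obj Y) ((dualEval E C j).obj (op Y)) :=
  rightAdjointMate_comp_evaluation (f.hom.app j)

/-- The inclusions are by definition the transposes of the quotient morphisms of the duals, so the
canonical form of the duality holds by construction. -/
instance (j : J) : (eval E C j).OplaxMonoidal :=
  oplaxOfPairing (V := dualEval E C j) (dualEval_evaluation E C j)

lemma isCanonicalDuality : IsCanonicalDuality E C := fun j X Y =>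
  (transposeμ_pairing (U := eval E C j) (V := dualEval E C j) X Y).symm

/-- The tensorator of the duality functor is invertible, so the tensor product of the duals may be
replaced by the dual of the tensor product. -/
lemma isTensorProduct_dual (j : J) (X Y : ProlongCat E C) :
    IsTensorProduct (X.obj.module j).dual (Y.obj.module j).dual ((X ⊗ Y).obj.module j).dual
      (opμ (dualEval E C j) X Y) :=
  ((FlatCat.isLevelwiseTensor E C).isTensorProduct j _ _).of_iso
    (FlatCat.moduleIso j (Functor.Monoidal.μIso (dualFunctor E C) X Y).unop.symm)

lemma isTensorUnit_dual (j : J) :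
    IsTensorUnit ((𝟙_ (ProlongCat E C)).obj.module j).dual (opε (dualEval E C j)) :=
  ((FlatCat.isLevelwiseTensor E C).isTensorUnit j).of_iso
    (FlatCat.moduleIso j (Functor.Monoidal.εIso (dualFunctor E C)).unop.symm)

lemma dualTensorator_map {i j : J} (f : i ⟶ j) (X Y : ProlongCat E C) :
    opμ (dualEval E C i) X Y ≫ (X ⊗ Y).obj.dual.map f =
      (X.obj.dual.map f ⊗ₘ Y.obj.dual.map f) ≫ opμ (dualEval E C j) X Y :=
  FlatCat.map_comp_eval f (δ (dualFunctor E C) X Y).unop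
    ((FlatCat.isLevelwiseTensor E C).map_tensor f _ _)

lemma dualUnit_map {i j : J} (f : i ⟶ j) :
    opε (dualEval E C i) ≫ (𝟙_ (ProlongCat E C)).obj.dual.map f = opε (dualEval E C j) :=
  (FlatCat.map_comp_eval f (s := 𝟙 _) (η (dualFunctor E C)).unop
    (((FlatCat.isLevelwiseTensor E C).map_unit f).trans (Category.id_comp _).symm)).trans
      (Category.id_comp _)

variable {E C} in
lemma dualMap_evaluation {i j : J} (f : i ⟶ j) (X : ProlongCat E C) :
    (X.obj.dual.map f ▷ _ ≫ ε_ ((eval E C j).obj X) ((dualEval E C j).obj (op X)) :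
      (X.obj.dual.module i).obj ⊗ _ ⟶ _) =
    _ ◁ X.obj.map f ≫ ε_ ((eval E C i).obj X) ((dualEval E C i).obj (op X)) :=
  rightAdjointMate_comp_evaluation (X.obj.map f)

lemma isLevelwiseTensor : ProlongCat.IsLevelwiseTensor E C where
  isDualTensorProduct j X Y := isDualTensorProduct_of_dual (isTensorProduct_dual E C j X Y)
    (transposeμ_pairing (U := eval E C j) (V := dualEval E C j) X Y)
  isDualTensorUnit j := isDualTensorUnit_of_dual (isTensorUnit_dual E C j)
    (transposeε_pairing (U := eval E C j) (V := dualEval E C j))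
  braided j X Y := transposeμ_braiding (V := dualEval E C j) (dualEval_evaluation E C j) X Y
  map_tensor {i j} f X Y :=
    transpose_comm (transposeμ_pairing (U := eval E C i) (V := dualEval E C i) X Y)
      (transposeμ_pairing (U := eval E C j) (V := dualEval E C j) X Y) (dualMap_evaluation f X)
      (dualMap_evaluation f Y) (dualMap_evaluation f (X ⊗ Y)) (dualTensorator_map E C f X Y)
  map_unit {i j} f :=
    transpose_unit_comm (transposeε_pairing (U := eval E C i) (V := dualEval E C i))
      (transposeε_pairing (U := eval E C j) (V := dualEval E C j)) (dualMap_evaluation f _)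
      (dualUnit_map E C f)

variable {E C} in
lemma hom_ext_δ {W X Y : ProlongCat E C} {f g : W ⟶ X ⊗ Y}
    (h : ∀ j, (eval E C j).map f ≫ δ (eval E C j) X Y = (eval E C j).map g ≫ δ (eval E C j) X Y) :
    f = g :=
  ObjectProperty.hom_ext _ <| DualModuleSystem.hom_ext fun j =>
    ((isLevelwiseTensor E C).isDualTensorProduct j X Y).hom_ext (h j)

instance (j : J) : (eval E C j).Additive where
  map_add := rfl

instance (j : J) : (eval E C j).Linear k where
  map_smul _ _ := rfl

instance monoidalPreadditive : MonoidalPreadditive (ProlongCat E C) where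
  whiskerLeft_zero := hom_ext_δ fun j => by simp [← δ_natural_right]
  zero_whiskerRight := hom_ext_δ fun j => by simp [← δ_natural_left]
  whiskerLeft_add _ _ := hom_ext_δ fun j => by
    simp [← δ_natural_right, Preadditive.add_comp, MonoidalPreadditive.whiskerLeft_add]
  add_whiskerRight _ _ := hom_ext_δ fun j => by
    simp [← δ_natural_left, Preadditive.add_comp, MonoidalPreadditive.add_whiskerRight]

instance monoidalLinear : MonoidalLinear k (ProlongCat E C) where
  whiskerLeft_smul _ _ _ _ _ := hom_ext_δ fun j => by
    simp [← δ_natural_right, Functor.map_smul]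
  smul_whiskerRight _ _ _ _ _ := hom_ext_δ fun j => by
    simp [← δ_natural_left, Functor.map_smul]

end ProlongCat

end Prolong

end

theorem mainTheorem3
    {k : Type u} [Field k]
    {C : Type u₁} [Category.{v₁} C] [Abelian C] [Linear k C] [Prolong.IsFiniteLinear k C]
    [MonoidalCategory C] [SymmetricCategory C] [MonoidalPreadditive C] [MonoidalLinear k C]
    [RigidCategory C]
    {J : Type u₂} [Category.{v₂} J] [IsCofiltered J]
    (E : J ⥤ CommAlgCat.{w} k) [∀ j, Prolong.IsQuasiSeparable k (E.obj j)] :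
    HasFiniteBiproducts (Prolong.FlatCat E C) ∧ HasFiniteBiproducts (Prolong.ProlongCat E C) ∧
    ∃ (_ : MonoidalCategory (Prolong.FlatCat E C)) (_ : SymmetricCategory (Prolong.FlatCat E C))
      (_ : ∀ j, (Prolong.FlatCat.eval E C j).LaxBraided)
      (_ : MonoidalCategory (Prolong.ProlongCat E C))
      (_ : SymmetricCategory (Prolong.ProlongCat E C))
      (_ : ∀ j, (Prolong.ProlongCat.eval E C j).OplaxMonoidal),
      Prolong.FlatCat.IsLevelwiseTensor E C ∧
      Prolong.ProlongCat.IsLevelwiseTensor E C ∧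
      (∃ _ : MonoidalPreadditive (Prolong.FlatCat E C),
        MonoidalLinear k (Prolong.FlatCat E C)) ∧
      (∃ _ : MonoidalPreadditive (Prolong.ProlongCat E C),
        MonoidalLinear k (Prolong.ProlongCat E C)) ∧
      Nonempty (RigidCategory (Prolong.FlatCat E C)) ∧
      Nonempty (RigidCategory (Prolong.ProlongCat E C)) ∧
      (Prolong.dualFunctor E C).IsEquivalence ∧
      ∃ _ : (Prolong.dualFunctor E C).Braided, Prolong.IsCanonicalDuality E C :=
  open Prolong in
  ⟨inferInstance, ProlongCat.hasFiniteBiproducts E C, inferInstance, inferInstance, inferInstance,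
    inferInstance, inferInstance, inferInstance, FlatCat.isLevelwiseTensor E C,
    ProlongCat.isLevelwiseTensor E C, ⟨inferInstance, inferInstance⟩,
    ⟨inferInstance, inferInstance⟩, ⟨inferInstance⟩, ⟨inferInstance⟩, inferInstance,
    inferInstance, ProlongCat.isCanonicalDuality E C⟩
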